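/- **Setting.** Let $G$ be a connected, simply connected, semisimple complex Lie group with Borel subgroup $B$, maximal torus $T\subset B$, Weyl group $W$ with its length function, root system $\Phi$, simple roots $\Delta^+$, root lattice $Q=\langle\Phi\rangle_{\mathbb Z}$, cocharacter lattice $\mathfrak t(\mathbb Z)\subset\mathfrak t=\operatorname{Lie}T$, and $Q^*=\{y\in\mathfrak t:\alpha(y)\in\mathbb Z\ \forall\alpha\in\Phi\}$. For a root $\alpha$ let $\iota_\alpha:\mathrm{SL}_2(\mathbb C)\to G$ be the associated homomorphism, $h_\alpha$ its coroot and $f_\alpha(z)=\iota_\alpha\left(\begin{smallmatrix}0&1\\-1&-z\end{smallmatrix}\right)$. Let ${}^L\tilde G$ be the universal cover of the group with root datum dual to that of $G$. For a finitely generated abelian group $M$ let $M^*=\operatorname{Hom}(M,\mathbb C^\times)$; for a diagonalizable group $D$ let $D^*$ be its group of algebraic characters. **Walks.** A walk associated with a word $\alpha_l\cdots\alpha_1$ in $\Delta^+$ is a sequence $p=(p_0,\dots,p_l)$ in $W$ such that $p_k=s_{\alpha_k}p_{k-1}$ if $\ell(s_{\alpha_k}p_{k-1})>\ell(p_{k-1})$,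 and $p_k\in\{s_{\alpha_k}p_{k-1},p_{k-1}\}$ otherwise. Let $S_p=\{k:p_k=p_{k-1}\}$ and $\pi_k=s_{\alpha_k}\cdots s_{\alpha_1}$. Put $$Q(p)=\langle\pi_k^{-1}\alpha_k:k\in S_p\rangle_{\mathbb Z},\quad T(p)=\langle\pi_k^{-1}h_{\alpha_k}:k\in S_p\rangle_{\mathbb Z},\quad Z(p)=(Q/Q(p))^*,\quad \pi_1(p)=\mathfrak t(\mathbb Z)/T(p).$$ Let $C_p\subset\mathbb C^l$ be the cell of all $z$ with $f_{\alpha_k}(z_k)\cdots f_{\alpha_1}(z_1)p_0B\subset Bp_kB$ for all $k$. The torus $T$ acts on $\mathbb C^l$, $t$ multiplying $z_k$ by $\alpha_k({}^{\pi_{k-1}}t)$; let $S(p)\subset T$ be the subgroup generated by the stabilizers of the points of $C_p$. **Positive genus.** Let $\mathcal V$ be the set of the $$\beta=(\pi_1^{(1)},\pi_2^{(1)},w_1)\cdots(\pi_1^{(g)},\pi_2^{(g)},w_g)\,\alpha_l\cdots\alpha_1\in F(W^3)\times F(\Delta^+)$$ (with $F$ the free monoid) that are associated with $g$ handles and finitely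 many punctures: $w_i=[\pi_1^{(1)},\pi_2^{(1)}]\cdots[\pi_1^{(i-1)},\pi_2^{(i-1)}]$ with $[x,y]=xyx^{-1}y^{-1}$, and $\alpha_l\cdots\alpha_1$ is the concatenation of the words $a_ic_ia_i^tc_i^t$, $i=1,\dots,g$, with $a_i,c_i$ reduced words of $\pi_1^{(i)},\pi_2^{(i)}$, followed by words $d_jd_j^t$ with $d_j$ a minimal lift of an element of $W/W_{I_j}$, $I_j\subset\Delta^+$ (here $u^t$ is the reversed word). For $\beta\in\mathcal V$ and a walk $p$ associated with $\alpha_l\cdots\alpha_1$ with $p_0=p_l=e$, put $$\pi_{1,\beta}(p)=\mathfrak t(\mathbb Z)\Big/\Big(T(p)+\sum_{i,j}(1-\pi_j^{(i)})\mathfrak t(\mathbb Z)\Big),\qquad \tilde\pi_{1,\beta}(p)=\mathfrak t(\mathbb Z)\Big/\Big(T(p)+\sum_{i,j}w_i(\pi_j^{(i)}-1)Q^*\Big),$$ $$S_\beta(p)=\{t\in S(p):{}^{\pi_l}t\text{ is fixed by all }\pi_j^{(i)}\},\qquad Z_\beta(p)=S_\beta(p)/Z(G),$$ $$\tilde S_\beta(p)=\{t\in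 S(p):{}^{\pi_j^{(i)}}s\,s^{-1}\in Z(G)\text{ for all }i,j,\text{ where }s={}^{\pi_l}t\},$$ and let $\tilde Z_\beta(p)$ be the image of $\tilde S_\beta(p)$ in $(T/Z(G))\times T^{2g}$ under $t\mapsto(tZ(G),A(t)^{-1})$. Here $A:T\to T^{2g}$ is the homomorphism by which $T$ acts on the torus components of the cell: with $c_i=w_i\pi_2^{(i)}\pi_1^{(i)}(\pi_2^{(i)})^{-1}(\pi_1^{(i)})^{-1}w_i^{-1}$, $s={}^{w_i^{-1}c_{i+1}\cdots c_g\pi_l}t$ and $(\pi_1,\pi_2)=(\pi_1^{(i)},\pi_2^{(i)})$, the $i$-th pair of components of $A(t)$ is $$\Big({}^{\pi_1^{-1}\pi_2\pi_1\pi_2^{-1}\pi_1^{-1}}s\cdot({}^{\pi_2\pi_1\pi_2^{-1}\pi_1^{-1}}s)^{-1},\ {}^{\pi_1\pi_2^{-1}\pi_1^{-1}}s\cdot({}^{\pi_2\pi_1\pi_2^{-1}\pi_1^{-1}}s)^{-1}\Big).$$ **Duality.** Identify the Weyl group of ${}^L\tilde G$ with $W$ and its simple roots with the simple coroots of $G$.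 This turns $\beta$ and $p$ into $\beta^*$ and $p^*$ for ${}^L\tilde G$. **Statement.** 1. The map $p\mapsto p^*$ is a bijection from the walks associated with a word in $\Delta^+$ to the walks associated with the dual word, and $S_{p^*}=S_p$. For every walk $p$, $$Z(p^*)=\pi_1(p)^*,\qquad\pi_1(p^*)=Z(p)^*.$$ 2. For $\beta\in\mathcal V$ and every walk $p$ associated with it with $p_0=p_l=e$, one has $\beta^*\in\mathcal V_{{}^L\tilde G}$, $p^*$ is a walk associated with $\beta^*$ from $e$ to $e$, and $$\pi_{1,\beta^*}(p^*)=\tilde Z_\beta(p)^*,\quad\tilde Z_{\beta^*}(p^*)=\pi_{1,\beta}(p)^*,\quad\tilde\pi_{1,\beta^*}(p^*)=Z_\beta(p)^*,\quad Z_{\beta^*}(p^*)=\tilde\pi_{1,\beta}(p)^*.$$ Each equality means that the canonical pairing, induced by evaluating roots (of $G$, respectively of ${}^L\tilde G$) on the maximal torus and by identifying the roots of one group with the coroots of the other, is an isomorphism of groups. -/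

import Mathlib

noncomputable section

namespace WalkDuality

section RootData

variable {ι X Y : Type*} [AddCommGroup X] [AddCommGroup Y]

theorem eq_zero_of_mem_rootSpan [Finite ι] (P : RootDatum ι X Y) {x : X}
    (hx : x ∈ P.rootSpan ℤ) (h : ∀ i, P.toLinearMap x (P.coroot i) = 0) : x = 0 := by
  have := Fintype.ofFinite ι
  refine P.eq_zero_of_mem_rootSpan_of_rootForm_self_eq_zero hx ?_
  rw [P.rootForm_apply_apply]
  refine Finset.sum_eq_zero fun i _ => ?_
  have : P.coroot' i x = 0 := h i
  simp [this]

/-- Restriction of a character `x` of the maximal torus to the coroot lattice `Q^∨`, through the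
pairing of characters and cocharacters. -/
def restrictChar (P : RootDatum ι X Y) : X →ₗ[ℤ] Module.Dual ℤ (P.corootSpan ℤ) :=
  (LinearMap.lcomp ℤ ℤ (P.corootSpan ℤ).subtype) ∘ₗ P.toLinearMap

@[simp] theorem restrictChar_apply (P : RootDatum ι X Y) (x : X) (y : P.corootSpan ℤ) :
    restrictChar P x y = P.toLinearMap x y := rfl

theorem restrictChar_injOn [Finite ι] (P : RootDatum ι X Y) {x y : X}
    (hx : x ∈ P.rootSpan ℤ) (hy : y ∈ P.rootSpan ℤ)
    (h : restrictChar P x = restrictChar P y) : x = y := by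
  rw [← sub_eq_zero]
  refine eq_zero_of_mem_rootSpan P (sub_mem hx hy) fun i => ?_
  have := LinearMap.congr_fun h (P.corootSpanMem ℤ i)
  simpa [sub_eq_zero] using this

/-- The root datum of the universal cover of the derived group of the group with root datum `P`:
its cocharacter lattice is the coroot lattice `Q^∨`, its character lattice is the dual lattice of
`Q^∨`, its coroots are those of `P` and its roots are the restrictions of the roots of `P`. For
semisimple groups this is the root datum of the universal cover. -/
def simplyConnectedCover [Finite ι] [Module.Finite ℤ Y] [Module.Free ℤ Y]
    (P : RootDatum ι X Y) :
    RootDatum ι (Module.Dual ℤ (P.corootSpan ℤ)) (P.corootSpan ℤ) where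
  toLinearMap := LinearMap.id
  root := ⟨fun i => restrictChar P (P.root i), fun i j h => P.root.injective
    (restrictChar_injOn P (Submodule.subset_span ⟨i, rfl⟩) (Submodule.subset_span ⟨j, rfl⟩) h)⟩
  coroot := ⟨fun i => P.corootSpanMem ℤ i, fun i j h => P.coroot.injective (congrArg Subtype.val h)⟩
  root_coroot_two i := P.root_coroot_two i
  reflectionPerm := P.reflectionPerm
  reflectionPerm_root i j := by
    have := congrArg (restrictChar P) (P.reflectionPerm_root i j)
    rw [map_sub, map_smul] at this
    exact this
  reflectionPerm_coroot i j := Subtype.ext (P.reflectionPerm_coroot i j)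

/-- Simple roots of the universal cover: the same indices as before. -/
def simplyConnectedCoverBase [Finite ι] [Module.Finite ℤ Y] [Module.Free ℤ Y]
    {P : RootDatum ι X Y} (b : P.Base) : (simplyConnectedCover P).Base where
  support := b.support
  linearIndepOn_root := by
    have h := b.linearIndepOn_root
    refine LinearIndependent.map_injOn (f := restrictChar P) h ?_
    intro x hx y hy hxy
    have key : Submodule.span ℤ (Set.range fun i : b.support => P.root i) ≤ P.rootSpan ℤ :=
      Submodule.span_mono (by rintro _ ⟨i, rfl⟩; exact ⟨i, rfl⟩)
    exact restrictChar_injOn P (key hx) (key hy) hxy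
  linearIndepOn_coroot := by
    have h := b.linearIndepOn_coroot
    exact LinearIndependent.of_comp (P.corootSpan ℤ).subtype h
  root_mem_or_neg_mem i := by
    have key : ∀ x ∈ AddSubmonoid.closure (P.root '' b.support), restrictChar P x ∈
        AddSubmonoid.closure ((simplyConnectedCover P).root '' b.support) := by
      intro x hx
      have := AddSubmonoid.mem_map_of_mem (restrictChar P).toAddMonoidHom hx
      rw [AddMonoidHom.map_mclosure, ← Set.image_comp] at this
      exact this
    rcases b.root_mem_or_neg_mem i with h | h
    · exact Or.inl (key _ h)
    · refine Or.inr ?_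
      have := key _ h
      rwa [map_neg] at this
  coroot_mem_or_neg_mem i := by
    have key : ∀ x : P.corootSpan ℤ, (x : Y) ∈ AddSubmonoid.closure (P.coroot '' b.support) →
        x ∈ AddSubmonoid.closure ((simplyConnectedCover P).coroot '' b.support) := by
      intro x hx
      have himg : P.coroot '' (b.support : Set ι) = (P.corootSpan ℤ).subtype.toAddMonoidHom ''
          ((simplyConnectedCover P).coroot '' b.support) := by
        rw [← Set.image_comp]; rfl
      rw [himg, ← AddMonoidHom.map_mclosure] at hx
      obtain ⟨y, hy, hyx⟩ := hx
      have : y = x := Subtype.ext hyx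
      exact this ▸ hy
    exact (b.coroot_mem_or_neg_mem i).imp (key _) (key (-_))

/-- The Weyl group acts faithfully on the roots. -/
theorem weylGroupToPerm_injective [Finite ι] (P : RootDatum ι X Y) :
    Function.Injective P.weylGroupToPerm := by
  rw [injective_iff_map_eq_one]
  intro g hg
  have hsub : ∀ (g : P.weylGroup) (x : X), g • x - x ∈ P.rootSpan ℤ := by
    rintro ⟨g, hgm⟩
    induction hgm using RootPairing.weylGroup.induction with
    | mem i =>
      intro x
      change P.reflection i x - x ∈ _
      rw [P.reflection_apply, sub_right_comm, sub_self, zero_sub]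
      exact neg_mem (Submodule.smul_mem _ _ (Submodule.subset_span ⟨i, rfl⟩))
    | one => intro x; change x - x ∈ _; simp
    | mul a c ha hc iha ihc =>
      intro x
      have h1 := iha ((⟨c, hc⟩ : P.weylGroup) • x)
      have h2 := add_mem h1 (ihc x)
      rwa [sub_add_sub_cancel, smul_smul] at h2
  have hfix : ∀ x : X, g • x = x := by
    intro x
    rw [← sub_eq_zero]
    refine eq_zero_of_mem_rootSpan P (hsub g x) fun i => ?_
    rw [map_sub, LinearMap.sub_apply, sub_eq_zero]
    have h1 : P.toLinearMap (g • x) (P.coroot i) =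
        P.toLinearMap x ((g : P.Aut).toHom.coweightMap (P.coroot i)) := by
      have := (g : P.Aut).toHom.weight_coweight_transpose_apply (P := P) (Q := P)
      have h := LinearMap.congr_fun (this (P.coroot i)) x
      simp only [LinearMap.dualMap_apply] at h
      exact h
    rw [h1, RootPairing.Hom.coroot_coweightMap_apply]
    have h3 : (g : P.Aut).toHom.indexEquiv = 1 := hg
    rw [h3]; rfl
  apply Subtype.ext
  apply RootPairing.Equiv.weightHom_injective P
  ext x
  exact hfix x

/-- Two root data on the same index set with the same reflection permutations have the same Weyl
group; the isomorphism carries the reflection `s_i` to the reflection `s_i`. -/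
def weylEquiv [Finite ι] {X₂ Y₂ : Type*} [AddCommGroup X₂] [AddCommGroup Y₂]
    (P : RootDatum ι X Y) (Q : RootDatum ι X₂ Y₂) (h : P.reflectionPerm = Q.reflectionPerm) :
    P.weylGroup ≃* Q.weylGroup :=
  ((MonoidHom.ofInjective (weylGroupToPerm_injective P)).trans
    (MulEquiv.subgroupCongr (by
      rw [RootPairing.range_weylGroupToPerm, RootPairing.range_weylGroupToPerm, h]))).trans
    (MonoidHom.ofInjective (weylGroupToPerm_injective Q)).symm

/-- A group with root datum `P` is simply connected (and semisimple) when its fundamental group,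
cocharacters modulo coroots, is trivial. -/
def IsSimplyConnected (P : RootDatum ι X Y) : Prop :=
  P.corootSpan ℤ = ⊤

/-- The root datum of `ᴸG̃`: interchange roots and coroots, then pass to the universal cover. -/
def dualDatum [Finite ι] [Module.Finite ℤ X] [Module.Free ℤ X] (P : RootDatum ι X Y) :
    RootDatum ι (Module.Dual ℤ (P.flip.corootSpan ℤ)) (P.flip.corootSpan ℤ) :=
  simplyConnectedCover P.flip

/-- The simple roots of `ᴸG̃` are the simple coroots of `G`. -/
def dualBase [Finite ι] [Module.Finite ℤ X] [Module.Free ℤ X] {P : RootDatum ι X Y}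
    (b : P.Base) : (dualDatum P).Base :=
  simplyConnectedCoverBase b.flip

/-- The isomorphism `W ≃ W^∨` between the Weyl groups of `G` and `ᴸG̃`, `s_α ↦ s_{α^∨}`. -/
def dualWeyl [Finite ι] [Module.Finite ℤ X] [Module.Free ℤ X] (P : RootDatum ι X Y) :
    P.weylGroup ≃* (dualDatum P).weylGroup :=
  weylEquiv P (dualDatum P) rfl

/-- The action of the Weyl group on the cocharacter lattice `𝔱(ℤ) = Y`. -/
def weylCochar (P : RootDatum ι X Y) (w : P.weylGroup) : Y →ₗ[ℤ] Y :=
  (RootPairing.Equiv.coweightEquiv P P ((w⁻¹ : P.weylGroup) : P.Aut)).toLinearMap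

/-- The action of the Weyl group on the Lie algebra `𝔱 = Hom(X, ℂ)` of the maximal torus. -/
def weylLie (P : RootDatum ι X Y) (w : P.weylGroup) : (X →+ ℂ) →+ (X →+ ℂ) where
  toFun f := f.comp (DistribSMul.toAddMonoidHom X w⁻¹)
  map_zero' := rfl
  map_add' _ _ := rfl

/-- The inclusion `𝔱(ℤ) ⊆ 𝔱`. -/
def cocharToLie (P : RootDatum ι X Y) : Y →+ (X →+ ℂ) where
  toFun y := (Int.castAddHom ℂ).comp (P.toLinearMap.flip y).toAddMonoidHom
  map_zero' := by ext; simp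
  map_add' _ _ := by ext; simp

/-- The lattice `Q^* ⊆ 𝔱` of points at which all roots are integral. -/
def coweightLattice (P : RootDatum ι X Y) : AddSubgroup (X →+ ℂ) where
  carrier := {f | ∀ i, ∃ n : ℤ, f (P.root i) = n}
  zero_mem' _ := ⟨0, by simp⟩
  add_mem' hf hg i := by
    obtain ⟨m, hm⟩ := hf i
    obtain ⟨n, hn⟩ := hg i
    exact ⟨m + n, by simp [hm, hn]⟩
  neg_mem' hf i := by
    obtain ⟨m, hm⟩ := hf i
    exact ⟨-m, by simp [hm]⟩

end RootData

section Diagonalizable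

/-- The diagonalizable group `Hom(M, ℂˣ)` with character group `M`. For `M` the character lattice
of a group it is the maximal torus; for a finitely generated group `M` it is the dual `M^*`. -/
def Diag (M : Type*) [AddCommGroup M] : Type _ := Multiplicative M →* ℂˣ

instance (M : Type*) [AddCommGroup M] : CommGroup (Diag M) :=
  inferInstanceAs (CommGroup (Multiplicative M →* ℂˣ))

/-- The value of the character `m` at `t`. -/
def charValue {M : Type*} [AddCommGroup M] (m : M) (t : Diag M) : ℂˣ :=
  (show Multiplicative M →* ℂˣ from t) (Multiplicative.ofAdd m)

/-- The regular functions on `Hom(M, ℂˣ)`. -/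
def diagRegular (M : Type*) [AddCommGroup M] : Subalgebra ℂ (Diag M → ℂ) :=
  Algebra.adjoin ℂ (Set.range fun (m : M) (t : Diag M) => (charValue m t : ℂ))

variable {A B : Type*}

/-- The regular functions on a quotient group: those whose pullbacks are regular. -/
def quotientRegular [Group A] (O : Subalgebra ℂ (A → ℂ)) (N : Subgroup A) : Subalgebra ℂ (A ⧸ N → ℂ) :=
  Algebra.adjoin ℂ {f | (fun a : A => f (QuotientGroup.mk a)) ∈ O}

/-- The regular functions on a closed subgroup: the restrictions of regular functions. -/
def subgroupRegular [Group A] (O : Subalgebra ℂ (A → ℂ)) (H : Subgroup A) : Subalgebra ℂ (H → ℂ) :=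
  Algebra.adjoin ℂ {f | ∃ F ∈ O, f = fun h : H => F h}

/-- The regular functions on a product. -/
def prodRegular (O₁ : Subalgebra ℂ (A → ℂ)) (O₂ : Subalgebra ℂ (B → ℂ)) :
    Subalgebra ℂ (A × B → ℂ) :=
  Algebra.adjoin ℂ ({f | ∃ F ∈ O₁, f = fun x : A × B => F x.1} ∪
    {f | ∃ F ∈ O₂, f = fun x : A × B => F x.2})

/-- The regular functions on a finite power. -/
def powRegular (κ : Type*) (O : Subalgebra ℂ (A → ℂ)) : Subalgebra ℂ ((κ → A) → ℂ) :=
  Algebra.adjoin ℂ {f | ∃ F ∈ O, ∃ k : κ, f = fun x : κ → A => F (x k)}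

/-- The dual `A^*` of a diagonalizable group `A` with algebra of regular functions `O`: the group
of algebraic characters, that is, of homomorphisms to `ℂˣ` that are regular together with their
inverses. For a finite group these are all the homomorphisms to `ℂˣ`. -/
def charGroup [Group A] (O : Subalgebra ℂ (A → ℂ)) : Subgroup (A →* ℂˣ) where
  carrier := {χ | (fun a => (χ a : ℂ)) ∈ O ∧ (fun a => ((χ⁻¹ : A →* ℂˣ) a : ℂ)) ∈ O}
  one_mem' := by
    have h : (fun _ : A => (1 : ℂ)) ∈ O := O.one_mem
    constructor <;> simpa using h
  mul_mem' {χ ψ} hχ hψ := by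
    constructor
    · convert O.mul_mem hχ.1 hψ.1 using 1
      ext a; simp
    · convert O.mul_mem hχ.2 hψ.2 using 1
      ext a; simp [mul_comm]
  inv_mem' {χ} hχ := ⟨hχ.2, by simpa using hχ.1⟩

end Diagonalizable

section Groups

variable {ι X Y : Type*} [AddCommGroup X] [AddCommGroup Y]

/-- The action `t ↦ ʷt` of the Weyl group on the maximal torus. -/
def weylTorus (P : RootDatum ι X Y) (w : P.weylGroup) : Diag X →* Diag X where
  toFun t := MonoidHom.comp (show Multiplicative X →* ℂˣ from t) (DistribSMul.toAddMonoidHom X w⁻¹).toMultiplicative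
  map_one' := rfl
  map_mul' _ _ := rfl

/-- The one-parameter subgroup `ℂˣ → T` attached to a cocharacter. -/
def cocharTorus (P : RootDatum ι X Y) (y : Y) (a : ℂˣ) : Diag X :=
  show Multiplicative X →* ℂˣ from
  { toFun := fun x => a ^ P.toLinearMap x.toAdd y
    map_one' := by simp
    map_mul' := fun _ _ => by simp [zpow_add] }

/-- The matrix `(1 z; 0 1)`. -/
def upperSL (z : ℂ) : Matrix.SpecialLinearGroup (Fin 2) ℂ :=
  ⟨!![1, z; 0, 1], by simp [Matrix.det_fin_two]⟩

/-- The matrix `(1 0; z 1)`. -/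
def lowerSL (z : ℂ) : Matrix.SpecialLinearGroup (Fin 2) ℂ :=
  ⟨!![1, 0; z, 1], by simp [Matrix.det_fin_two]⟩

/-- The matrix `(a 0; 0 a⁻¹)`. -/
def diagSL (a : ℂˣ) : Matrix.SpecialLinearGroup (Fin 2) ℂ :=
  ⟨!![(a : ℂ), 0; 0, ((a⁻¹ : ℂˣ) : ℂ)], by simp [Matrix.det_fin_two]⟩

/-- The matrix `(0 1; -1 -z)`; at `z = 0` it lifts the nontrivial Weyl group element. -/
def stepSL (z : ℂ) : Matrix.SpecialLinearGroup (Fin 2) ℂ :=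
  ⟨!![0, 1; -1, -z], by simp [Matrix.det_fin_two]⟩

/-- A complex connected reductive group `G` with maximal torus `T = Hom(X, ℂˣ)` and root datum `P`,
given by its root group datum: the torus, and for every root `α` the homomorphism
`ι_α : SL₂(ℂ) → G` of the associated `𝔰𝔩₂`-triple, whose upper triangular unipotent part is the root
subgroup `U_α`. -/
structure ReductiveGroup (P : RootDatum ι X Y) (G : Type*) [Group G] where
  /-- the inclusion of the maximal torus -/
  torus : Diag X →* G
  /-- the homomorphisms `ι_α` -/
  sl : ι → Matrix.SpecialLinearGroup (Fin 2) ℂ →* G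
  torus_injective : Function.Injective torus
  /-- the maximal torus is its own centralizer -/
  torus_centralizer (x : G) (hx : ∀ t, x * torus t = torus t * x) : ∃ t, x = torus t
  /-- `ι_α` restricts to the coroot `α^∨` on diagonal matrices -/
  sl_diag (i : ι) (a : ℂˣ) : sl i (diagSL a) = torus (cocharTorus P (P.coroot i) a)
  /-- `ι_{-α}` is `ι_α` with the two coordinates interchanged -/
  sl_neg (i : ι) (z : ℂ) : sl (P.reflectionPerm i i) (upperSL z) = sl i (lowerSL z)
  /-- `T` acts on `U_α` through `α` -/
  torus_conj (t : Diag X) (i : ι) (z : ℂ) :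
    torus t * sl i (upperSL z) * (torus t)⁻¹ = sl i (upperSL ((charValue (P.root i) t : ℂ) * z))
  /-- `ι_α(0 1; -1 0)` normalizes `T` and acts on it as `s_α` -/
  weyl_conj_torus (i : ι) (t : Diag X) :
    sl i (stepSL 0) * torus t * (sl i (stepSL 0))⁻¹ =
      torus (weylTorus P (RootPairing.weylGroup.ofIdx P i) t)
  /-- `ι_α(0 1; -1 0)` conjugates `U_γ` to `U_{s_α γ}` -/
  weyl_conj_root (i j : ι) : ∃ c : ℂˣ, ∀ z : ℂ,
    sl i (stepSL 0) * sl j (upperSL z) * (sl i (stepSL 0))⁻¹ =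
      sl (P.reflectionPerm i j) (upperSL ((c : ℂ) * z))
  /-- the commutator of `U_α` and `U_γ`, `γ ≠ ±α`, is in the group generated by the root subgroups
  of the roots `mα + nγ` with `m, n ≥ 1` -/
  commutator (i j : ι) (hij : LinearIndependent ℤ ![P.root i, P.root j]) (z z' : ℂ) :
    sl i (upperSL z) * sl j (upperSL z') * (sl i (upperSL z))⁻¹ * (sl j (upperSL z'))⁻¹ ∈
      Subgroup.closure
      {x : G | ∃ (k : ι) (m n : ℕ) (u : ℂ), 0 < m ∧ 0 < n ∧
        P.root k = m • P.root i + n • P.root j ∧ x = sl k (upperSL u)}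
  /-- for every choice of positive roots, the unipotent group that the positive root subgroups
  generate contains no nontrivial element of a negative root subgroup -/
  neg_notMem (b : P.Base) (i : ι) (hi : b.IsPos i) (z : ℂ) (hz : z ≠ 0) :
    sl i (lowerSL z) ∉ Subgroup.closure
      {x : G | ∃ (k : ι) (u : ℂ), b.IsPos k ∧ x = sl k (upperSL u)}
  /-- `G` is generated by `T` and the images of the `ι_α` -/
  generates : Subgroup.closure (Set.range torus ∪ {x : G | ∃ i g, x = sl i g}) = ⊤

variable {P : RootDatum ι X Y} {G : Type*} [Group G]

/-- The center `Z(G)`, as a subgroup of the maximal torus. -/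
def torusCenter (𝔾 : ReductiveGroup P G) : Subgroup (Diag X) :=
  (Subgroup.center G).comap 𝔾.torus

instance torusCenter_normal (𝔾 : ReductiveGroup P G) : (torusCenter 𝔾).Normal where
  conj_mem n hn t := by
    have h : t * n * t⁻¹ = n := by rw [mul_comm t n, mul_inv_cancel_right]
    rwa [h]

/-- The Borel subgroup generated by `T` and the positive root subgroups. -/
def borel (𝔾 : ReductiveGroup P G) (b : P.Base) : Subgroup G :=
  Subgroup.closure (Set.range 𝔾.torus ∪
    {x : G | ∃ (k : ι) (u : ℂ), b.IsPos k ∧ x = 𝔾.sl k (upperSL u)})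

/-- The product `s_u ∈ W` of the simple reflections along a word. -/
def wordProd (b : P.Base) (u : List b.support) : P.weylGroup :=
  (u.map fun i => RootPairing.weylGroup.ofIdx P i.1).prod

/-- The length function of the Weyl group. -/
def weylLength (b : P.Base) (w : P.weylGroup) : ℕ :=
  sInf {n | ∃ u : List b.support, u.length = n ∧ wordProd b u = w}

/-- The lift to `G` of a word in the simple roots, `α ↦ ι_α(0 1; -1 0)`. -/
def wordLift (𝔾 : ReductiveGroup P G) (b : P.Base) (u : List b.support) : G :=
  (u.map fun i => 𝔾.sl i.1 (stepSL 0)).prod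

/-- The Bruhat cell `BwB`. -/
def bruhatCell (𝔾 : ReductiveGroup P G) (b : P.Base) (w : P.weylGroup) : Set G :=
  {x | ∃ u : List b.support, wordProd b u = w ∧
    ∃ y ∈ borel 𝔾 b, ∃ y' ∈ borel 𝔾 b, x = y * wordLift 𝔾 b u * y'}

end Groups

section Walks

variable {ι X Y : Type*} [AddCommGroup X] [AddCommGroup Y] {P : RootDatum ι X Y}

/-- `π_k = s_{α_k} ⋯ s_{α_1}` for the word `α_l ⋯ α_1`. Here and below `α k` is the letter
`α_{k+1}`. -/
def partialProd (b : P.Base) {l : ℕ} (α : Fin l → b.support) : Fin (l + 1) → P.weylGroup :=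
  Fin.induction 1 fun k w => RootPairing.weylGroup.ofIdx P (α k).1 * w

/-- `p = (p_0, …, p_l)` is a walk associated with the word `α`: if the edge of the next letter goes
up it is followed, otherwise it is followed or the walk stays. -/
def IsWalk (b : P.Base) {l : ℕ} (α : Fin l → b.support) (p : Fin (l + 1) → P.weylGroup) : Prop :=
  ∀ k : Fin l,
    (weylLength b (p k.castSucc) <
        weylLength b (RootPairing.weylGroup.ofIdx P (α k).1 * p k.castSucc) →
      p k.succ = RootPairing.weylGroup.ofIdx P (α k).1 * p k.castSucc) ∧
    (¬ weylLength b (p k.castSucc) <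
        weylLength b (RootPairing.weylGroup.ofIdx P (α k).1 * p k.castSucc) →
      p k.succ = RootPairing.weylGroup.ofIdx P (α k).1 * p k.castSucc ∨
      p k.succ = p k.castSucc)

/-- The set `S_p` of steps at which the walk stays. -/
def stays {l : ℕ} (p : Fin (l + 1) → P.weylGroup) : Set (Fin l) :=
  {k | p k.succ = p k.castSucc}

/-- `Q(p) = ⟨π_k⁻¹ α_k : k ∈ S_p⟩`. -/
def walkQ (b : P.Base) {l : ℕ} (α : Fin l → b.support) (p : Fin (l + 1) → P.weylGroup) :
    Submodule ℤ X :=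
  Submodule.span ℤ {x | ∃ k ∈ stays p, x = (partialProd b α k.succ)⁻¹ • P.root (α k).1}

/-- `T(p) = ⟨π_k⁻¹ h_{α_k} : k ∈ S_p⟩ ⊆ 𝔱(ℤ)`. -/
def walkT (b : P.Base) {l : ℕ} (α : Fin l → b.support) (p : Fin (l + 1) → P.weylGroup) :
    Submodule ℤ Y :=
  Submodule.span ℤ
    {y | ∃ k ∈ stays p, y = weylCochar P (partialProd b α k.succ)⁻¹ (P.coroot (α k).1)}

/-- The group `Q / Q(p)`, where `Q` is the root lattice. -/
abbrev rootQuotient (b : P.Base) {l : ℕ} (α : Fin l → b.support)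
    (p : Fin (l + 1) → P.weylGroup) : Type _ :=
  P.rootSpan ℤ ⧸ (walkQ b α p).submoduleOf (P.rootSpan ℤ)

/-- The center `Z(p) = (Q / Q(p))^*` of a walk. -/
abbrev walkCenter (b : P.Base) {l : ℕ} (α : Fin l → b.support)
    (p : Fin (l + 1) → P.weylGroup) : Type _ :=
  Diag (rootQuotient b α p)

/-- The fundamental group `π₁(p) = 𝔱(ℤ) / T(p)` of a walk (`G` is semisimple). -/
abbrev walkPi (b : P.Base) {l : ℕ} (α : Fin l → b.support)
    (p : Fin (l + 1) → P.weylGroup) : Type _ :=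
  Y ⧸ walkT b α p

variable {G : Type*} [Group G]

/-- The partial products `f_{α_k}(z_k) ⋯ f_{α_1}(z_1)` of the structure map `ρ(β) = ℂˡ → G`. -/
def partialMap (𝔾 : ReductiveGroup P G) (b : P.Base) {l : ℕ} (α : Fin l → b.support)
    (z : Fin l → ℂ) : Fin (l + 1) → G :=
  Fin.induction 1 fun k g => 𝔾.sl (α k).1 (stepSL (z k)) * g

/-- The cell `C_p ⊆ ρ(β) = ℂˡ` of the points with `f_{α_k}(z_k) ⋯ f_{α_1}(z_1) p_0 B ⊆ B p_k B` for
all `k`. -/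
def walkCell (𝔾 : ReductiveGroup P G) (b : P.Base) {l : ℕ} (α : Fin l → b.support)
    (p : Fin (l + 1) → P.weylGroup) : Set (Fin l → ℂ) :=
  {z | ∀ (k : Fin (l + 1)) (u : List b.support), wordProd b u = p 0 →
    partialMap 𝔾 b α z k * wordLift 𝔾 b u ∈ bruhatCell 𝔾 b (p k)}

/-- The action of `T` on `ρ(β) = ℂˡ`: the coordinate `z_k` is multiplied by `α_k(^{π_{k-1}} t)`. -/
def torusAct (b : P.Base) {l : ℕ} (α : Fin l → b.support) (t : Diag X) (z : Fin l → ℂ) :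
    Fin l → ℂ :=
  fun k => (charValue (P.root (α k).1) (weylTorus P (partialProd b α k.castSucc) t) : ℂ) * z k

/-- `S(p) ⊆ T`: the subgroup generated by the stabilizers of the points of `C_p`. -/
def walkStab (𝔾 : ReductiveGroup P G) (b : P.Base) {l : ℕ} (α : Fin l → b.support)
    (p : Fin (l + 1) → P.weylGroup) : Subgroup (Diag X) :=
  Subgroup.closure {t | ∃ z ∈ walkCell 𝔾 b α p, torusAct b α t z = z}

/-- An element `(π₁⁽¹⁾, π₂⁽¹⁾, w₁) ⋯ (π₁⁽ᵍ⁾, π₂⁽ᵍ⁾, w_g) α_l ⋯ α_1` of `F(W³) × F(Δ⁺)`; the handles are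
numbered from left to right, starting with `0`. -/
structure HandleWord (b : P.Base) where
  /-- the genus -/
  g : ℕ
  /-- the elements `π₁⁽ⁱ⁾` -/
  fst : Fin g → P.weylGroup
  /-- the elements `π₂⁽ⁱ⁾` -/
  snd : Fin g → P.weylGroup
  /-- the twists `w_i` -/
  twist : Fin g → P.weylGroup
  /-- the length of the `F(Δ⁺)`-part -/
  l : ℕ
  /-- the letters of the `F(Δ⁺)`-part -/
  letter : Fin l → b.support

/-- `u` is a word of minimal length among the words that represent its class in `W / W_I`. For
`I = ∅` these are the reduced words. -/
def IsMinimalLift (b : P.Base) (I : Set b.support) (u : List b.support) : Prop :=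
  ∀ v : List b.support,
    (wordProd b u)⁻¹ * wordProd b v ∈
      Subgroup.closure {w | ∃ i ∈ I, w = RootPairing.weylGroup.ofIdx P i.1} →
    u.length ≤ v.length

/-- The set `𝒱` of those `β` that come from `g` handles and finitely many nice punctures. A handle
with reduced words `a`, `c` contributes the tori of the commutator variety of `(π₁, π₂) = (s_a, s_c)`
and the word `a c aᵗ cᵗ`; a puncture contributes `d dᵗ` for a minimal lift `d` of an element of
`W / W_I`. Moving the tori to the left past the words of the previous handles twists them by the
product of the commutators of the previous handles. -/
def HandleWord.IsCellWord {b : P.Base} (β : HandleWord b) : Prop :=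
  ∃ (a c : Fin β.g → List b.support) (n : ℕ) (d : Fin n → List b.support),
    (∀ i, IsMinimalLift b ∅ (a i) ∧ IsMinimalLift b ∅ (c i)) ∧
    (∀ j, ∃ I : Set b.support, IsMinimalLift b I (d j)) ∧
    (∀ i, β.fst i = wordProd b (a i) ∧ β.snd i = wordProd b (c i)) ∧
    (∀ i, β.twist i = (((List.finRange β.g).take i).map
      fun j => β.fst j * β.snd j * (β.fst j)⁻¹ * (β.snd j)⁻¹).prod) ∧
    (List.ofFn β.letter).reverse =
      (List.ofFn fun i => a i ++ c i ++ (a i).reverse ++ (c i).reverse).flatten ++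
      (List.ofFn fun j => d j ++ (d j).reverse).flatten

variable {b : P.Base}

/-- `π_l`, the product of all simple reflections of the `F(Δ⁺)`-part. -/
def HandleWord.total (β : HandleWord b) : P.weylGroup :=
  partialProd b β.letter (Fin.last β.l)

/-- `T_β(p) = T(p) + p_l⁻¹ ∑_{i,j} (1 - π_j⁽ⁱ⁾) 𝔱(ℤ)`. -/
def HandleWord.latticeT (β : HandleWord b) (p : Fin (β.l + 1) → P.weylGroup) : Submodule ℤ Y :=
  walkT b β.letter p ⊔
    (⨆ i, LinearMap.range (LinearMap.id - weylCochar P (β.fst i)) ⊔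
      LinearMap.range (LinearMap.id - weylCochar P (β.snd i))).map
    (weylCochar P (p (Fin.last β.l))⁻¹)

/-- `π_{1,β}(p) = 𝔱(ℤ) / T_β(p)`. -/
abbrev HandleWord.pi (β : HandleWord b) (p : Fin (β.l + 1) → P.weylGroup) : Type _ :=
  Y ⧸ β.latticeT p

/-- `T̃_β(p) = T(p) + ∑_{i,j} w_i (π_j⁽ⁱ⁾ - 1) Q^*`, a subgroup of `𝔱`. -/
def HandleWord.tildeLattice (β : HandleWord b) (p : Fin (β.l + 1) → P.weylGroup) :
    AddSubgroup (X →+ ℂ) :=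
  (walkT b β.letter p).toAddSubgroup.map (cocharToLie P) ⊔
    ⨆ i, (coweightLattice P).map
        ((weylLie P (β.twist i)).comp (weylLie P (β.fst i) - AddMonoidHom.id _)) ⊔
      (coweightLattice P).map
        ((weylLie P (β.twist i)).comp (weylLie P (β.snd i) - AddMonoidHom.id _))

/-- `π̃_{1,β}(p) = 𝔱(ℤ) / T̃_β(p)`. -/
abbrev HandleWord.tildePi (β : HandleWord b) (p : Fin (β.l + 1) → P.weylGroup) : Type _ :=
  Y ⧸ (β.tildeLattice p).comap (cocharToLie P)

/-- The fixed points `T^π` of `π ∈ W` on `T`. -/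
def fixedTorus (P : RootDatum ι X Y) (w : P.weylGroup) : Subgroup (Diag X) :=
  (weylTorus P w / MonoidHom.id _).ker

/-- `T̂^π`: the preimage of `Z(G)` under `t ↦ ^π t t⁻¹`. -/
def hatTorus (𝔾 : ReductiveGroup P G) (w : P.weylGroup) : Subgroup (Diag X) :=
  (torusCenter 𝔾).comap (weylTorus P w / MonoidHom.id _)

/-- `S_β(p)`: the intersection of `S(p)` with all the groups `π_l⁻¹(T^{⟨π₁⁽ⁱ⁾, π₂⁽ⁱ⁾⟩})`. -/
def HandleWord.stab (𝔾 : ReductiveGroup P G) (β : HandleWord b)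
    (p : Fin (β.l + 1) → P.weylGroup) : Subgroup (Diag X) :=
  walkStab 𝔾 b β.letter p ⊓
    ⨅ i, (fixedTorus P (β.fst i) ⊓ fixedTorus P (β.snd i)).comap (weylTorus P β.total)

/-- `Z_β(p) = S_β(p) / Z(G)`, as a subgroup of `T / Z(G)`. -/
def HandleWord.center (𝔾 : ReductiveGroup P G) (β : HandleWord b)
    (p : Fin (β.l + 1) → P.weylGroup) : Subgroup (Diag X ⧸ torusCenter 𝔾) :=
  (β.stab 𝔾 p).map (QuotientGroup.mk' _)

/-- `S̃_β(p)`: the intersection of `S(p)` with all the groups `π_l⁻¹(T̂^{π_j⁽ⁱ⁾})`. -/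
def HandleWord.tildeStab (𝔾 : ReductiveGroup P G) (β : HandleWord b)
    (p : Fin (β.l + 1) → P.weylGroup) : Subgroup (Diag X) :=
  walkStab 𝔾 b β.letter p ⊓
    ⨅ i, (hatTorus 𝔾 (β.fst i) ⊓ hatTorus 𝔾 (β.snd i)).comap (weylTorus P β.total)

/-- The twist `w π₂ π₁ π₂⁻¹ π₁⁻¹ w⁻¹` of the commutator variety of a handle. -/
def HandleWord.handleTwist (β : HandleWord b) (i : Fin β.g) : P.weylGroup :=
  β.twist i * (β.snd i * β.fst i * (β.snd i)⁻¹ * (β.fst i)⁻¹) * (β.twist i)⁻¹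

/-- The action of `T` on a convolution is twisted on each factor by everything to its right. -/
def HandleWord.rightTwist (β : HandleWord b) (i : Fin β.g) : P.weylGroup :=
  (((List.finRange β.g).drop (i + 1)).map β.handleTwist).prod * β.total

/-- The homomorphism `A : T → T^{2g}` such that `t` acts on the tori components of the cell by
multiplication by `A(t)`. On an untwisted handle `s ∈ T` multiplies `t₁` by
`^{π₁⁻¹ π₂ π₁ π₂⁻¹ π₁⁻¹} s (^{π₂ π₁ π₂⁻¹ π₁⁻¹} s)⁻¹` and `t₂` by
`^{π₁ π₂⁻¹ π₁⁻¹} s (^{π₂ π₁ π₂⁻¹ π₁⁻¹} s)⁻¹`; a twist by `w` replaces `s` by `^{w⁻¹} s`. -/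
def HandleWord.toriAct (β : HandleWord b) : Diag X →* (Fin β.g → Diag X × Diag X) :=
  MonoidHom.pi fun i =>
    let a := β.fst i
    let c := β.snd i
    ((weylTorus P (a⁻¹ * c * a * c⁻¹ * a⁻¹) / weylTorus P (c * a * c⁻¹ * a⁻¹)).prod
      (weylTorus P (a * c⁻¹ * a⁻¹) / weylTorus P (c * a * c⁻¹ * a⁻¹))).comp
    (weylTorus P ((β.twist i)⁻¹ * β.rightTwist i))

/-- The homomorphism `t ↦ (t Z(G), A(t)⁻¹)`. -/
def HandleWord.tildeHom (𝔾 : ReductiveGroup P G) (β : HandleWord b) :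
    Diag X →* (Diag X ⧸ torusCenter 𝔾) × (Fin β.g → Diag X × Diag X) :=
  (QuotientGroup.mk' (torusCenter 𝔾)).prod β.toriAct⁻¹

/-- `Z̃_β(p)`: the image of `S̃_β(p)` in `(T / Z(G)) × T^{2g}` under `t ↦ (t Z(G), A(t)⁻¹)`. -/
def HandleWord.tildeCenter (𝔾 : ReductiveGroup P G) (β : HandleWord b)
    (p : Fin (β.l + 1) → P.weylGroup) :
    Subgroup ((Diag X ⧸ torusCenter 𝔾) × (Fin β.g → Diag X × Diag X)) :=
  (β.tildeStab 𝔾 p).map (β.tildeHom 𝔾)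

/-- The dual `Z(p)^*`. -/
abbrev walkCenterDual (b : P.Base) {l : ℕ} (α : Fin l → b.support)
    (p : Fin (l + 1) → P.weylGroup) : Subgroup (walkCenter b α p →* ℂˣ) :=
  charGroup (diagRegular (rootQuotient b α p))

/-- The dual `Z_β(p)^*`. -/
abbrev HandleWord.centerDual (𝔾 : ReductiveGroup P G) (β : HandleWord b)
    (p : Fin (β.l + 1) → P.weylGroup) : Subgroup (β.center 𝔾 p →* ℂˣ) :=
  charGroup (subgroupRegular (quotientRegular (diagRegular X) (torusCenter 𝔾)) (β.center 𝔾 p))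

/-- The dual `Z̃_β(p)^*`. -/
abbrev HandleWord.tildeCenterDual (𝔾 : ReductiveGroup P G) (β : HandleWord b)
    (p : Fin (β.l + 1) → P.weylGroup) : Subgroup (β.tildeCenter 𝔾 p →* ℂˣ) :=
  charGroup (subgroupRegular
    (prodRegular (quotientRegular (diagRegular X) (torusCenter 𝔾))
      (powRegular (Fin β.g) (prodRegular (diagRegular X) (diagRegular X))))
    (β.tildeCenter 𝔾 p))

end Walks

section Duality

variable {ι X Y : Type*} [Finite ι] [AddCommGroup X] [AddCommGroup Y] [Module.Finite ℤ X]
  [Module.Free ℤ X] {P : RootDatum ι X Y} {b : P.Base}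

/-- The dual word: every simple root is replaced by its coroot. -/
def dualLetters {l : ℕ} (α : Fin l → b.support) : Fin l → (dualBase b).support :=
  fun k => ⟨(α k).1, (α k).2⟩

/-- The dual walk `p^*` on `ᴸG̃`: it goes through the corresponding elements of the Weyl group, and
so it stays at the same steps. -/
def dualWalk {l : ℕ} (p : Fin (l + 1) → P.weylGroup) : Fin (l + 1) → (dualDatum P).weylGroup :=
  fun k => dualWeyl P (p k)

/-- The dual `β^*`. -/
def HandleWord.dual (β : HandleWord b) : HandleWord (dualBase b) where
  g := β.g
  fst i := dualWeyl P (β.fst i)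
  snd i := dualWeyl P (β.snd i)
  twist i := dualWeyl P (β.twist i)
  l := β.l
  letter := dualLetters β.letter

end Duality

end WalkDuality

end

/-! All the groups in question are described by sublattices of character lattices and their
annihilators `perp` in tori. Duality then becomes an identity between lattices.

When G is simply connected its coroots span Y, so Y is the root lattice of the dual group
(`dualRootEquiv`); the cocharacter lattice of the dual group is by construction the root lattice Q
of G. Both identifications commute with the Weyl group, and they turn Q(p^*) into T(p) and T(p^*)
into Q(p) (`walkQ_dual`, `map_walkT_dual`). Walks involve only W, its simple reflections and the
length, so p ↦ p^* is a bijection with the same stays. Together with the fact that M is the group of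
algebraic characters of Hom(M, ℂˣ), this is the case without handles.

With handles, the centers are defined by stabilizers of points of the cell, and the geometric core
is `walkStab_eq_perp`: S(p) is the annihilator of Q(p). Suppose t fixes a point, and let s be the
translate of t that acts at a stay with simple root α. If α(s) ≠ 1, then the coordinate of this step
is zero, and comparing the partial product with its translate by the torus would put an element into
two Bruhat cells at once (`charValue_eq_one_of_stay`, `eq_of_mem_bruhatCell`). Conversely, for t in
the annihilator a fixed point is built step by step, with partial products in v w B where the
unipotent v commutes with the current translate of t (`exists_step_move`, `exists_step_stay`).

Being fixed by π means annihilating (π - 1)X. Being fixed up to Z(G), which is the annihilator of Q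
(`torusCenter_eq_perp`), means annihilating (π - 1)Q. The element π_l and the twists w_i lie in the
group generated by the π_j, so they do not affect these lattices (`HandleWord.total_mem`,
`HandleWord.twistedLattice_eq`). Hence S_β(p) and S̃_β(p) are the annihilators of L = Q(p) + ∑(π_j -
1)X and L = Q(p) + ∑(π_j - 1)Q. Both L lie in Q, and the maps that define Z_β and Z̃_β have kernel
Z(G), so the images are Hom(Q/L, ℂˣ), with character group Q/L (`exists_equiv_diag`,
`exists_equiv_charGroup`).

For the dual group Q is the cocharacter lattice and X = Hom(Y, ℤ) is the coweight lattice Q^*. This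
is why Z̃ is paired with π₁ and Z with π̃₁; the second case rests on
`HandleWord.cocharToLie_mem_tildeLattice_iff`. -/

noncomputable section

namespace WalkDuality

/-! ### Words, length and exchange in the Weyl group. -/

section WeylGroup

variable {ι X Y : Type*} [AddCommGroup X] [AddCommGroup Y] {P : RootDatum ι X Y}

local notation "σ" => RootPairing.weylGroup.ofIdx

theorem root_smul (w : P.weylGroup) (i : ι) : P.root (w • i) = w • P.root i :=
  (P.weylGroup_apply_root w i).symm

theorem ofIdx_smul_index (i j : ι) : σ P i • j = P.reflectionPerm i j := rfl

theorem ofIdx_smul_weight (i : ι) (x : X) : σ P i • x = P.reflection i x := rfl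

@[simp] theorem ofIdx_mul_self (i : ι) : σ P i * σ P i = 1 := by
  apply Subtype.ext
  apply RootPairing.Equiv.weightHom_injective P
  ext x
  exact P.reflection_same i x

@[simp] theorem ofIdx_inv (i : ι) : (σ P i)⁻¹ = σ P i :=
  inv_eq_of_mul_eq_one_left (ofIdx_mul_self i)

@[simp] theorem ofIdx_mul_cancel_left (i : ι) (w : P.weylGroup) : σ P i * (σ P i * w) = w := by
  rw [← mul_assoc, ofIdx_mul_self, one_mul]

theorem weylGroup_ext {v w : P.weylGroup} (h : ∀ x : X, v • x = w • x) : v = w := by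
  apply Subtype.ext
  apply RootPairing.Equiv.weightHom_injective P
  ext x
  exact h x

theorem ofIdx_reflectionPerm (i j : ι) :
    σ P (P.reflectionPerm i j) = σ P i * σ P j * σ P i := by
  refine weylGroup_ext fun x => ?_
  rw [mul_smul, mul_smul]
  simp only [ofIdx_smul_weight, RootPairing.reflection_reflectionPerm]
  rfl

theorem ofIdx_reflectionPerm_self (i : ι) : σ P (P.reflectionPerm i i) = σ P i := by
  rw [ofIdx_reflectionPerm]; simp

@[simp] theorem wordProd_nil (b : P.Base) : wordProd b [] = 1 := rfl

@[simp] theorem wordProd_cons (b : P.Base) (i : b.support) (u : List b.support) :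
    wordProd b (i :: u) = σ P i.1 * wordProd b u := by simp [wordProd]

@[simp] theorem wordProd_append (b : P.Base) (u v : List b.support) :
    wordProd b (u ++ v) = wordProd b u * wordProd b v := by simp [wordProd]

theorem wordProd_reverse (b : P.Base) (u : List b.support) :
    wordProd b u.reverse = (wordProd b u)⁻¹ := by
  induction u with
  | nil => simp
  | cons i u ih => simp [ih]

theorem isPos_or_isPos_neg (b : P.Base) (i : ι) : b.IsPos i ∨ b.IsPos (P.reflectionPerm i i) :=
  RootPairing.Base.IsPos.or_neg b i

theorem isPos_neg_iff_not (b : P.Base) (i : ι) : b.IsPos (P.reflectionPerm i i) ↔ ¬ b.IsPos i :=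
  RootPairing.Base.IsPos.neg_iff_not b i

/-- `P.reflectionPerm i i` is the index of the negative of the root i, so this is w(-α) = -wα. -/
theorem reflectionPerm_reflectionPerm_self (w : P.weylGroup) (i : ι) :
    w • P.reflectionPerm i i = P.reflectionPerm (w • i) (w • i) := by
  apply P.root.injective
  rw [root_smul, P.root_reflectionPerm, P.root_reflectionPerm, P.reflection_apply_self,
    P.reflection_apply_self, root_smul, smul_neg]

theorem weylLength_wordProd_le (b : P.Base) (u : List b.support) :
    weylLength b (wordProd b u) ≤ u.length :=
  Nat.sInf_le ⟨u, rfl, rfl⟩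

variable [Finite ι] [P.IsReduced]

/-- Simple reflections carry simple roots to all roots, so every reflection is conjugate to a simple
one by a word. -/
theorem weylGroup_eq_wordProd (b : P.Base) (w : P.weylGroup) :
    ∃ u, wordProd b u = w := by
  have refl : ∀ i : ι, ∃ u, wordProd b u = σ P i := by
    intro i
    refine RootPairing.Base.induction_reflect (b := b) i (p := fun i => ∃ u, wordProd b u = σ P i)
      ?_ ?_ ?_
    · rintro i ⟨u, hu⟩
      exact ⟨u, by rw [hu, ofIdx_reflectionPerm_self]⟩
    · intro i hi
      exact ⟨[⟨i, hi⟩], by simp⟩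
    · rintro i j ⟨u, hu⟩ hj
      exact ⟨[⟨j, hj⟩] ++ u ++ [⟨j, hj⟩], by simp [hu, ofIdx_reflectionPerm, mul_assoc]⟩
  obtain ⟨w, hw⟩ := w
  induction hw using RootPairing.weylGroup.induction with
  | mem i => exact refl i
  | one => exact ⟨[], rfl⟩
  | mul x y hx hy ihx ihy =>
    obtain ⟨u, hu⟩ := ihx
    obtain ⟨v, hv⟩ := ihy
    exact ⟨u ++ v, by rw [wordProd_append, hu, hv]; rfl⟩

/-- The infimum that defines the length is attained because some word exists; it is not the default
value 0 of an empty infimum. -/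
theorem exists_reduced_word (b : P.Base) (w : P.weylGroup) :
    ∃ u : List b.support, u.length = weylLength b w ∧ wordProd b u = w :=
  Nat.sInf_mem (s := {n | ∃ u : List b.support, u.length = n ∧ wordProd b u = w})
    (let ⟨u, hu⟩ := weylGroup_eq_wordProd b w; ⟨u.length, u, rfl, hu⟩)

theorem weylLength_ofIdx_mul_le (b : P.Base) (i : b.support) (w : P.weylGroup) :
    weylLength b (σ P i.1 * w) ≤ weylLength b w + 1 := by
  obtain ⟨u, hu, rfl⟩ := exists_reduced_word b w
  rw [← wordProd_cons, ← hu]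
  exact weylLength_wordProd_le b (i :: u)

/-- The exchange property. -/
theorem exists_word_of_not_isPos (b : P.Base) (u : List b.support) (i : ι) (hi : b.IsPos i)
    (h : ¬ b.IsPos ((wordProd b u)⁻¹ • i)) :
    ∃ v : List b.support, v.length + 1 = u.length ∧ σ P i * wordProd b u = wordProd b v := by
  induction u generalizing i with
  | nil => exact absurd (by simpa using hi) h
  | cons j u ih =>
    by_cases hij : i = j.1
    · subst hij
      exact ⟨u, rfl, by simp⟩
    · have hpos : b.IsPos (P.reflectionPerm j.1 i) := hi.reflectionPerm j.2 hij
      obtain ⟨v, hv, hvu⟩ := ih _ hpos (by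
        rwa [wordProd_cons, mul_inv_rev, mul_smul, ofIdx_inv, ofIdx_smul_index] at h)
      refine ⟨j :: v, by simp [hv], ?_⟩
      rw [wordProd_cons, wordProd_cons, ← hvu, ofIdx_reflectionPerm]
      simp [mul_assoc]

/-- The exchange property applies to a reduced word of s_i w, since (s_i w)⁻¹ makes the root i
negative. It leaves a word of w with one letter less. -/
theorem weylLength_lt_of_isPos (b : P.Base) (i : b.support) (w : P.weylGroup)
    (h : b.IsPos (w⁻¹ • i.1)) : weylLength b w < weylLength b (σ P i.1 * w) := by
  obtain ⟨u, hu, huw⟩ := exists_reduced_word b (σ P i.1 * w)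
  obtain ⟨v, hv, hvu⟩ := exists_word_of_not_isPos b u i.1
    (RootPairing.Base.isPos_of_mem_support i.2) (by
      rw [huw, mul_inv_rev, mul_smul, ofIdx_inv, ofIdx_smul_index,
        reflectionPerm_reflectionPerm_self, isPos_neg_iff_not]
      exact not_not.2 h)
  rw [huw, ofIdx_mul_cancel_left] at hvu
  rw [← hu, ← hv, hvu]
  exact Nat.lt_succ_of_le (weylLength_wordProd_le b v)

/-- If a reduced word of w⁻¹ began with i, then s_i w⁻¹ would be shorter than w⁻¹; positivity of w
α_i makes it longer. -/
theorem eq_one_of_forall_isPos (b : P.Base) (w : P.weylGroup)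
    (h : ∀ i : b.support, b.IsPos (w • i.1)) : w = 1 := by
  obtain ⟨u, hu, huw⟩ := exists_reduced_word b w⁻¹
  cases u with
  | nil => simpa using huw.symm
  | cons i u =>
    have h1 := weylLength_lt_of_isPos b i w⁻¹ (by rw [inv_inv]; exact h i)
    have h2 := weylLength_wordProd_le b u
    rw [← huw, wordProd_cons, ofIdx_mul_cancel_left, ← wordProd_cons, huw, ← hu] at h1
    simp only [List.length_cons] at h1
    omega

end WeylGroup

/-! ### Characters of diagonalizable groups and annihilators of lattices. -/

section Characters

variable {M : Type*} [AddCommGroup M]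

@[simp] theorem charValue_zero (t : Diag M) : charValue 0 t = 1 :=
  map_one (show Multiplicative M →* ℂˣ from t)

theorem charValue_add (x y : M) (t : Diag M) :
    charValue (x + y) t = charValue x t * charValue y t :=
  map_mul (show Multiplicative M →* ℂˣ from t) _ _

theorem charValue_neg (x : M) (t : Diag M) : charValue (-x) t = (charValue x t)⁻¹ :=
  map_inv (show Multiplicative M →* ℂˣ from t) _

theorem charValue_sub (x y : M) (t : Diag M) :
    charValue (x - y) t = charValue x t / charValue y t :=
  map_div (show Multiplicative M →* ℂˣ from t) _ _

theorem charValue_zsmul (n : ℤ) (x : M) (t : Diag M) :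
    charValue (n • x) t = charValue x t ^ n :=
  map_zpow (show Multiplicative M →* ℂˣ from t) _ n

@[simp] theorem charValue_mul (x : M) (s t : Diag M) :
    charValue x (s * t) = charValue x s * charValue x t := rfl

@[simp] theorem charValue_inv (x : M) (t : Diag M) : charValue x t⁻¹ = (charValue x t)⁻¹ := rfl

@[simp] theorem charValue_div (x : M) (s t : Diag M) :
    charValue x (s / t) = charValue x s / charValue x t := rfl

theorem diag_ext {s t : Diag M} (h : ∀ x, charValue x s = charValue x t) : s = t :=
  MonoidHom.ext fun x => h x.toAdd

/-- The subgroup of `Hom(M, ℂˣ)` on which all characters in `L` are trivial. -/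
def perp (L : Submodule ℤ M) : Subgroup (Diag M) where
  carrier := {t | ∀ x ∈ L, charValue x t = 1}
  one_mem' _ _ := rfl
  mul_mem' hs ht x hx := by rw [charValue_mul, hs x hx, ht x hx, one_mul]
  inv_mem' ht x hx := by rw [charValue_inv, ht x hx, inv_one]

theorem mem_perp_span {s : Set M} {t : Diag M} :
    t ∈ perp (Submodule.span ℤ s) ↔ ∀ x ∈ s, charValue x t = 1 := by
  refine ⟨fun h x hx => h x (Submodule.subset_span hx), fun h x hx => ?_⟩
  induction hx using Submodule.span_induction with
  | mem x hx => exact h x hx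
  | zero => exact charValue_zero t
  | add x y _ _ hx hy => rw [charValue_add, hx, hy, one_mul]
  | smul n x _ hx => rw [charValue_zsmul, hx, one_zpow]

end Characters

/-! ### The Weyl group action on the maximal torus. -/

section WeylActionOnTorus

variable {ι X Y : Type*} [AddCommGroup X] [AddCommGroup Y] {P : RootDatum ι X Y}

@[simp] theorem charValue_weylTorus (w : P.weylGroup) (x : X) (t : Diag X) :
    charValue x (weylTorus P w t) = charValue (w⁻¹ • x) t := rfl

theorem weylTorus_mul (v w : P.weylGroup) (t : Diag X) :
    weylTorus P (v * w) t = weylTorus P v (weylTorus P w t) :=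
  diag_ext fun x => by simp [mul_smul]

@[simp] theorem weylTorus_one (t : Diag X) : weylTorus P 1 t = t :=
  diag_ext fun x => by simp

theorem charValue_cocharTorus (x : X) (y : Y) (a : ℂˣ) :
    charValue x (cocharTorus P y a) = a ^ P.toLinearMap x y := rfl

theorem weylTorus_ofIdx_of_charValue_eq_one (i : ι) (t : Diag X)
    (h : charValue (P.root i) t = 1) : weylTorus P (RootPairing.weylGroup.ofIdx P i) t = t :=
  diag_ext fun x => by
    rw [charValue_weylTorus, ofIdx_inv, ofIdx_smul_weight, P.reflection_apply, charValue_sub,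
      charValue_zsmul, h]
    simp

end WeylActionOnTorus

/-! ### Matrix identities in SL₂. -/

section SpecialLinear

theorem coe_upperSL (z : ℂ) : (upperSL z : Matrix (Fin 2) (Fin 2) ℂ) = !![1, z; 0, 1] := rfl

theorem coe_lowerSL (z : ℂ) : (lowerSL z : Matrix (Fin 2) (Fin 2) ℂ) = !![1, 0; z, 1] := rfl

theorem coe_stepSL (z : ℂ) : (stepSL z : Matrix (Fin 2) (Fin 2) ℂ) = !![0, 1; -1, -z] := rfl

theorem coe_diagSL (a : ℂˣ) :
    (diagSL a : Matrix (Fin 2) (Fin 2) ℂ) = !![(a : ℂ), 0; 0, ((a⁻¹ : ℂˣ) : ℂ)] := rfl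

@[simp] theorem upperSL_zero : upperSL 0 = 1 := by
  refine Subtype.ext ?_
  rw [coe_upperSL, Matrix.SpecialLinearGroup.coe_one, Matrix.one_fin_two]

theorem upperSL_add (z w : ℂ) : upperSL (z + w) = upperSL z * upperSL w := by
  refine Subtype.ext ?_
  simp only [Matrix.SpecialLinearGroup.coe_mul, coe_upperSL, Matrix.mul_fin_two]
  simp [add_comm]

theorem upperSL_neg (z : ℂ) : upperSL (-z) = (upperSL z)⁻¹ := by
  rw [eq_inv_iff_mul_eq_one, ← upperSL_add, neg_add_cancel, upperSL_zero]

theorem stepSL_eq (z : ℂ) : stepSL z = stepSL 0 * upperSL z := by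
  refine Subtype.ext ?_
  simp only [Matrix.SpecialLinearGroup.coe_mul, coe_upperSL, coe_stepSL, Matrix.mul_fin_two]
  simp

theorem stepSL_mul_upperSL (z w : ℂ) : stepSL z * upperSL w = stepSL (z + w) := by
  rw [stepSL_eq z, stepSL_eq (z + w), upperSL_add, mul_assoc]

theorem stepSL_conj_upperSL (z : ℂ) : stepSL 0 * upperSL z * (stepSL 0)⁻¹ = lowerSL (-z) := by
  rw [mul_inv_eq_iff_eq_mul]
  refine Subtype.ext ?_
  simp only [Matrix.SpecialLinearGroup.coe_mul, coe_upperSL, coe_stepSL, coe_lowerSL,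
    Matrix.mul_fin_two]
  simp

theorem stepSL_mul_self : stepSL 0 * stepSL 0 = diagSL (-1) := by
  refine Subtype.ext ?_
  simp only [Matrix.SpecialLinearGroup.coe_mul, coe_stepSL, coe_diagSL, Matrix.mul_fin_two]
  simp

/-- For a nonzero parameter the step lies in U_α T U_{-α}. At a descent the factor in U_{-α} can be
moved past the Weyl group element into B, so the step can stay in its cell. -/
theorem stepSL_bruhat (a : ℂˣ) :
    stepSL a = upperSL (-(a⁻¹ : ℂˣ)) * diagSL (-a⁻¹) * lowerSL (a⁻¹ : ℂˣ) := by
  refine Subtype.ext ?_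
  simp only [Matrix.SpecialLinearGroup.coe_mul, coe_upperSL, coe_stepSL, coe_lowerSL, coe_diagSL,
    Matrix.mul_fin_two]
  simp

theorem closure_upperSL_lowerSL :
    Subgroup.closure (Set.range upperSL ∪ Set.range lowerSL) = ⊤ := by
  set H := Subgroup.closure (Set.range upperSL ∪ Set.range lowerSL)
  have hu : ∀ z, upperSL z ∈ H := fun z => Subgroup.subset_closure (Or.inl ⟨z, rfl⟩)
  have hl : ∀ z, lowerSL z ∈ H := fun z => Subgroup.subset_closure (Or.inr ⟨z, rfl⟩)
  have hdet : ∀ g : Matrix.SpecialLinearGroup (Fin 2) ℂ,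
      g.1 0 0 * g.1 1 1 - g.1 0 1 * g.1 1 0 = 1 := fun g => by
    rw [← Matrix.det_fin_two]; exact g.2
  have key : ∀ g : Matrix.SpecialLinearGroup (Fin 2) ℂ, g.1 1 0 ≠ 0 → g ∈ H := by
    intro g hg
    have hd := hdet g
    have : g = upperSL ((g.1 0 0 - 1) / g.1 1 0) * lowerSL (g.1 1 0) *
        upperSL ((g.1 1 1 - 1) / g.1 1 0) := by
      refine Subtype.ext ?_
      simp only [Matrix.SpecialLinearGroup.coe_mul, coe_upperSL, coe_lowerSL, Matrix.mul_fin_two]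
      ext i j
      fin_cases i <;> fin_cases j <;> simp
      · field_simp; ring
      · field_simp; linear_combination -hd
      · field_simp; ring
    rw [this]
    exact mul_mem (mul_mem (hu _) (hl _)) (hu _)
  refine eq_top_iff.2 fun g _ => ?_
  by_cases hg : g.1 1 0 = 0
  -- When the lower left entry of g vanishes, the product has the upper left entry of g in its
  -- place, which is nonzero because det g = 1.
  · have h1 : lowerSL 1 * g ∈ H := by
      refine key _ fun h => ?_
      have hd := hdet g
      change ((lowerSL 1 * g : Matrix.SpecialLinearGroup (Fin 2) ℂ) :
        Matrix (Fin 2) (Fin 2) ℂ) 1 0 = 0 at h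
      rw [Matrix.SpecialLinearGroup.coe_mul, coe_lowerSL, Matrix.mul_apply, Fin.sum_univ_two] at h
      simp [hg] at h hd
      simp [h] at hd
    exact (mul_mem_cancel_left (hl 1)).1 h1
  · exact key g hg

end SpecialLinear

theorem conj_mem_closure {G : Type*} [Group G] {S : Set G} {g : G}
    (h : ∀ s ∈ S, g * s * g⁻¹ ∈ Subgroup.closure S) {y : G} (hy : y ∈ Subgroup.closure S) :
    g * y * g⁻¹ ∈ Subgroup.closure S := by
  have : Subgroup.closure S ≤ (Subgroup.closure S).comap (MulAut.conj g).toMonoidHom :=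
    (Subgroup.closure_le _).2 h
  exact this hy

/-! ### Root subgroups, the Borel subgroup and the center. -/

section RootGroups

variable {ι X Y : Type*} [AddCommGroup X] [AddCommGroup Y] {P : RootDatum ι X Y}
  {G : Type*} [Group G]

local notation "σ" => RootPairing.weylGroup.ofIdx

/-- The subgroup generated by the positive root subgroups. -/
def posUnip (𝔾 : ReductiveGroup P G) (b : P.Base) : Subgroup G :=
  Subgroup.closure {x : G | ∃ (k : ι) (u : ℂ), b.IsPos k ∧ x = 𝔾.sl k (upperSL u)}

/-- The subgroup generated by the root subgroups of the positive roots other than `i`. For a simple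
root it is the unipotent radical of a minimal parabolic subgroup. -/
def radUnip (𝔾 : ReductiveGroup P G) (b : P.Base) (i : ι) : Subgroup G :=
  Subgroup.closure {x : G | ∃ (k : ι) (u : ℂ), (b.IsPos k ∧ k ≠ i) ∧ x = 𝔾.sl k (upperSL u)}

variable (𝔾 : ReductiveGroup P G) (b : P.Base)

theorem sl_mem_posUnip {k : ι} (hk : b.IsPos k) (z : ℂ) : 𝔾.sl k (upperSL z) ∈ posUnip 𝔾 b :=
  Subgroup.subset_closure ⟨k, z, hk, rfl⟩

theorem sl_mem_radUnip {i k : ι} (hk : b.IsPos k) (hki : k ≠ i) (z : ℂ) :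
    𝔾.sl k (upperSL z) ∈ radUnip 𝔾 b i :=
  Subgroup.subset_closure ⟨k, z, ⟨hk, hki⟩, rfl⟩

theorem radUnip_le_posUnip (i : ι) : radUnip 𝔾 b i ≤ posUnip 𝔾 b :=
  Subgroup.closure_mono (by rintro _ ⟨k, u, ⟨hk, _⟩, rfl⟩; exact ⟨k, u, hk, rfl⟩)

theorem posUnip_le_borel : posUnip 𝔾 b ≤ borel 𝔾 b :=
  Subgroup.closure_mono Set.subset_union_right

theorem torus_mem_borel (t : Diag X) : 𝔾.torus t ∈ borel 𝔾 b :=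
  Subgroup.subset_closure (Or.inl ⟨t, rfl⟩)

theorem torus_conj_posUnip (t : Diag X) {y : G} (hy : y ∈ posUnip 𝔾 b) :
    𝔾.torus t * y * (𝔾.torus t)⁻¹ ∈ posUnip 𝔾 b := by
  refine conj_mem_closure ?_ hy
  rintro _ ⟨k, u, hk, rfl⟩
  rw [𝔾.torus_conj]
  exact sl_mem_posUnip 𝔾 b hk _

theorem torus_conj_radUnip (i : ι) (t : Diag X) {y : G} (hy : y ∈ radUnip 𝔾 b i) :
    𝔾.torus t * y * (𝔾.torus t)⁻¹ ∈ radUnip 𝔾 b i := by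
  refine conj_mem_closure ?_ hy
  rintro _ ⟨k, u, ⟨hk, hki⟩, rfl⟩
  rw [𝔾.torus_conj]
  exact sl_mem_radUnip 𝔾 b hk hki _

/-- B = U T because T normalizes U. -/
theorem exists_of_mem_borel {y : G} (hy : y ∈ borel 𝔾 b) :
    ∃ u ∈ posUnip 𝔾 b, ∃ t, y = u * 𝔾.torus t := by
  induction hy using Subgroup.closure_induction with
  | mem x hx =>
    rcases hx with ⟨t, rfl⟩ | hx
    · exact ⟨1, one_mem _, t, (one_mul _).symm⟩
    · exact ⟨x, Subgroup.subset_closure hx, 1, by simp⟩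
  | one => exact ⟨1, one_mem _, 1, by simp⟩
  | mul x y _ _ hx hy =>
    obtain ⟨u, hu, t, rfl⟩ := hx
    obtain ⟨v, hv, s, rfl⟩ := hy
    exact ⟨u * (𝔾.torus t * v * (𝔾.torus t)⁻¹), mul_mem hu (torus_conj_posUnip 𝔾 b t hv), t * s,
      by rw [map_mul]; group⟩
  | inv x _ hx =>
    obtain ⟨u, hu, t, rfl⟩ := hx
    refine ⟨𝔾.torus t⁻¹ * u⁻¹ * (𝔾.torus t⁻¹)⁻¹, torus_conj_posUnip 𝔾 b _ (inv_mem hu), t⁻¹, ?_⟩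
    rw [map_inv]; group

theorem sl_lower_eq (i : ι) (z : ℂ) :
    𝔾.sl i (lowerSL z) = 𝔾.sl i (stepSL 0) * 𝔾.sl i (upperSL (-z)) * (𝔾.sl i (stepSL 0))⁻¹ := by
  rw [← map_inv, ← map_mul, ← map_mul, stepSL_conj_upperSL, neg_neg]

/-- The axiom `neg_notMem` excludes only U. Dividing the element u t by its conjugate under a torus
element s cancels t, since T is commutative, and leaves an element of U that is still a nontrivial
element of U_{-α}. -/
theorem lower_notMem_borel {i : ι} (hi : b.IsPos i) {z : ℂ} (hz : z ≠ 0) :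
    𝔾.sl i (lowerSL z) ∉ borel 𝔾 b := by
  intro h
  obtain ⟨u, hu, t, hut⟩ := exists_of_mem_borel 𝔾 b h
  have hconj : ∀ s : Diag X, 𝔾.torus s * 𝔾.sl i (lowerSL z) * (𝔾.torus s)⁻¹ =
      𝔾.sl i (lowerSL (((charValue (P.root i) s)⁻¹ : ℂˣ) * z)) := by
    intro s
    rw [← 𝔾.sl_neg, 𝔾.torus_conj, ← 𝔾.sl_neg, P.root_reflectionPerm, P.reflection_apply_self,
      charValue_neg]
  -- For s = α^∨(2) one has α(s) = 2² = 4, so conjugation by s multiplies the parameter of U_{-α} by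
  -- 1/4, and z - z/4 ≠ 0.
  let s : Diag X := cocharTorus P (P.coroot i) (Units.mk0 2 two_ne_zero)
  have hs : charValue (P.root i) s = Units.mk0 4 (by norm_num) := by
    rw [charValue_cocharTorus, P.root_coroot_two]
    ext
    norm_num
  have key : 𝔾.sl i (lowerSL (z - 4⁻¹ * z)) =
      u * (𝔾.torus s * u * (𝔾.torus s)⁻¹)⁻¹ := by
    have h1 := hconj s
    rw [hs] at h1
    have h2 : 𝔾.torus t * (𝔾.torus s)⁻¹ = (𝔾.torus s)⁻¹ * 𝔾.torus t := by
      rw [← map_inv, ← map_mul, ← map_mul, mul_comm]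
    have h3 : 𝔾.sl i (lowerSL (z - 4⁻¹ * z)) =
        𝔾.sl i (lowerSL z) * (𝔾.sl i (lowerSL (4⁻¹ * z)))⁻¹ := by
      rw [← 𝔾.sl_neg, ← 𝔾.sl_neg, ← 𝔾.sl_neg, ← map_inv, ← upperSL_neg, ← map_mul, ← upperSL_add,
        sub_eq_add_neg]
    have h4 : 𝔾.sl i (lowerSL (4⁻¹ * z)) =
        𝔾.torus s * 𝔾.sl i (lowerSL z) * (𝔾.torus s)⁻¹ := by
      rw [h1]; simp
    rw [h3, h4, hut]
    have h5 : 𝔾.torus s * (u * 𝔾.torus t) * (𝔾.torus s)⁻¹ =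
        (𝔾.torus s * u * (𝔾.torus s)⁻¹) * 𝔾.torus t := by
      rw [mul_assoc, mul_assoc u, h2, ← mul_assoc, ← mul_assoc]
    rw [h5]; group
  refine 𝔾.neg_notMem b i hi (z - 4⁻¹ * z) ?_ ?_
  · intro h0
    apply hz
    linear_combination (4 / 3 : ℂ) * h0
  · rw [key]
    exact mul_mem hu (inv_mem (torus_conj_posUnip 𝔾 b s hu))

/-- If t is central and α(t) ≠ 1, then x_α(c) = 1 for some c ≠ 0; conjugating by the lift of s_α
gives a nontrivial parameter of U_{-α} with value 1 in B, a contradiction. Conversely, a t in the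
kernel of all roots commutes with T and all U_{±α}, hence with the images of SL₂ and with G. -/
theorem torusCenter_eq_perp (b : P.Base) : torusCenter 𝔾 = perp (P.rootSpan ℤ) := by
  ext t
  constructor
  · intro ht
    have hpos : ∀ i, b.IsPos i → charValue (P.root i) t = 1 := by
      intro i hi
      by_contra hne
      have h1 := 𝔾.torus_conj t i 1
      have h2 : 𝔾.torus t * 𝔾.sl i (upperSL 1) * (𝔾.torus t)⁻¹ = 𝔾.sl i (upperSL 1) := by
        rw [← (Subgroup.mem_center_iff.1 ht _), mul_inv_cancel_right]
      rw [h2, mul_one] at h1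
      have h3 : 𝔾.sl i (upperSL ((charValue (P.root i) t : ℂ) - 1)) = 1 := by
        rw [sub_eq_add_neg, upperSL_add, map_mul, ← h1, ← map_mul, ← upperSL_add, add_neg_cancel,
          upperSL_zero, map_one]
      refine lower_notMem_borel 𝔾 b hi (z := 1 - (charValue (P.root i) t : ℂ)) ?_ ?_
      · intro h
        exact hne (Units.ext (sub_eq_zero.1 h).symm)
      · rw [sl_lower_eq, neg_sub, h3, mul_one, mul_inv_cancel]
        exact one_mem _
    refine mem_perp_span.2 ?_
    rintro _ ⟨i, rfl⟩
    rcases isPos_or_isPos_neg b i with hi | hi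
    · exact hpos i hi
    · have := hpos _ hi
      rwa [P.root_reflectionPerm, P.reflection_apply_self, charValue_neg, inv_eq_one] at this
  · intro ht
    have hroot : ∀ i, charValue (P.root i) t = 1 := fun i =>
      ht _ (Submodule.subset_span ⟨i, rfl⟩)
    have hu : ∀ i z, 𝔾.sl i (upperSL z) * 𝔾.torus t = 𝔾.torus t * 𝔾.sl i (upperSL z) := by
      intro i z
      have := 𝔾.torus_conj t i z
      rw [hroot, Units.val_one, one_mul, mul_inv_eq_iff_eq_mul] at this
      exact this.symm
    have hsl : ∀ i g, 𝔾.sl i g * 𝔾.torus t = 𝔾.torus t * 𝔾.sl i g := by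
      intro i g
      have : (⊤ : Subgroup _) ≤ (Subgroup.centralizer {𝔾.torus t}).comap (𝔾.sl i) := by
        rw [← closure_upperSL_lowerSL, Subgroup.closure_le]
        rintro _ (⟨z, rfl⟩ | ⟨z, rfl⟩)
        · exact Subgroup.mem_centralizer_singleton_iff.2 (hu i z)
        · refine Subgroup.mem_centralizer_singleton_iff.2 ?_
          rw [← 𝔾.sl_neg]
          exact hu _ z
      exact Subgroup.mem_centralizer_singleton_iff.1 (this (Subgroup.mem_top g))
    have hG : (⊤ : Subgroup G) ≤ Subgroup.centralizer {𝔾.torus t} := by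
      rw [← 𝔾.generates, Subgroup.closure_le]
      rintro _ (⟨s, rfl⟩ | ⟨i, g, rfl⟩)
      · refine Subgroup.mem_centralizer_singleton_iff.2 ?_
        rw [← map_mul, ← map_mul, mul_comm]
      · exact Subgroup.mem_centralizer_singleton_iff.2 (hsl i g)
    exact Subgroup.mem_center_iff.2 fun g =>
      Subgroup.mem_centralizer_singleton_iff.1 (hG (Subgroup.mem_top g))

/-- Height is additive, and positive roots are those of positive height. -/
theorem isPos_of_root_eq {i k l : ι} {m n : ℕ} (hm : 0 < m) (hi : b.IsPos i) (hk : b.IsPos k)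
    (hl : P.root l = m • P.root i + n • P.root k) : b.IsPos l := by
  obtain ⟨f, -, -, hf⟩ := b.exists_root_eq_sum_int i
  obtain ⟨g, -, -, hg⟩ := b.exists_root_eq_sum_int k
  have h : P.root l = ∑ j ∈ b.support, ((m : ℤ) * f j + n * g j) • P.root j := by
    rw [hl, hf, hg, Finset.smul_sum, Finset.smul_sum, ← Finset.sum_add_distrib]
    refine Finset.sum_congr rfl fun j _ => ?_
    module
  rw [b.isPos_iff] at hi hk ⊢
  rw [RootPairing.Base.height_eq_sum hf] at hi
  rw [RootPairing.Base.height_eq_sum hg] at hk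
  rw [RootPairing.Base.height_eq_sum h, Finset.sum_add_distrib, ← Finset.mul_sum, ← Finset.mul_sum]
  positivity

/-- Simple root homomorphisms intertwine the torus actions. -/
theorem torus_mul_step_mul (i : ι) (t : Diag X) (z : ℂ) :
    𝔾.torus (weylTorus P (σ P i) t) * 𝔾.sl i (stepSL z) * (𝔾.torus t)⁻¹ =
      𝔾.sl i (stepSL ((charValue (P.root i) t : ℂ) * z)) := by
  rw [← 𝔾.weyl_conj_torus, stepSL_eq z, stepSL_eq (_ * z), map_mul, map_mul, ← 𝔾.torus_conj]
  group

theorem step_inv (i : ι) : (𝔾.sl i (stepSL 0))⁻¹ =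
    𝔾.sl i (stepSL 0) * 𝔾.torus (cocharTorus P (P.coroot i) (-1))⁻¹ := by
  rw [map_inv, ← 𝔾.sl_diag, ← stepSL_mul_self, map_mul]
  group

/-- The commutator of U_α with U_γ involves only the roots mα + nγ with m, n ≥ 1. These are positive
and different from α, so U_α normalizes the group. -/
theorem upper_conj_radUnip [P.IsReduced] (i : b.support) (z : ℂ) {y : G} (hy : y ∈ radUnip 𝔾 b i) :
    𝔾.sl i (upperSL z) * y * (𝔾.sl i (upperSL z))⁻¹ ∈ radUnip 𝔾 b i := by
  refine conj_mem_closure ?_ hy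
  rintro _ ⟨k, u, ⟨hk, hki⟩, rfl⟩
  have hlin : LinearIndependent ℤ ![P.root i, P.root k] := by
    refine RootPairing.IsReduced.linearIndependent P (Ne.symm hki) fun h => ?_
    have hk' : k = P.reflectionPerm i i := by
      apply P.root.injective
      rw [P.root_reflectionPerm, P.reflection_apply_self, h, neg_neg]
    rw [hk', isPos_neg_iff_not] at hk
    exact hk (RootPairing.Base.isPos_of_mem_support i.2)
  have hcomm := 𝔾.commutator i k hlin z u
  have hle : Subgroup.closure {x : G | ∃ (l : ι) (m n : ℕ) (u : ℂ), 0 < m ∧ 0 < n ∧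
      P.root l = m • P.root i + n • P.root k ∧ x = 𝔾.sl l (upperSL u)} ≤ radUnip 𝔾 b i := by
    rw [Subgroup.closure_le]
    rintro _ ⟨l, m, n, v, hm, hn, hl, rfl⟩
    refine sl_mem_radUnip 𝔾 b ?_ ?_ v
    · exact isPos_of_root_eq b hm (RootPairing.Base.isPos_of_mem_support i.2) hk hl
    · rintro rfl
      -- If mα + nγ = α, then (m - 1)α + nγ = 0, and independence forces n = 0.
      have h2 := LinearIndependent.pair_iff.1 hlin ((m : ℤ) - 1) n (by
        rw [sub_smul, one_smul, natCast_zsmul, natCast_zsmul]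
        nth_rewrite 2 [hl]
        abel)
      have := h2.2
      omega
  have h1 := mul_mem (hle hcomm) (sl_mem_radUnip 𝔾 b (i := i.1) hk hki u)
  rwa [inv_mul_cancel_right] at h1

section Simple

variable [Finite ι] [P.IsReduced] (i : b.support)

/-- A simple reflection permutes the positive roots other than its own. -/
theorem step_conj_radUnip {y : G} (hy : y ∈ radUnip 𝔾 b i) :
    𝔾.sl i (stepSL 0) * y * (𝔾.sl i (stepSL 0))⁻¹ ∈ radUnip 𝔾 b i := by
  refine conj_mem_closure ?_ hy
  rintro _ ⟨k, u, ⟨hk, hki⟩, rfl⟩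
  obtain ⟨c, hc⟩ := 𝔾.weyl_conj_root i k
  rw [hc]
  refine sl_mem_radUnip 𝔾 b (hk.reflectionPerm i.2 hki) ?_ _
  intro h
  have hk' : k = P.reflectionPerm i i := by
    rw [← P.reflectionPerm_self i.1 k, h]
  rw [hk', isPos_neg_iff_not] at hk
  exact hk (RootPairing.Base.isPos_of_mem_support i.2)

theorem step_inv_conj_radUnip {y : G} (hy : y ∈ radUnip 𝔾 b i) :
    (𝔾.sl i (stepSL 0))⁻¹ * y * 𝔾.sl i (stepSL 0) ∈ radUnip 𝔾 b i := by
  have h := step_conj_radUnip 𝔾 b i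
    (torus_conj_radUnip 𝔾 b i (cocharTorus P (P.coroot i) (-1))⁻¹ hy)
  have e : (𝔾.sl i (stepSL 0))⁻¹ * y * 𝔾.sl i (stepSL 0) =
      (𝔾.sl i (stepSL 0))⁻¹ * y * ((𝔾.sl i (stepSL 0))⁻¹)⁻¹ := by rw [inv_inv]
  rw [e, step_inv]
  convert h using 1
  group

end Simple

end RootGroups

/-! ### Bruhat cells: multiplication by a simple step and disjointness. -/

section Bruhat

variable {ι X Y : Type*} [AddCommGroup X] [AddCommGroup Y] {P : RootDatum ι X Y}
  {G : Type*} [Group G]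

local notation "σ" => RootPairing.weylGroup.ofIdx

variable (𝔾 : ReductiveGroup P G) (b : P.Base)

@[simp] theorem wordLift_nil : wordLift 𝔾 b [] = 1 := rfl

@[simp] theorem wordLift_cons (i : b.support) (u : List b.support) :
    wordLift 𝔾 b (i :: u) = 𝔾.sl i.1 (stepSL 0) * wordLift 𝔾 b u := by simp [wordLift]

theorem wordLift_conj_torus (u : List b.support) (t : Diag X) :
    wordLift 𝔾 b u * 𝔾.torus t * (wordLift 𝔾 b u)⁻¹ = 𝔾.torus (weylTorus P (wordProd b u) t) := by
  induction u with
  | nil => simp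
  | cons i u ih =>
    rw [wordLift_cons, wordProd_cons, weylTorus_mul, ← 𝔾.weyl_conj_torus, ← ih]
    group

theorem wordLift_conj_root (u : List b.support) (j : ι) : ∃ c : ℂˣ, ∀ z : ℂ,
    wordLift 𝔾 b u * 𝔾.sl j (upperSL z) * (wordLift 𝔾 b u)⁻¹ =
      𝔾.sl (wordProd b u • j) (upperSL ((c : ℂ) * z)) := by
  induction u with
  | nil => exact ⟨1, by simp⟩
  | cons i u ih =>
    obtain ⟨c, hc⟩ := ih
    obtain ⟨d, hd⟩ := 𝔾.weyl_conj_root i (wordProd b u • j)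
    refine ⟨d * c, fun z => ?_⟩
    rw [wordLift_cons, wordProd_cons, mul_smul, ofIdx_smul_index, Units.val_mul, mul_assoc (d : ℂ),
      ← hd, ← hc]
    group

theorem upper_mul_wordLift (u : List b.support) (j : ι) (z : ℂ) : ∃ z' : ℂ,
    𝔾.sl j (upperSL z) * wordLift 𝔾 b u =
      wordLift 𝔾 b u * 𝔾.sl ((wordProd b u)⁻¹ • j) (upperSL z') := by
  obtain ⟨c, hc⟩ := wordLift_conj_root 𝔾 b u ((wordProd b u)⁻¹ • j)
  refine ⟨(c⁻¹ : ℂˣ) * z, ?_⟩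
  have := hc ((c⁻¹ : ℂˣ) * z)
  rw [smul_inv_smul, ← mul_assoc, Units.mul_inv, one_mul, mul_inv_eq_iff_eq_mul] at this
  exact this.symm

theorem torus_mul_wordLift (u : List b.support) (t : Diag X) :
    𝔾.torus t * wordLift 𝔾 b u =
      wordLift 𝔾 b u * 𝔾.torus (weylTorus P (wordProd b u)⁻¹ t) := by
  have := wordLift_conj_torus 𝔾 b u (weylTorus P (wordProd b u)⁻¹ t)
  rw [← weylTorus_mul, mul_inv_cancel, weylTorus_one, mul_inv_eq_iff_eq_mul] at this
  exact this.symm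

/-- Both lifts act on T in the same way, so their quotient centralizes T and therefore belongs to T.
-/
theorem wordLift_eq_mul_torus {u v : List b.support} (h : wordProd b u = wordProd b v) :
    ∃ t, wordLift 𝔾 b u = wordLift 𝔾 b v * 𝔾.torus t := by
  obtain ⟨t, ht⟩ := 𝔾.torus_centralizer ((wordLift 𝔾 b v)⁻¹ * wordLift 𝔾 b u) (by
    intro t
    have h1 := wordLift_conj_torus 𝔾 b u t
    have h2 := wordLift_conj_torus 𝔾 b v t
    rw [h, ← h2, mul_inv_eq_iff_eq_mul] at h1
    rw [mul_assoc, h1]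
    group)
  exact ⟨t, by rw [← ht, mul_inv_cancel_left]⟩

theorem bruhatCell_mul_mem {w : P.weylGroup} {x y : G} (hx : x ∈ bruhatCell 𝔾 b w)
    (hy : y ∈ borel 𝔾 b) : x * y ∈ bruhatCell 𝔾 b w := by
  obtain ⟨u, hu, c, hc, d, hd, rfl⟩ := hx
  exact ⟨u, hu, c, hc, d * y, mul_mem hd hy, by group⟩

theorem mul_bruhatCell_mem {w : P.weylGroup} {x y : G} (hx : x ∈ bruhatCell 𝔾 b w)
    (hy : y ∈ borel 𝔾 b) : y * x ∈ bruhatCell 𝔾 b w := by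
  obtain ⟨u, hu, c, hc, d, hd, rfl⟩ := hx
  exact ⟨u, hu, y * c, mul_mem hy hc, d, hd, by group⟩

theorem wordLift_mem_bruhatCell (u : List b.support) :
    wordLift 𝔾 b u ∈ bruhatCell 𝔾 b (wordProd b u) :=
  ⟨u, rfl, 1, one_mem _, 1, one_mem _, by simp⟩

/-- The normal form of an element of a Bruhat cell with respect to a given word. -/
theorem exists_of_mem_bruhatCell {u : List b.support} {x : G}
    (hx : x ∈ bruhatCell 𝔾 b (wordProd b u)) :
    ∃ v ∈ posUnip 𝔾 b, ∃ y ∈ borel 𝔾 b, x = v * wordLift 𝔾 b u * y := by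
  obtain ⟨u', hu', c, hc, d, hd, rfl⟩ := hx
  obtain ⟨v, hv, t, rfl⟩ := exists_of_mem_borel 𝔾 b hc
  obtain ⟨s, hs⟩ := wordLift_eq_mul_torus 𝔾 b hu'
  refine ⟨v, hv, 𝔾.torus (weylTorus P (wordProd b u)⁻¹ t) * 𝔾.torus s * d,
    mul_mem (mul_mem (torus_mem_borel 𝔾 b _) (torus_mem_borel 𝔾 b _)) hd, ?_⟩
  rw [hs, mul_assoc v, ← mul_assoc (𝔾.torus t), torus_mul_wordLift]
  group

/-- Moving U_{-α} past w turns it into the root subgroup of -w⁻¹α, a positive root by hypothesis. -/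
theorem lower_mul_wordLift (i : b.support) (u : List b.support) (z : ℂ)
    (h : ¬ b.IsPos ((wordProd b u)⁻¹ • i.1)) :
    ∃ y ∈ posUnip 𝔾 b, 𝔾.sl i (lowerSL z) * wordLift 𝔾 b u = wordLift 𝔾 b u * y := by
  obtain ⟨z', hz'⟩ := upper_mul_wordLift 𝔾 b u (P.reflectionPerm i i) z
  rw [𝔾.sl_neg] at hz'
  refine ⟨_, sl_mem_posUnip 𝔾 b ?_ z', hz'⟩
  rwa [reflectionPerm_reflectionPerm_self, isPos_neg_iff_not]

/-- Left multiplication by a non-trivial step does not leave the Bruhat cell if the reflection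
decreases the length; the formula describes the new unipotent part. -/
theorem step_mul_wordLift (i : b.support) (u : List b.support) (a : ℂˣ) (v : G)
    (h : ¬ b.IsPos ((wordProd b u)⁻¹ • i.1)) :
    ∃ y ∈ borel 𝔾 b, 𝔾.sl i (stepSL a) * v * wordLift 𝔾 b u =
      (𝔾.sl i (upperSL (-(a⁻¹ : ℂˣ))) * (𝔾.torus (cocharTorus P (P.coroot i) (-a⁻¹)) *
        (𝔾.sl i (lowerSL (a⁻¹ : ℂˣ)) * v * (𝔾.sl i (lowerSL (a⁻¹ : ℂˣ)))⁻¹) *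
        (𝔾.torus (cocharTorus P (P.coroot i) (-a⁻¹)))⁻¹)) * wordLift 𝔾 b u * y := by
  obtain ⟨y, hy, hyu⟩ := lower_mul_wordLift 𝔾 b i u (a⁻¹ : ℂˣ) h
  have ht := torus_mul_wordLift 𝔾 b u (cocharTorus P (P.coroot i) (-a⁻¹))
  refine ⟨_, mul_mem (torus_mem_borel 𝔾 b (weylTorus P (wordProd b u)⁻¹
    (cocharTorus P (P.coroot i) (-a⁻¹)))) (posUnip_le_borel 𝔾 b hy), ?_⟩
  rw [stepSL_bruhat, map_mul, map_mul, 𝔾.sl_diag]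
  set L := 𝔾.sl i (lowerSL (a⁻¹ : ℂˣ))
  set T := 𝔾.torus (cocharTorus P (P.coroot i) (-a⁻¹))
  set W := wordLift 𝔾 b u
  rw [mul_assoc _ W, ← mul_assoc W, ← ht, mul_assoc T W, ← hyu]
  group

variable [P.IsReduced]

/-- U = U_α R, where R is generated by the other positive root subgroups, because U_α normalizes R.
-/
theorem exists_of_mem_posUnip (i : b.support) {u : G} (hu : u ∈ posUnip 𝔾 b) :
    ∃ (c : ℂ), ∃ v ∈ radUnip 𝔾 b i, u = 𝔾.sl i (upperSL c) * v := by
  have hconj : ∀ (d : ℂ) {v : G}, v ∈ radUnip 𝔾 b i →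
      (𝔾.sl i (upperSL d))⁻¹ * v * 𝔾.sl i (upperSL d) ∈ radUnip 𝔾 b i := by
    intro d v hv
    have := upper_conj_radUnip 𝔾 b i (-d) hv
    rwa [upperSL_neg, map_inv, inv_inv] at this
  induction hu using Subgroup.closure_induction with
  | mem x hx =>
    obtain ⟨k, z, hk, rfl⟩ := hx
    by_cases hki : k = i
    · exact ⟨z, 1, one_mem _, by rw [hki, mul_one]⟩
    · exact ⟨0, _, sl_mem_radUnip 𝔾 b hk hki z, by simp⟩
  | one => exact ⟨0, 1, one_mem _, by simp⟩
  | mul x y _ _ hx hy =>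
    obtain ⟨c, v, hv, rfl⟩ := hx
    obtain ⟨d, v', hv', rfl⟩ := hy
    refine ⟨c + d, _, mul_mem (hconj d hv) hv', ?_⟩
    rw [upperSL_add, map_mul]
    group
  | inv x _ hx =>
    obtain ⟨c, v, hv, rfl⟩ := hx
    refine ⟨-c, _, hconj (-c) (inv_mem hv), ?_⟩
    rw [upperSL_neg, map_inv]
    group

variable [Finite ι]

theorem lower_conj_radUnip (i : b.support) (z : ℂ) {y : G} (hy : y ∈ radUnip 𝔾 b i) :
    𝔾.sl i (lowerSL z) * y * (𝔾.sl i (lowerSL z))⁻¹ ∈ radUnip 𝔾 b i := by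
  have := step_conj_radUnip 𝔾 b i (upper_conj_radUnip 𝔾 b i (-z) (step_inv_conj_radUnip 𝔾 b i hy))
  rw [sl_lower_eq]
  convert this using 1
  group

/-- The lift of s_α normalizes R and carries U_α to U_{-α}, which meets U trivially by the axiom
`neg_notMem`. -/
theorem eq_zero_of_upper_mem_radUnip (i : b.support) {c : ℂ}
    (h : 𝔾.sl i (upperSL c) ∈ radUnip 𝔾 b i) : c = 0 := by
  by_contra hc
  refine 𝔾.neg_notMem b i (RootPairing.Base.isPos_of_mem_support i.2) (-c) (neg_ne_zero.2 hc) ?_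
  have := step_conj_radUnip 𝔾 b i h
  rw [sl_lower_eq, neg_neg]
  exact radUnip_le_posUnip 𝔾 b i this

/-- The decomposition of a positive unipotent element along a simple root is unique. -/
theorem upper_mul_radUnip_inj (i : b.support) {c d : ℂ} {v v' : G} (hv : v ∈ radUnip 𝔾 b i)
    (hv' : v' ∈ radUnip 𝔾 b i)
    (h : 𝔾.sl i (upperSL c) * v = 𝔾.sl i (upperSL d) * v') : c = d ∧ v = v' := by
  have h1 : 𝔾.sl i (upperSL (c - d)) = v' * v⁻¹ := by
    rw [sub_eq_neg_add, upperSL_add, map_mul, upperSL_neg, map_inv, inv_mul_eq_iff_eq_mul,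
      ← mul_assoc, ← h, mul_inv_cancel_right]
  have h2 : c = d := sub_eq_zero.1 <| eq_zero_of_upper_mem_radUnip 𝔾 b i
    (h1 ▸ mul_mem hv' (inv_mem hv))
  subst h2
  exact ⟨rfl, mul_left_cancel h⟩

theorem step_rad_mem_bruhatCell (i : b.support) (u : List b.support) {v : G}
    (hv : v ∈ radUnip 𝔾 b i) : 𝔾.sl i (stepSL 0) * v * wordLift 𝔾 b u ∈
      bruhatCell 𝔾 b (σ P i.1 * wordProd b u) := by
  refine ⟨i :: u, by simp, _, posUnip_le_borel 𝔾 b (radUnip_le_posUnip 𝔾 b _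
    (step_conj_radUnip 𝔾 b i hv)), 1, one_mem _, ?_⟩
  rw [wordLift_cons]
  group

theorem step_mem_bruhatCell_of_isPos (i : b.support) (u : List b.support) (c : ℂ) {v : G}
    (hv : v ∈ radUnip 𝔾 b i) (h : b.IsPos ((wordProd b u)⁻¹ • i.1)) :
    𝔾.sl i (stepSL c) * v * wordLift 𝔾 b u ∈ bruhatCell 𝔾 b (σ P i.1 * wordProd b u) := by
  obtain ⟨z, hz⟩ := upper_mul_wordLift 𝔾 b u i c
  have h1 := bruhatCell_mul_mem 𝔾 b
    (step_rad_mem_bruhatCell 𝔾 b i u (upper_conj_radUnip 𝔾 b i c hv))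
    (posUnip_le_borel 𝔾 b (sl_mem_posUnip 𝔾 b h z))
  rw [mul_assoc _ (wordLift 𝔾 b u), ← hz] at h1
  convert h1 using 1
  rw [stepSL_eq, map_mul]
  group

theorem step_mem_bruhatCell_of_not_isPos (i : b.support) (u : List b.support) (a : ℂˣ) {v : G}
    (hv : v ∈ radUnip 𝔾 b i) (h : ¬ b.IsPos ((wordProd b u)⁻¹ • i.1)) :
    𝔾.sl i (stepSL a) * v * wordLift 𝔾 b u ∈ bruhatCell 𝔾 b (wordProd b u) := by
  obtain ⟨y, hy, e⟩ := step_mul_wordLift 𝔾 b i u a v h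
  rw [e]
  refine bruhatCell_mul_mem 𝔾 b (mul_bruhatCell_mem 𝔾 b (wordLift_mem_bruhatCell 𝔾 b u) ?_) hy
  refine posUnip_le_borel 𝔾 b (mul_mem (sl_mem_posUnip 𝔾 b
    (RootPairing.Base.isPos_of_mem_support i.2) _) (radUnip_le_posUnip 𝔾 b i ?_))
  exact torus_conj_radUnip 𝔾 b i _ (lower_conj_radUnip 𝔾 b i _ hv)

/-- The Tits axiom s B w ⊆ B w B ∪ B s w B. Which cell occurs depends on the U_α-component c of the
unipotent part: only a descent with c ≠ 0 stays in B w B. -/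
theorem step_mul_mem_bruhatCell (i : b.support) (w : P.weylGroup) {x : G}
    (hx : x ∈ bruhatCell 𝔾 b w) : 𝔾.sl i (stepSL 0) * x ∈ bruhatCell 𝔾 b w ∨
      𝔾.sl i (stepSL 0) * x ∈ bruhatCell 𝔾 b (σ P i.1 * w) := by
  obtain ⟨u, rfl⟩ := weylGroup_eq_wordProd b w
  obtain ⟨v, hv, y, hy, rfl⟩ := exists_of_mem_bruhatCell 𝔾 b hx
  obtain ⟨c, v, hv', rfl⟩ := exists_of_mem_posUnip 𝔾 b i hv
  have e : 𝔾.sl i (stepSL 0) * (𝔾.sl i (upperSL c) * v * wordLift 𝔾 b u * y) =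
      𝔾.sl i (stepSL c) * v * wordLift 𝔾 b u * y := by
    rw [stepSL_eq c, map_mul]; group
  rw [e]
  by_cases h : b.IsPos ((wordProd b u)⁻¹ • i.1)
  · exact Or.inr (bruhatCell_mul_mem 𝔾 b (step_mem_bruhatCell_of_isPos 𝔾 b i u c hv' h) hy)
  · by_cases hc : c = 0
    · subst hc
      exact Or.inr (bruhatCell_mul_mem 𝔾 b (step_rad_mem_bruhatCell 𝔾 b i u hv') hy)
    · exact Or.inl (bruhatCell_mul_mem 𝔾 b
        (step_mem_bruhatCell_of_not_isPos 𝔾 b i u (Units.mk0 c hc) hv' h) hy)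

/-- A lift in B conjugates simple root subgroups into B. No negative root subgroup lies in B, so w
keeps all simple roots positive and is trivial. -/
theorem wordProd_eq_one_of_wordLift_mem_borel (u : List b.support)
    (hu : wordLift 𝔾 b u ∈ borel 𝔾 b) : wordProd b u = 1 := by
  refine eq_one_of_forall_isPos b _ fun i => ?_
  by_contra h
  obtain ⟨c, hc⟩ := wordLift_conj_root 𝔾 b u i
  have h1 : 𝔾.sl (wordProd b u • i.1) (upperSL (c * 1)) ∈ borel 𝔾 b := by
    rw [← hc]
    exact mul_mem (mul_mem hu (posUnip_le_borel 𝔾 b (sl_mem_posUnip 𝔾 b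
      (RootPairing.Base.isPos_of_mem_support i.2) _))) (inv_mem hu)
  have h2 := (isPos_neg_iff_not b _).2 h
  set j := P.reflectionPerm (wordProd b u • i.1) (wordProd b u • i.1)
  have hj : P.reflectionPerm j j = wordProd b u • i.1 := by
    apply P.root.injective
    rw [P.root_reflectionPerm, P.reflection_apply_self, P.root_reflectionPerm,
      P.reflection_apply_self, neg_neg]
  rw [← hj, 𝔾.sl_neg] at h1
  exact lower_notMem_borel 𝔾 b h2 (by simp) h1

/-- Tits' induction on the shorter element: strip the first letter s of a reduced word of v = s v'.
Then v' B lies in one of the two cells that the Tits axiom allows for s B w, and the induction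
hypothesis identifies v' with w or s w. -/
theorem bruhatCell_disjoint_of_le {v w : P.weylGroup} (hle : weylLength b v ≤ weylLength b w)
    {x : G} (hv : x ∈ bruhatCell 𝔾 b v) (hw : x ∈ bruhatCell 𝔾 b w) : v = w := by
  obtain ⟨u, hu, rfl⟩ := exists_reduced_word b v
  induction u generalizing w x with
  | nil =>
    obtain ⟨u', rfl⟩ := weylGroup_eq_wordProd b w
    obtain ⟨c, hc, d, hd, rfl⟩ := exists_of_mem_bruhatCell 𝔾 b hv
    obtain ⟨c', hc', d', hd', e⟩ := exists_of_mem_bruhatCell 𝔾 b hw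
    rw [wordLift_nil, mul_one] at e
    refine (wordProd_eq_one_of_wordLift_mem_borel 𝔾 b u' ?_).symm
    have : wordLift 𝔾 b u' = c'⁻¹ * (c * d) * d'⁻¹ := by rw [e]; group
    rw [this]
    exact mul_mem (mul_mem (inv_mem (posUnip_le_borel 𝔾 b hc'))
      (mul_mem (posUnip_le_borel 𝔾 b hc) hd)) (inv_mem hd')
  | cons i u ih =>
    obtain ⟨c, hc, d, hd, rfl⟩ := exists_of_mem_bruhatCell 𝔾 b hv
    have hred : u.length = weylLength b (wordProd b u) := by
      refine le_antisymm ?_ (weylLength_wordProd_le b u)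
      have := weylLength_ofIdx_mul_le b i (wordProd b u)
      rw [← wordProd_cons, ← hu, List.length_cons] at this
      omega
    have hlt : weylLength b (wordProd b u) + 1 = weylLength b (wordProd b (i :: u)) := by
      rw [← hred, ← hu, List.length_cons]
    have hx : wordLift 𝔾 b (i :: u) ∈ bruhatCell 𝔾 b w := by
      have := bruhatCell_mul_mem 𝔾 b
        (mul_bruhatCell_mem 𝔾 b hw (inv_mem (posUnip_le_borel 𝔾 b hc))) (inv_mem hd)
      convert this using 1
      group
    -- A repeated letter cancels in W, so this is also a lift of the shorter element.
    have hmem : wordLift 𝔾 b (i :: i :: u) ∈ bruhatCell 𝔾 b (wordProd b u) := by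
      simpa using wordLift_mem_bruhatCell 𝔾 b (i :: i :: u)
    rcases step_mul_mem_bruhatCell 𝔾 b i w hx with h | h
    -- Here the shortened element equals w, which contradicts that v is at most as long as w.
    · have := ih (w := w) (by rwa [wordLift_cons]) (by omega) hmem hred
      rw [← this] at hle
      omega
    · have hw' := weylLength_ofIdx_mul_le b i (σ P i.1 * w)
      rw [ofIdx_mul_cancel_left] at hw'
      have := ih (w := σ P i.1 * w) (by rwa [wordLift_cons]) (by omega) hmem hred
      rw [wordProd_cons, this, ofIdx_mul_cancel_left]

/-- Different Bruhat cells are disjoint. -/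
theorem eq_of_mem_bruhatCell {v w : P.weylGroup} {x : G} (hv : x ∈ bruhatCell 𝔾 b v)
    (hw : x ∈ bruhatCell 𝔾 b w) : v = w := by
  rcases le_total (weylLength b v) (weylLength b w) with h | h
  · exact bruhatCell_disjoint_of_le 𝔾 b h hv hw
  · exact (bruhatCell_disjoint_of_le 𝔾 b h hw hv).symm

end Bruhat

/-! ### Stabilizers of points in the cell of a walk. -/

section Stabilizer

variable {ι X Y : Type*} [AddCommGroup X] [AddCommGroup Y] {P : RootDatum ι X Y}
  {G : Type*} [Group G] (b : P.Base) {l : ℕ} (α : Fin l → b.support)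

local notation "σ" => RootPairing.weylGroup.ofIdx

@[simp] theorem partialProd_zero : partialProd b α 0 = 1 := rfl

theorem partialProd_succ (k : Fin l) :
    partialProd b α k.succ = σ P (α k).1 * partialProd b α k.castSucc :=
  Fin.induction_succ _ _ _

theorem partialMap_succ (𝔾 : ReductiveGroup P G) (z : Fin l → ℂ) (k : Fin l) :
    partialMap 𝔾 b α z k.succ = 𝔾.sl (α k).1 (stepSL (z k)) * partialMap 𝔾 b α z k.castSucc :=
  Fin.induction_succ _ _ _

theorem ofIdx_mul_ne (i : ι) (w : P.weylGroup) : σ P i * w ≠ w := by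
  intro h
  have h1 : σ P i • P.root i = P.root i := by rw [mul_eq_right.1 h, one_smul]
  rw [ofIdx_smul_weight, P.reflection_apply_self] at h1
  have h2 := congrArg (fun x => P.toLinearMap x (P.coroot i)) h1
  simp at h2

/-- Q(p) is defined with π_k, the torus action with π_{k-1}. Since s_α α = -α the two characters are
inverse to each other and have the same kernel. -/
theorem partialProd_succ_inv_smul_root (k : Fin l) :
    (partialProd b α k.succ)⁻¹ • P.root (α k).1 =
      -((partialProd b α k.castSucc)⁻¹ • P.root (α k).1) := by
  rw [partialProd_succ, mul_inv_rev, ofIdx_inv, mul_smul, ofIdx_smul_weight,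
    P.reflection_apply_self, smul_neg]

theorem mem_perp_walkQ (p : Fin (l + 1) → P.weylGroup) (t : Diag X) :
    t ∈ perp (walkQ b α p) ↔ ∀ k ∈ stays p,
      charValue (P.root (α k).1) (weylTorus P (partialProd b α k.castSucc) t) = 1 := by
  rw [walkQ, mem_perp_span]
  constructor
  · intro h k hk
    have := h _ ⟨k, hk, rfl⟩
    rwa [partialProd_succ_inv_smul_root, charValue_neg, inv_eq_one] at this
  · rintro h _ ⟨k, hk, rfl⟩
    rw [partialProd_succ_inv_smul_root, charValue_neg, inv_eq_one]
    exact h k hk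

/-- Each factor intertwines t and s_α t, and the product telescopes. A fixed point thus has every
partial product g fixed under g ↦ (π_k t) g t⁻¹. -/
theorem torus_mul_partialMap (𝔾 : ReductiveGroup P G) (t : Diag X) (z : Fin l → ℂ)
    (k : Fin (l + 1)) :
    𝔾.torus (weylTorus P (partialProd b α k) t) * partialMap 𝔾 b α z k * (𝔾.torus t)⁻¹ =
      partialMap 𝔾 b α (torusAct b α t z) k := by
  induction k using Fin.induction with
  | zero => simp [partialMap]
  | succ k ih =>
    rw [partialMap_succ, partialMap_succ, ← ih, partialProd_succ, weylTorus_mul, torusAct,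
      ← torus_mul_step_mul]
    group

/-- `g` lies in `v w B` for a positive unipotent `v` that commutes with `s`. -/
def InFixedCell (𝔾 : ReductiveGroup P G) (w : P.weylGroup) (s : Diag X) (g : G) : Prop :=
  ∃ v ∈ posUnip 𝔾 b, Commute (𝔾.torus s) v ∧ ∃ u : List b.support, wordProd b u = w ∧
    ∃ y ∈ borel 𝔾 b, g = v * wordLift 𝔾 b u * y

variable {b} in
theorem InFixedCell.mem_bruhatCell {𝔾 : ReductiveGroup P G} {w : P.weylGroup} {s : Diag X} {g : G}
    (h : InFixedCell b 𝔾 w s g) : g ∈ bruhatCell 𝔾 b w := by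
  obtain ⟨v, hv, -, u, rfl, y, hy, rfl⟩ := h
  exact ⟨u, rfl, v, posUnip_le_borel 𝔾 b hv, y, hy, rfl⟩

variable [Finite ι] [P.IsReduced] (𝔾 : ReductiveGroup P G)

/-- A torus element that fixes a point of a Bruhat cell is in the kernel of the simple root of a
step that stays in this cell. -/
theorem charValue_eq_one_of_stay (i : b.support) (w : P.weylGroup) {g : G} (s t : Diag X) (z : ℂ)
    (hg : g ∈ bruhatCell 𝔾 b w) (hg' : 𝔾.sl i (stepSL z) * g ∈ bruhatCell 𝔾 b w)
    (hst : 𝔾.torus s * g * (𝔾.torus t)⁻¹ = g) (hz : (charValue (P.root i) s : ℂ) * z = z) :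
    charValue (P.root i) s = 1 := by
  by_contra hne
  have hne' : (charValue (P.root i) s : ℂ) ≠ 1 := fun h => hne (Units.ext h)
  -- A coordinate that is scaled by α(s) ≠ 1 and remains the same is zero.
  have hz0 : z = 0 := by
    by_contra h0
    exact hne' (mul_right_cancel₀ h0 (by rw [hz, one_mul]))
  subst hz0
  obtain ⟨u, rfl⟩ := weylGroup_eq_wordProd b w
  obtain ⟨v, hv, y, hy, rfl⟩ := exists_of_mem_bruhatCell 𝔾 b hg
  obtain ⟨c, v, hv', rfl⟩ := exists_of_mem_posUnip 𝔾 b i hv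
  have e : 𝔾.sl i (stepSL 0) * (𝔾.sl i (upperSL c) * v * wordLift 𝔾 b u * y) =
      𝔾.sl i (stepSL c) * v * wordLift 𝔾 b u * y := by
    rw [stepSL_eq c, map_mul]; group
  rw [e] at hg'
  -- A step with z = 0 leaves the cell at an ascent, and also at a descent if c = 0. What remains is
  -- a descent with c ≠ 0.
  by_cases h : b.IsPos ((wordProd b u)⁻¹ • i.1)
  · exact ofIdx_mul_ne i.1 (wordProd b u) (eq_of_mem_bruhatCell 𝔾 b (bruhatCell_mul_mem 𝔾 b
      (step_mem_bruhatCell_of_isPos 𝔾 b i u c hv' h) hy) hg')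
  by_cases hc : c = 0
  · subst hc
    exact ofIdx_mul_ne i.1 (wordProd b u) (eq_of_mem_bruhatCell 𝔾 b (bruhatCell_mul_mem 𝔾 b
      (step_rad_mem_bruhatCell 𝔾 b i u hv') hy) hg')
  set χ : ℂ := (charValue (P.root i) s : ℂ)
  have ha : χ * c - c ≠ 0 := by
    intro h0
    exact hne' (mul_right_cancel₀ hc (by rw [one_mul]; exact sub_eq_zero.1 h0))
  have hTW := torus_mul_wordLift 𝔾 b u s
  have hx := 𝔾.torus_conj s i c
  have hsplit : 𝔾.sl i (upperSL (χ * c - c)) = (𝔾.sl i (upperSL c))⁻¹ * 𝔾.sl i (upperSL (χ * c)) := by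
    rw [sub_eq_neg_add, upperSL_add, map_mul, upperSL_neg, map_inv]
  -- Invariance under s writes the coset of g in a second way, with c replaced by χc and v by its
  -- conjugate. Cancelling x_α(c) leaves x_α((χ - 1)c), whose parameter is nonzero.
  have key : 𝔾.sl i (upperSL (χ * c - c)) * (𝔾.torus s * v * (𝔾.torus s)⁻¹) * wordLift 𝔾 b u =
      v * wordLift 𝔾 b u * (y * (𝔾.torus t) * y⁻¹ *
        (𝔾.torus (weylTorus P (wordProd b u)⁻¹ s))⁻¹) := by
    rw [mul_inv_eq_iff_eq_mul] at hst
    have h1 : 𝔾.sl i (upperSL (χ * c)) * (𝔾.torus s * v * (𝔾.torus s)⁻¹) *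
        (𝔾.torus s * wordLift 𝔾 b u) * y =
        𝔾.sl i (upperSL c) * v * wordLift 𝔾 b u * y * 𝔾.torus t := by
      rw [← hst, ← hx]; group
    rw [hTW] at h1
    have h2 : 𝔾.sl i (upperSL (χ * c)) * (𝔾.torus s * v * (𝔾.torus s)⁻¹) * wordLift 𝔾 b u =
        𝔾.sl i (upperSL c) * v * wordLift 𝔾 b u * y * 𝔾.torus t * y⁻¹ *
          (𝔾.torus (weylTorus P (wordProd b u)⁻¹ s))⁻¹ := by
      rw [← h1]; group
    rw [hsplit, mul_assoc, mul_assoc, ← mul_assoc (𝔾.sl i (upperSL (χ * c))), h2]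
    group
  -- Multiply both sides of `key` by the lift of s_α: the left side stays in B w B as (χ - 1)c ≠ 0,
  -- the right side has no U_α-component and moves to B s_α w B.
  have hin := step_mem_bruhatCell_of_not_isPos 𝔾 b i u (Units.mk0 _ ha)
    (torus_conj_radUnip 𝔾 b i s hv') h
  have hout := bruhatCell_mul_mem 𝔾 b (step_rad_mem_bruhatCell 𝔾 b i u hv')
    (y := y * (𝔾.torus t) * y⁻¹ * (𝔾.torus (weylTorus P (wordProd b u)⁻¹ s))⁻¹)
    (mul_mem (mul_mem (mul_mem hy (torus_mem_borel 𝔾 b _)) (inv_mem hy))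
      (inv_mem (torus_mem_borel 𝔾 b _)))
  rw [mul_assoc _ v, mul_assoc, ← key] at hout
  rw [stepSL_eq, map_mul, Units.val_mk0, mul_assoc, mul_assoc,
    ← mul_assoc (𝔾.sl i (upperSL (χ * c - c)))] at hin
  exact ofIdx_mul_ne i.1 (wordProd b u) (eq_of_mem_bruhatCell 𝔾 b hout hin)

/-- The decomposition U = U_α R is unique and T normalizes both factors, so an element that commutes
with s has components that do. -/
theorem exists_of_commute (i : b.support) (s : Diag X) {v : G} (hv : v ∈ posUnip 𝔾 b)
    (hs : Commute (𝔾.torus s) v) : ∃ c : ℂ, (charValue (P.root i) s : ℂ) * c = c ∧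
      ∃ v' ∈ radUnip 𝔾 b i, Commute (𝔾.torus s) v' ∧ v = 𝔾.sl i (upperSL c) * v' := by
  obtain ⟨c, v', hv', rfl⟩ := exists_of_mem_posUnip 𝔾 b i hv
  have h : 𝔾.sl i (upperSL ((charValue (P.root i) s : ℂ) * c)) *
      (𝔾.torus s * v' * (𝔾.torus s)⁻¹) = 𝔾.sl i (upperSL c) * v' := by
    rw [← 𝔾.torus_conj, ← mul_inv_eq_iff_eq_mul.2 hs.eq]
    group
  obtain ⟨h1, h2⟩ := upper_mul_radUnip_inj 𝔾 b i (torus_conj_radUnip 𝔾 b i s hv') hv' h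
  exact ⟨c, h1, v', hv', mul_inv_eq_iff_eq_mul.1 h2, rfl⟩

/-- The coordinate z = -c cancels the U_α-component, so the step reaches s_α w whether it goes up or
down. It is allowed because α(s)c = c. -/
theorem exists_step_move (i : b.support) {w : P.weylGroup} {s : Diag X} {g : G}
    (h : InFixedCell b 𝔾 w s g) : ∃ z : ℂ, (charValue (P.root i) s : ℂ) * z = z ∧
      InFixedCell b 𝔾 (σ P i.1 * w) (weylTorus P (σ P i.1) s) (𝔾.sl i (stepSL z) * g) := by
  obtain ⟨v, hv, hs, u, rfl, y, hy, rfl⟩ := h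
  obtain ⟨c, hc, v', hv', hs', rfl⟩ := exists_of_commute b 𝔾 i s hv hs
  refine ⟨-c, by rw [mul_neg, hc], _, radUnip_le_posUnip 𝔾 b i (step_conj_radUnip 𝔾 b i hv'), ?_,
    i :: u, by simp, y, hy, ?_⟩
  · rw [← 𝔾.weyl_conj_torus]
    exact hs'.conj _
  · have e : 𝔾.sl i (stepSL (-c)) * 𝔾.sl i (upperSL c) = 𝔾.sl i (stepSL 0) := by
      rw [← map_mul, stepSL_mul_upperSL, neg_add_cancel]
    rw [wordLift_cons, ← e]
    group

/-- The coordinate z = 1 - c makes the U_α-component equal to 1; any nonzero value would keep the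
step in the cell at a descent. As α(s) = 1, s commutes with U_{±α} and T, hence with the new
unipotent part. -/
theorem exists_step_stay (i : b.support) {w : P.weylGroup} {s : Diag X} {g : G}
    (hpos : ¬ b.IsPos (w⁻¹ • i.1)) (hi : charValue (P.root i) s = 1)
    (h : InFixedCell b 𝔾 w s g) : ∃ z : ℂ, (charValue (P.root i) s : ℂ) * z = z ∧
      InFixedCell b 𝔾 w (weylTorus P (σ P i.1) s) (𝔾.sl i (stepSL z) * g) := by
  obtain ⟨v, hv, hs, u, rfl, y, hy, rfl⟩ := h
  obtain ⟨c, hc, v', hv', hs', rfl⟩ := exists_of_commute b 𝔾 i s hv hs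
  rw [weylTorus_ofIdx_of_charValue_eq_one i.1 s hi]
  have hup : ∀ z, Commute (𝔾.torus s) (𝔾.sl i (upperSL z)) := by
    intro z
    have := 𝔾.torus_conj s i z
    rw [hi, Units.val_one, one_mul] at this
    exact mul_inv_eq_iff_eq_mul.1 this
  have hlow : ∀ z, Commute (𝔾.torus s) (𝔾.sl i (lowerSL z)) := by
    intro z
    have := 𝔾.torus_conj s (P.reflectionPerm i i) z
    rw [P.root_reflectionPerm, P.reflection_apply_self, charValue_neg, hi, inv_one, Units.val_one,
      one_mul, 𝔾.sl_neg] at this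
    exact mul_inv_eq_iff_eq_mul.1 this
  have htor : ∀ t, Commute (𝔾.torus s) (𝔾.torus t) := fun t => by
    rw [Commute, SemiconjBy, ← map_mul, ← map_mul, mul_comm]
  obtain ⟨y', hy', e⟩ := step_mul_wordLift 𝔾 b i u 1 v' hpos
  have hV := mul_mem (sl_mem_posUnip 𝔾 b (RootPairing.Base.isPos_of_mem_support i.2)
    (-((1⁻¹ : ℂˣ) : ℂ))) (radUnip_le_posUnip 𝔾 b i (torus_conj_radUnip 𝔾 b i
      (cocharTorus P (P.coroot i) (-1⁻¹)) (lower_conj_radUnip 𝔾 b i ((1⁻¹ : ℂˣ) : ℂ) hv')))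
  refine ⟨1 - c, by rw [hi]; simp, _, hV, ?_, u, rfl, y' * y, mul_mem hy' hy, ?_⟩
  · exact (hup _).mul_right (((htor _).mul_right (((hlow _).mul_right hs').mul_right
      (hlow _).inv_right)).mul_right (htor _).inv_right)
  · have e1 : 𝔾.sl i (stepSL (1 - c)) * 𝔾.sl i (upperSL c) = 𝔾.sl i (stepSL (1 : ℂˣ)) := by
      rw [← map_mul, stepSL_mul_upperSL, sub_add_cancel, Units.val_one]
    rw [← mul_assoc _ y' y, ← e, ← e1]
    group

/-- The group generated by the stabilizers of the points of the cell of a walk that starts at the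
identity is the common kernel of the characters `π_k⁻¹ α_k` of the steps at which the walk stays. -/
theorem walkStab_eq_perp (p : Fin (l + 1) → P.weylGroup) (hp : IsWalk b α p) (hp0 : p 0 = 1) :
    walkStab 𝔾 b α p = perp (walkQ b α p) := by
  apply le_antisymm
  · rw [walkStab, Subgroup.closure_le]
    rintro t ⟨z, hz, htz⟩
    refine (mem_perp_walkQ b α p t).2 fun k hk => ?_
    have hcell : ∀ k, partialMap 𝔾 b α z k ∈ bruhatCell 𝔾 b (p k) := fun k => by
      simpa using hz k [] hp0.symm
    have h1 := hcell k.succ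
    rw [partialMap_succ, show p k.succ = p k.castSucc from hk] at h1
    refine charValue_eq_one_of_stay b 𝔾 (α k) _ _ t (z k) (hcell k.castSucc) h1 ?_ ?_
    · rw [torus_mul_partialMap, htz]
    · exact congrFun htz k
  · intro t ht
    rw [mem_perp_walkQ] at ht
    -- The coordinate is chosen for every g, with the invariant as a premise, because the partial
    -- products are only defined recursively from these choices. The value 0 is a default.
    have step : ∀ (k : Fin l) (g : G), ∃ z : ℂ,
        InFixedCell b 𝔾 (p k.castSucc) (weylTorus P (partialProd b α k.castSucc) t) g →
        (charValue (P.root (α k).1) (weylTorus P (partialProd b α k.castSucc) t) : ℂ) * z = z ∧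
        InFixedCell b 𝔾 (p k.succ) (weylTorus P (partialProd b α k.succ) t)
          (𝔾.sl (α k).1 (stepSL z) * g) := by
      intro k g
      by_cases hg : InFixedCell b 𝔾 (p k.castSucc) (weylTorus P (partialProd b α k.castSucc) t) g
      swap
      · exact ⟨0, fun h => absurd h hg⟩
      rw [partialProd_succ, weylTorus_mul]
      by_cases hk : k ∈ stays p
      -- Ascending edges must be followed, so a stay occurs only at a descent.
      · have hpos : ¬ b.IsPos ((p k.castSucc)⁻¹ • (α k).1) := by
          intro hpos
          have h1 := (hp k).1 (weylLength_lt_of_isPos b (α k) _ hpos)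
          rw [show p k.succ = p k.castSucc from hk] at h1
          exact ofIdx_mul_ne _ _ h1.symm
        obtain ⟨z, hz⟩ := exists_step_stay b 𝔾 (α k) hpos (ht k hk) hg
        rw [show p k.succ = p k.castSucc from hk]
        exact ⟨z, fun _ => hz⟩
      · have hmove : p k.succ = σ P (α k).1 * p k.castSucc := by
          by_cases hlt : weylLength b (p k.castSucc) < weylLength b (σ P (α k).1 * p k.castSucc)
          · exact (hp k).1 hlt
          · exact ((hp k).2 hlt).resolve_right hk
        obtain ⟨z, hz⟩ := exists_step_move b 𝔾 (α k) hg
        rw [hmove]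
        exact ⟨z, fun _ => hz⟩
    choose f hf using step
    let g : Fin (l + 1) → G := Fin.induction 1 fun k g => 𝔾.sl (α k).1 (stepSL (f k g)) * g
    have hgsucc : ∀ k : Fin l, g k.succ =
        𝔾.sl (α k).1 (stepSL (f k (g k.castSucc))) * g k.castSucc :=
      fun k => Fin.induction_succ _ _ _
    have hinv : ∀ k, InFixedCell b 𝔾 (p k) (weylTorus P (partialProd b α k) t) (g k) := by
      intro k
      induction k using Fin.induction with
      | zero => exact ⟨1, one_mem _, Commute.one_right _, [], hp0.symm, 1, one_mem _, by simp [g]⟩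
      | succ k ih =>
        rw [hgsucc]
        exact (hf k _ ih).2
    have hmap : ∀ k, partialMap 𝔾 b α (fun k => f k (g k.castSucc)) k = g k := by
      intro k
      induction k using Fin.induction with
      | zero => rfl
      | succ k ih => rw [partialMap_succ, ih, hgsucc]
    refine Subgroup.subset_closure ⟨fun k => f k (g k.castSucc), ?_, ?_⟩
    · intro k u hu
      rw [hmap]
      -- The cell is tested on all words that represent p_0 = 1; their lifts are torus elements,
      -- which the cell absorbs.
      obtain ⟨s, hs⟩ := wordLift_eq_mul_torus 𝔾 b (u := u) (v := []) (hu.trans hp0)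
      rw [hs, wordLift_nil, one_mul]
      exact bruhatCell_mul_mem 𝔾 b (hinv k).mem_bruhatCell (torus_mem_borel 𝔾 b s)
    · funext k
      exact (hf k _ (hinv k.castSucc)).1

end Stabilizer

/-- Comparing two surjections with the same kernel gives an isomorphism together with its values on
representatives, which is what the canonical pairings require. -/
theorem exists_mulEquiv_of_ker_eq {A B C : Type*} [Group A] [Group B] [Group C] (f : A →* B)
    (g : A →* C) (hf : Function.Surjective f) (hg : Function.Surjective g) (h : f.ker = g.ker) :
    ∃ e : B ≃* C, ∀ a, e (f a) = g a := by
  refine ⟨(QuotientGroup.quotientKerEquivOfSurjective f hf).symm.trans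
    ((QuotientGroup.quotientMulEquivOfEq h).trans
      (QuotientGroup.quotientKerEquivOfSurjective g hg)), fun a => ?_⟩
  have : f a = QuotientGroup.quotientKerEquivOfSurjective f hf (QuotientGroup.mk a) := rfl
  rw [this, MulEquiv.trans_apply, MulEquiv.symm_apply_apply]
  rfl

/-! ### Duality between abelian groups and diagonalizable groups. -/

section CharacterTheory

variable {M : Type*} [AddCommGroup M]

/-- A homomorphism to `ℂˣ`, written additively, as a point of `Hom(M, ℂˣ)`. -/
def toDiag (f : M →+ Additive ℂˣ) : Diag M := AddMonoidHom.toMultiplicativeLeft f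

/-- A point of `Hom(M, ℂˣ)` as an additive homomorphism. -/
def ofDiag (t : Diag M) : M →+ Additive ℂˣ where
  toFun m := Additive.ofMul (charValue m t)
  map_zero' := by simp
  map_add' x y := by rw [charValue_add, ofMul_mul]

/-- Restriction of homomorphisms along a homomorphism. -/
def diagComap {N : Type*} [AddCommGroup N] (f : N →+ M) : Diag M →* Diag N where
  toFun t := toDiag ((ofDiag t).comp f)
  map_one' := diag_ext fun _ => rfl
  map_mul' _ _ := diag_ext fun _ => rfl

@[simp] theorem charValue_diagComap {N : Type*} [AddCommGroup N] (f : N →+ M) (t : Diag M)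
    (n : N) : charValue n (diagComap f t) = charValue (f n) t := rfl

/-- An isomorphism of lattices induces an isomorphism of diagonalizable groups. -/
def diagCongr {N : Type*} [AddCommGroup N] (f : N ≃+ M) : Diag M ≃* Diag N :=
  (diagComap f.toAddMonoidHom).toMulEquiv (diagComap f.symm.toAddMonoidHom)
    (MonoidHom.ext fun t => diag_ext fun m => congrArg (charValue · t) (f.apply_symm_apply m))
    (MonoidHom.ext fun t => diag_ext fun m => congrArg (charValue · t) (f.symm_apply_apply m))

@[simp] theorem charValue_diagCongr {N : Type*} [AddCommGroup N] (f : N ≃+ M) (t : Diag M)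
    (n : N) : charValue n (diagCongr f t) = charValue (f n) t := rfl

/-- The point of `Hom(M / L, ℂˣ)` defined by a point of `Hom(M, ℂˣ)` that is trivial on `L`. -/
def descend (L : Submodule ℤ M) (t : Diag M) (ht : t ∈ perp L) : Diag (M ⧸ L) :=
  toDiag (L.liftQ (ofDiag t).toIntLinearMap fun x hx => ht x hx).toAddMonoidHom

/-- Roots exist in ℂ. Divisibility makes ℂˣ an injective abelian group by Baer's criterion, so
characters extend from subgroups. -/
instance : DivisibleBy (Additive ℂˣ) ℤ :=
  divisibleByOfSMulRightSurj _ _ fun {n} hn x => by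
    obtain ⟨z, hz⟩ := IsAlgClosed.exists_pow_nat_eq (x.toMul : ℂ) (Int.natAbs_pos.2 hn)
    have hz0 : z ≠ 0 := by
      rintro rfl
      rw [zero_pow (Int.natAbs_pos.2 hn).ne'] at hz
      exact x.toMul.ne_zero hz.symm
    have hu : (Units.mk0 z hz0) ^ n.natAbs = x.toMul := Units.ext (by simpa using hz)
    rcases Int.natAbs_eq n with h | h
    · refine ⟨Additive.ofMul (Units.mk0 z hz0), ?_⟩
      rw [h]
      change Additive.ofMul ((Units.mk0 z hz0) ^ (n.natAbs : ℤ)) = x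
      rw [zpow_natCast, hu]; rfl
    · refine ⟨Additive.ofMul (Units.mk0 z hz0)⁻¹, ?_⟩
      rw [h]
      change Additive.ofMul ((Units.mk0 z hz0)⁻¹ ^ (-(n.natAbs : ℤ))) = x
      rw [inv_zpow, zpow_neg, inv_inv, zpow_natCast, hu]; rfl

/-- Characters with values in `ℂˣ` extend from subgroups. -/
theorem exists_diag_extension (R : Submodule ℤ M) (f : Diag R) :
    ∃ t : Diag M, ∀ r : R, charValue (r : M) t = charValue r f := by
  obtain ⟨g, hg⟩ := (Module.Baer.of_divisible (Additive ℂˣ)).extension_property_addMonoidHom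
    R.subtype.toAddMonoidHom R.injective_subtype (ofDiag f)
  exact ⟨toDiag g, fun r => DFunLike.congr_fun hg r⟩

/-- The embedding of `ℚ/ℤ` into `ℂˣ`. -/
def rootOfUnityHom : AddCircle (1 : ℚ) →+ Additive ℂˣ :=
  QuotientAddGroup.lift _
    { toFun := fun q : ℚ => Additive.ofMul
        (Units.mk0 (Complex.exp (2 * Real.pi * Complex.I * q)) (Complex.exp_ne_zero _))
      map_zero' := by
        apply Additive.toMul.injective; ext; simp
      map_add' := fun x y => by
        apply Additive.toMul.injective
        ext
        simp [mul_add, Complex.exp_add] } (by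
    rintro _ ⟨n, rfl⟩
    apply Additive.toMul.injective
    ext
    simp only [AddMonoidHom.coe_mk, ZeroHom.coe_mk, toMul_ofMul, Units.val_mk0, zsmul_eq_mul,
      mul_one, toMul_zero, Units.val_one]
    exact Complex.exp_eq_one_iff.2 ⟨n, by push_cast; ring⟩)

theorem rootOfUnityHom_injective : Function.Injective rootOfUnityHom := by
  rw [injective_iff_map_eq_zero]
  intro a ha
  induction a using QuotientAddGroup.induction_on with
  | H q =>
    have h1 : Complex.exp (2 * Real.pi * Complex.I * q) = 1 :=
      congrArg (fun x : Additive ℂˣ => (x.toMul : ℂ)) ha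
    obtain ⟨n, hn⟩ := Complex.exp_eq_one_iff.1 h1
    rw [mul_comm (n : ℂ)] at hn
    have h2 := mul_left_cancel₀ Complex.two_pi_I_ne_zero hn
    rw [QuotientAddGroup.eq_zero_iff]
    exact ⟨n, by simpa using (by exact_mod_cast h2.symm : (n : ℚ) = q)⟩

/-- Homomorphisms to ℚ/ℤ separate points, and ℚ/ℤ embeds into ℂˣ as the roots of unity. -/
theorem exists_charValue_ne_one {m : M} (hm : m ≠ 0) : ∃ t : Diag M, charValue m t ≠ 1 := by
  obtain ⟨c, hc⟩ := CharacterModule.exists_character_apply_ne_zero_of_ne_zero hm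
  refine ⟨toDiag (rootOfUnityHom.comp c), fun h => hc (rootOfUnityHom_injective ?_)⟩
  rw [map_zero]
  exact h

/-- Biduality: if x is not in L, some character of M/L is nontrivial on its class. -/
theorem mem_of_forall_mem_perp {L : Submodule ℤ M} {x : M}
    (h : ∀ t ∈ perp L, charValue x t = 1) : x ∈ L := by
  by_contra hx
  obtain ⟨t, ht⟩ := exists_charValue_ne_one (m := (Submodule.Quotient.mk x : M ⧸ L))
    (fun h0 => hx ((Submodule.Quotient.mk_eq_zero L).1 h0))
  refine ht (h (diagComap L.mkQ.toAddMonoidHom t) fun y hy => ?_)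
  rw [charValue_diagComap]
  change charValue (Submodule.Quotient.mk y) t = 1
  rw [(Submodule.Quotient.mk_eq_zero L).2 hy, charValue_zero]

theorem perp_anti {L N : Submodule ℤ M} (h : L ≤ N) : perp N ≤ perp L :=
  fun _ ht x hx => ht x (h hx)

/-- The characters are closed under multiplication, so their linear span is already an algebra. This
makes Dedekind's theorem applicable to regular functions. -/
theorem diagRegular_toSubmodule : (diagRegular M).toSubmodule =
    Submodule.span ℂ (Set.range fun (m : M) (t : Diag M) => (charValue m t : ℂ)) := by
  let f : Multiplicative M →* (Diag M → ℂ) :=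
    { toFun := fun m t => (charValue m.toAdd t : ℂ)
      map_one' := by ext; simp
      map_mul' := fun x y => by ext; simp [charValue_add] }
  have h : (Set.range fun (m : M) (t : Diag M) => (charValue m t : ℂ)) = (MonoidHom.mrange f : Set _) :=
    rfl
  rw [diagRegular, Algebra.adjoin_eq_span, h, Submonoid.closure_eq]

/-- Dedekind's independence of characters: a character in the linear span of a family of
characters is a member of it. -/
theorem mem_range_of_mem_span {A κ : Type*} [Group A] (χ : A →* ℂˣ) (ψ : κ → A →* ℂˣ)
    (h : (fun a => (χ a : ℂ)) ∈ Submodule.span ℂ (Set.range fun k a => (ψ k a : ℂ))) :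
    ∃ k, χ = ψ k := by
  have hind := linearIndependent_monoidHom A ℂ
  by_contra! hne
  refine hind.notMem_span_image (s := Set.range fun k => (Units.coeHom ℂ).comp (ψ k))
    (x := (Units.coeHom ℂ).comp χ) ?_ ?_
  · rintro ⟨k, hk⟩
    exact hne k (MonoidHom.ext fun a => Units.ext (DFunLike.congr_fun hk a).symm)
  · rw [← Set.range_comp]
    exact h

/-- Evaluation of the characters in `M` on `Hom(M, ℂˣ)`. -/
def evalChar (M : Type*) [AddCommGroup M] : Multiplicative M →* (Diag M →* ℂˣ) where
  toFun m :=
    { toFun := fun t => charValue m.toAdd t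
      map_one' := rfl
      map_mul' := fun _ _ => rfl }
  map_one' := MonoidHom.ext fun t => charValue_zero t
  map_mul' x y := MonoidHom.ext fun t => charValue_add x.toAdd y.toAdd t

theorem evalChar_injective : Function.Injective (evalChar M) := by
  rw [injective_iff_map_eq_one]
  intro m hm
  by_contra hne
  obtain ⟨t, ht⟩ := exists_charValue_ne_one (m := m.toAdd) (fun h => hne (toAdd_eq_zero.1 h))
  exact ht (DFunLike.congr_fun hm t)

theorem charValue_mem_diagRegular (m : M) :
    (fun t : Diag M => (charValue m t : ℂ)) ∈ diagRegular M :=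
  Algebra.subset_adjoin ⟨m, rfl⟩

/-- A finitely generated group is the group of algebraic characters of its dual. -/
theorem exists_equiv_charGroup_diagRegular (M : Type*) [AddCommGroup M] :
    ∃ e : Multiplicative M ≃* charGroup (diagRegular M),
      ∀ (m : M) (t : Diag M), (e (Multiplicative.ofAdd m)).1 t = charValue m t := by
  let f : Multiplicative M →* charGroup (diagRegular M) := (evalChar M).codRestrict _ fun m =>
    ⟨charValue_mem_diagRegular m.toAdd, by
      have := charValue_mem_diagRegular (-m.toAdd)
      simp only [charValue_neg] at this
      exact this⟩
  refine ⟨MulEquiv.ofBijective f ⟨fun x y hxy => evalChar_injective (congrArg Subtype.val hxy),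
    ?_⟩, fun m t => rfl⟩
  rintro ⟨χ, hχ⟩
  have h1 : (fun t => (χ t : ℂ)) ∈ (diagRegular M).toSubmodule := hχ.1
  rw [diagRegular_toSubmodule] at h1
  obtain ⟨m, hm⟩ := mem_range_of_mem_span χ (fun m : M => evalChar M (Multiplicative.ofAdd m)) h1
  exact ⟨Multiplicative.ofAdd m, Subtype.ext hm.symm⟩

theorem mem_subgroupRegular {A : Type*} [Group A] (O : Subalgebra ℂ (A → ℂ)) (H : Subgroup A)
    (f : H → ℂ) : f ∈ subgroupRegular O H ↔ ∃ F ∈ O, f = fun h : H => F h := by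
  refine ⟨fun hf => ?_, fun hf => Algebra.subset_adjoin hf⟩
  induction hf using Algebra.adjoin_induction with
  | mem f hf => exact hf
  | algebraMap r => exact ⟨_, O.algebraMap_mem r, rfl⟩
  | add f g _ _ hf hg =>
    obtain ⟨F, hF, rfl⟩ := hf
    obtain ⟨F', hF', rfl⟩ := hg
    exact ⟨_, add_mem hF hF', rfl⟩
  | mul f g _ _ hf hg =>
    obtain ⟨F, hF, rfl⟩ := hf
    obtain ⟨F', hF', rfl⟩ := hg
    exact ⟨_, mul_mem hF hF', rfl⟩

section Quotients

variable {A : Type*} [Group A] (φ : Diag M →* A) (R L : Submodule ℤ M) (S : Subgroup (Diag M))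

/-- The image of `L^⊥` under a homomorphism with kernel `R^⊥` is `Hom(R / L, ℂˣ)`. -/
theorem exists_equiv_diag (hLR : L ≤ R) (hS : S = perp L)
    (hφ : ∀ t ∈ S, φ t = 1 ↔ t ∈ perp R) :
    ∃ e : S.map φ ≃* Diag (R ⧸ L.submoduleOf R), ∀ (r : R) (t : Diag M) (ht : t ∈ S),
      charValue (Submodule.Quotient.mk r) (e ⟨φ t, Subgroup.mem_map_of_mem _ ht⟩) =
        charValue (r : M) t := by
  subst hS
  have hmem : ∀ t ∈ perp L, diagComap R.subtype.toAddMonoidHom t ∈ perp (L.submoduleOf R) :=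
    fun t ht r hr => ht r hr
  let g : perp L →* Diag (R ⧸ L.submoduleOf R) :=
    { toFun := fun t => descend _ _ (hmem t.1 t.2)
      map_one' := diag_ext fun q => by
        induction q using Submodule.Quotient.induction_on with
        | H r => rfl
      map_mul' := fun s t => diag_ext fun q => by
        induction q using Submodule.Quotient.induction_on with
        | H r => rfl }
  have hg : ∀ (t : perp L) (r : R), charValue (Submodule.Quotient.mk r) (g t) =
      charValue (r : M) t.1 := fun t r => rfl
  obtain ⟨e, he⟩ := exists_mulEquiv_of_ker_eq (φ.subgroupMap (perp L)) g
    (φ.subgroupMap_surjective _) (by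
      intro d
      -- Surjectivity: pull a character of R/L back to R and extend it to M; the extension is still
      -- trivial on L.
      obtain ⟨t, ht⟩ := exists_diag_extension R
        (diagComap (L.submoduleOf R).mkQ.toAddMonoidHom d)
      refine ⟨⟨t, fun x hx => ?_⟩, diag_ext fun q => ?_⟩
      · rw [ht ⟨x, hLR hx⟩, charValue_diagComap]
        change charValue (Submodule.Quotient.mk _) d = 1
        rw [(Submodule.Quotient.mk_eq_zero _).2 (show (⟨x, hLR hx⟩ : R) ∈ L.submoduleOf R from hx),
          charValue_zero]
      · induction q using Submodule.Quotient.induction_on with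
        | H r => exact ht r) (by
      ext t
      rw [MonoidHom.mem_ker, MonoidHom.mem_ker, Subtype.ext_iff]
      refine (hφ t.1 t.2).trans ⟨fun h => ?_, fun h r hr => ?_⟩
      · refine diag_ext fun q => ?_
        induction q using Submodule.Quotient.induction_on with
        | H r => exact h r r.2
      · have := congrArg (charValue (Submodule.Quotient.mk ⟨r, hr⟩)) h
        exact this)
  exact ⟨e, fun r t ht => by rw [← hg ⟨t, ht⟩ r, ← he]; rfl⟩

/-- The algebraic characters of the image of `L^⊥` under a homomorphism with kernel `R^⊥` are given
by `R / L`. -/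
theorem exists_equiv_charGroup (hLR : L ≤ R) (hS : S = perp L)
    (hφ : ∀ t ∈ S, φ t = 1 ↔ t ∈ perp R) (O : Subalgebra ℂ (A → ℂ))
    (hO : ∀ F ∈ O, (fun t => F (φ t)) ∈ diagRegular M)
    (hR : ∀ x ∈ R, ∃ F ∈ O, ∀ t, F (φ t) = charValue x t) :
    ∃ e : Multiplicative (R ⧸ L.submoduleOf R) ≃* charGroup (subgroupRegular O (S.map φ)),
      ∀ (r : R) (t : Diag M) (ht : t ∈ S),
        (e (Multiplicative.ofAdd (Submodule.Quotient.mk r))).1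
          ⟨φ t, Subgroup.mem_map_of_mem _ ht⟩ = charValue (r : M) t := by
  obtain ⟨e, he⟩ := exists_equiv_diag φ R L S hLR hS hφ
  have hreg : ∀ q : R ⧸ L.submoduleOf R,
      (fun a : S.map φ => (charValue q (e a) : ℂ)) ∈ subgroupRegular O (S.map φ) := by
    intro q
    induction q using Submodule.Quotient.induction_on with
    | H r =>
      obtain ⟨F, hF, hFr⟩ := hR r r.2
      refine (mem_subgroupRegular _ _ _).2 ⟨F, hF, ?_⟩
      funext a
      obtain ⟨_, t, ht, rfl⟩ := a
      rw [hFr]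
      exact congrArg Units.val (he r t ht)
  let f : Multiplicative (R ⧸ L.submoduleOf R) →* charGroup (subgroupRegular O (S.map φ)) :=
    ((MonoidHom.compHom' e.toMonoidHom).comp (evalChar _)).codRestrict _ fun q =>
      ⟨hreg q.toAdd, by
        have := hreg (-q.toAdd)
        simp only [charValue_neg] at this
        exact this⟩
  refine ⟨MulEquiv.ofBijective f ⟨fun x y hxy => evalChar_injective (MonoidHom.ext fun d => ?_),
    ?_⟩, fun r t ht => he r t ht⟩
  · obtain ⟨a, rfl⟩ := e.surjective d
    exact DFunLike.congr_fun (congrArg Subtype.val hxy) a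
  · rintro ⟨χ, hχ⟩
    obtain ⟨F, hF, hFχ⟩ := (mem_subgroupRegular _ _ _).1 hχ.1
    have h1 : (fun t => F (φ t)) ∈ (diagRegular M).toSubmodule := hO F hF
    rw [diagRegular_toSubmodule] at h1
    -- A regular character of the image pulls back to a linear combination of characters in M,
    -- restricted to S. By independence it is one of them.
    have h2 := Submodule.mem_map_of_mem (f := LinearMap.funLeft ℂ ℂ (Subtype.val : S → Diag M)) h1
    rw [Submodule.map_span, ← Set.range_comp] at h2
    obtain ⟨x, hx⟩ := mem_range_of_mem_span (χ.comp (φ.subgroupMap S))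
      (fun x : M => (evalChar M (Multiplicative.ofAdd x)).comp S.subtype) (by
        have h3 : (fun t => ((χ.comp (φ.subgroupMap S)) t : ℂ)) =
            LinearMap.funLeft ℂ ℂ (Subtype.val : S → Diag M) fun t => F (φ t) := by
          funext t
          exact congrFun hFχ (φ.subgroupMap S t)
        rw [h3]
        exact h2)
    have hx' : ∀ (t : Diag M) (ht : t ∈ S),
        χ ⟨φ t, Subgroup.mem_map_of_mem _ ht⟩ = charValue x t :=
      fun t ht => DFunLike.congr_fun hx ⟨t, ht⟩
    -- The character factors through φ, which is trivial on the annihilator of R; biduality gives x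
    -- ∈ R.
    have hxR : x ∈ R := mem_of_forall_mem_perp fun t ht => by
      have htS : t ∈ S := hS ▸ perp_anti hLR ht
      rw [← hx' t htS]
      have : (⟨φ t, Subgroup.mem_map_of_mem _ htS⟩ : S.map φ) = 1 :=
        Subtype.ext ((hφ t htS).2 ht)
      rw [this, map_one]
    refine ⟨Multiplicative.ofAdd (Submodule.Quotient.mk ⟨x, hxR⟩), Subtype.ext ?_⟩
    refine MonoidHom.ext fun a => ?_
    obtain ⟨_, t, ht, rfl⟩ := a
    exact (he ⟨x, hxR⟩ t ht).trans (hx' t ht).symm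

end Quotients

end CharacterTheory

theorem perp_sup {M : Type*} [AddCommGroup M] (L N : Submodule ℤ M) :
    perp (L ⊔ N) = perp L ⊓ perp N := by
  refine le_antisymm (le_inf (perp_anti le_sup_left) (perp_anti le_sup_right)) ?_
  rintro t ⟨hL, hN⟩ x hx
  obtain ⟨y, hy, z, hz, rfl⟩ := Submodule.mem_sup.1 hx
  rw [charValue_add, hL y hy, hN z hz, one_mul]

/-- The cocycle identity (vw - 1)y = (v - 1)wy + (w - 1)y reduces the claim to generators. -/
theorem smul_sub_mem_of_mem_closure {Γ X : Type*} [Group Γ] [AddCommGroup X]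
    [DistribMulAction Γ X] {s : Set Γ} {L N : Submodule ℤ X}
    (hL : ∀ (w : Γ), ∀ y ∈ L, w • y ∈ L) (h : ∀ w ∈ s, ∀ y ∈ L, w • y - y ∈ N) {w : Γ}
    (hw : w ∈ Subgroup.closure s) : ∀ y ∈ L, w • y - y ∈ N := by
  induction hw using Subgroup.closure_induction with
  | mem w hw => exact h w hw
  | one => intro y _; simp
  | mul v w _ _ hv hw =>
    intro y hy
    have := add_mem (hv (w • y) (hL w y hy)) (hw y hy)
    rwa [sub_add_sub_cancel, smul_smul] at this
  | inv v _ hv =>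
    intro y hy
    have := neg_mem (hv (v⁻¹ • y) (hL v⁻¹ y hy))
    rwa [smul_inv_smul, neg_sub] at this

/-! ### Handle lattices and the stabilizers S_β(p) and S̃_β(p). -/

section Handles

variable {ι X Y : Type*} [AddCommGroup X] [AddCommGroup Y] {P : RootDatum ι X Y}
  {G : Type*} [Group G] {b : P.Base}

local notation "σ" => RootPairing.weylGroup.ofIdx

theorem smul_sub_mem_rootSpan (w : P.weylGroup) (x : X) : w • x - x ∈ P.rootSpan ℤ := by
  have hw : w ∈ Subgroup.closure (Set.range (σ P)) := by
    obtain ⟨w, hw⟩ := w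
    induction hw using RootPairing.weylGroup.induction with
    | mem i => exact Subgroup.subset_closure ⟨i, rfl⟩
    | one => exact one_mem _
    | mul x y hx hy ihx ihy => exact mul_mem ihx ihy
  refine smul_sub_mem_of_mem_closure (L := ⊤) (fun _ _ _ => trivial) ?_ hw x trivial
  rintro _ ⟨i, rfl⟩ y _
  rw [ofIdx_smul_weight, P.reflection_apply, sub_right_comm, sub_self, zero_sub]
  exact neg_mem (Submodule.smul_mem _ _ (Submodule.subset_span ⟨i, rfl⟩))

theorem smul_mem_rootSpan (w : P.weylGroup) {x : X} (hx : x ∈ P.rootSpan ℤ) :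
    w • x ∈ P.rootSpan ℤ := by
  have := add_mem (smul_sub_mem_rootSpan w x) hx
  rwa [sub_add_cancel] at this

theorem walkQ_le_rootSpan {l : ℕ} (α : Fin l → b.support) (p : Fin (l + 1) → P.weylGroup) :
    walkQ b α p ≤ P.rootSpan ℤ := by
  rw [walkQ, Submodule.span_le]
  rintro _ ⟨k, -, rfl⟩
  exact smul_mem_rootSpan _ (Submodule.subset_span ⟨_, rfl⟩)

/-- `∑_{i,j} (π_j⁽ⁱ⁾ - 1) L`. -/
def HandleWord.handleLattice (β : HandleWord b) (L : Submodule ℤ X) : Submodule ℤ X :=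
  Submodule.span ℤ {x | ∃ i, ∃ y ∈ L, x = β.fst i • y - y ∨ x = β.snd i • y - y}

/-- `∑_{i,j} w_i (π_j⁽ⁱ⁾ - 1) L`. -/
def HandleWord.twistedLattice (β : HandleWord b) (L : Submodule ℤ X) : Submodule ℤ X :=
  Submodule.span ℤ {x | ∃ i, ∃ y ∈ L, x = β.twist i • (β.fst i • y - y) ∨
    x = β.twist i • (β.snd i • y - y)}

/-- The subgroup of the Weyl group generated by the handle elements `π_j⁽ⁱ⁾`. -/
def HandleWord.handleGroup (β : HandleWord b) : Subgroup P.weylGroup :=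
  Subgroup.closure {w | ∃ i, w = β.fst i ∨ w = β.snd i}

theorem HandleWord.handleLattice_le (β : HandleWord b) {L : Submodule ℤ X} :
    β.handleLattice L ≤ P.rootSpan ℤ := by
  rw [handleLattice, Submodule.span_le]
  rintro _ ⟨i, y, -, rfl | rfl⟩ <;> exact smul_sub_mem_rootSpan _ _

theorem HandleWord.handleLattice_le_self (β : HandleWord b) {L : Submodule ℤ X}
    (hL : ∀ (w : P.weylGroup), ∀ y ∈ L, w • y ∈ L) : β.handleLattice L ≤ L := by
  rw [handleLattice, Submodule.span_le]
  rintro _ ⟨i, y, hy, rfl | rfl⟩ <;> exact sub_mem (hL _ _ hy) hy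

theorem HandleWord.smul_sub_mem_handleLattice (β : HandleWord b) {L : Submodule ℤ X}
    (hL : ∀ (w : P.weylGroup), ∀ y ∈ L, w • y ∈ L) {w : P.weylGroup} (hw : w ∈ β.handleGroup)
    {y : X} (hy : y ∈ L) : w • y - y ∈ β.handleLattice L := by
  refine smul_sub_mem_of_mem_closure hL ?_ hw y hy
  rintro w ⟨i, hi⟩ y hy
  exact Submodule.subset_span ⟨i, y, hy, hi.imp (by rintro rfl; rfl) (by rintro rfl; rfl)⟩

theorem HandleWord.smul_mem_handleLattice (β : HandleWord b) {L : Submodule ℤ X}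
    (hL : ∀ (w : P.weylGroup), ∀ y ∈ L, w • y ∈ L) {w : P.weylGroup} (hw : w ∈ β.handleGroup)
    {y : X} (hy : y ∈ β.handleLattice L) : w • y ∈ β.handleLattice L := by
  have := add_mem (β.smul_sub_mem_handleLattice hL hw (β.handleLattice_le_self hL hy)) hy
  rwa [sub_add_cancel] at this

/-- The twist is a product of commutators of strictly earlier handles; this strictness drives the
induction in `HandleWord.twistedLattice_eq`. -/
theorem HandleWord.twist_mem (β : HandleWord b) (hβ : β.IsCellWord) (i : Fin β.g) :
    β.twist i ∈ Subgroup.closure {w | ∃ j < i, w = β.fst j ∨ w = β.snd j} := by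
  obtain ⟨-, -, -, -, -, -, -, htw, -⟩ := hβ
  rw [htw]
  refine Subgroup.list_prod_mem _ fun w hw => ?_
  obtain ⟨j, hj, rfl⟩ := List.mem_map.1 hw
  have hji : j < i := by
    obtain ⟨n, hn, rfl⟩ := List.mem_iff_getElem.1 hj
    rw [List.length_take] at hn
    rw [List.getElem_take, List.getElem_finRange]
    simp only [Fin.lt_def, Fin.val_cast]
    omega
  have h1 : β.fst j ∈ Subgroup.closure {w | ∃ j < i, w = β.fst j ∨ w = β.snd j} :=
    Subgroup.subset_closure ⟨j, hji, Or.inl rfl⟩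
  have h2 : β.snd j ∈ Subgroup.closure {w | ∃ j < i, w = β.fst j ∨ w = β.snd j} :=
    Subgroup.subset_closure ⟨j, hji, Or.inr rfl⟩
  exact mul_mem (mul_mem (mul_mem h1 h2) (inv_mem h1)) (inv_mem h2)

/-- The twists are triangular: w_i - 1 maps L into the contributions of the handles before i, so
w_i(π - 1)y and (π - 1)y differ by something already present. -/
theorem HandleWord.twistedLattice_eq (β : HandleWord b) (hβ : β.IsCellWord) {L : Submodule ℤ X}
    (hL : ∀ (w : P.weylGroup), ∀ y ∈ L, w • y ∈ L) :
    β.twistedLattice L = β.handleLattice L := by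
  apply le_antisymm
  · rw [twistedLattice, Submodule.span_le]
    have htw : ∀ i, β.twist i ∈ β.handleGroup := fun i =>
      Subgroup.closure_mono (by rintro w ⟨j, -, hj⟩; exact ⟨j, hj⟩) (β.twist_mem hβ i)
    rintro _ ⟨i, y, hy, rfl | rfl⟩
    · exact β.smul_mem_handleLattice hL (htw i) (Submodule.subset_span ⟨i, y, hy, Or.inl rfl⟩)
    · exact β.smul_mem_handleLattice hL (htw i) (Submodule.subset_span ⟨i, y, hy, Or.inr rfl⟩)
  · have key : ∀ i : Fin β.g, ∀ y ∈ L, β.fst i • y - y ∈ β.twistedLattice L ∧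
        β.snd i • y - y ∈ β.twistedLattice L := by
      intro i
      induction i using WellFoundedLT.induction with
      | ind i ih =>
        -- By induction the earlier handles move L by elements of the twisted lattice; so does w_i,
        -- being in the group they generate.
        have hsub := fun y hy => smul_sub_mem_of_mem_closure (N := β.twistedLattice L) hL
          (by
            rintro w ⟨j, hj, rfl | rfl⟩ y hy
            · exact (ih j hj y hy).1
            · exact (ih j hj y hy).2) (β.twist_mem hβ i) y hy
        intro y hy
        constructor
        · have h1 := hsub _ (sub_mem (hL (β.fst i) y hy) hy)
          have h2 : β.twist i • (β.fst i • y - y) ∈ β.twistedLattice L :=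
            Submodule.subset_span ⟨i, y, hy, Or.inl rfl⟩
          have := sub_mem h2 h1
          rwa [sub_sub_cancel] at this
        · have h1 := hsub _ (sub_mem (hL (β.snd i) y hy) hy)
          have h2 : β.twist i • (β.snd i • y - y) ∈ β.twistedLattice L :=
            Submodule.subset_span ⟨i, y, hy, Or.inr rfl⟩
          have := sub_mem h2 h1
          rwa [sub_sub_cancel] at this
    rw [handleLattice, Submodule.span_le]
    rintro _ ⟨i, y, hy, rfl | rfl⟩
    · exact (key i y hy).1
    · exact (key i y hy).2

theorem partialProd_castSucc {l : ℕ} (α : Fin (l + 1) → b.support) (k : Fin (l + 1)) :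
    partialProd b (fun j : Fin l => α j.castSucc) k = partialProd b α k.castSucc := by
  induction k using Fin.induction with
  | zero => rfl
  | succ k ih => rw [partialProd_succ, ih, ← Fin.succ_castSucc, partialProd_succ]

/-- The letter with index 0 acts first and stands rightmost in the word, hence the reversal. -/
theorem partialProd_last {l : ℕ} (α : Fin l → b.support) :
    partialProd b α (Fin.last l) = wordProd b (List.ofFn α).reverse := by
  induction l with
  | zero => rfl
  | succ l ih =>
    rw [← Fin.succ_last, partialProd_succ, ← partialProd_castSucc, ih, List.ofFn_succ',
      List.concat_eq_append, List.reverse_append, List.reverse_singleton, List.singleton_append,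
      wordProd_cons]

theorem wordProd_flatten_mem {H : Subgroup P.weylGroup} {u : List (List b.support)}
    (h : ∀ v ∈ u, wordProd b v ∈ H) : wordProd b u.flatten ∈ H := by
  induction u with
  | nil => exact one_mem _
  | cons v u ih =>
    rw [List.flatten_cons, wordProd_append]
    exact mul_mem (h v (by simp)) (ih fun w hw => h w (by simp [hw]))

/-- Each handle contributes a commutator of its π_j to π_l, and each puncture word d dᵗ contributes
1. -/
theorem HandleWord.total_mem (β : HandleWord b) (hβ : β.IsCellWord) :
    β.total ∈ β.handleGroup := by
  obtain ⟨a, c, n, d, -, -, hac, -, hl⟩ := hβ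
  rw [total, partialProd_last, hl, wordProd_append]
  refine mul_mem (wordProd_flatten_mem fun v hv => ?_) (wordProd_flatten_mem fun v hv => ?_)
  · obtain ⟨i, rfl⟩ := List.mem_ofFn.1 hv
    have h1 : wordProd b (a i) ∈ β.handleGroup :=
      Subgroup.subset_closure ⟨i, Or.inl (hac i).1.symm⟩
    have h2 : wordProd b (c i) ∈ β.handleGroup :=
      Subgroup.subset_closure ⟨i, Or.inr (hac i).2.symm⟩
    simp only [wordProd_append, wordProd_reverse]
    exact mul_mem (mul_mem (mul_mem h1 h2) (inv_mem h1)) (inv_mem h2)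
  · obtain ⟨j, rfl⟩ := List.mem_ofFn.1 hv
    simp only [wordProd_append, wordProd_reverse, mul_inv_cancel]
    exact one_mem _

/-- Applied to w = π_l, this removes the conjugation by π_l from the conditions that define S_β(p)
and S̃_β(p). -/
theorem HandleWord.weylTorus_mem_perp_iff (β : HandleWord b) {L : Submodule ℤ X}
    (hL : ∀ (w : P.weylGroup), ∀ y ∈ L, w • y ∈ L) {w : P.weylGroup} (hw : w ∈ β.handleGroup)
    (t : Diag X) :
    weylTorus P w t ∈ perp (β.handleLattice L) ↔ t ∈ perp (β.handleLattice L) := by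
  constructor
  · intro h x hx
    have := h (w • x) (β.smul_mem_handleLattice hL hw hx)
    rwa [charValue_weylTorus, inv_smul_smul] at this
  · intro h x hx
    rw [charValue_weylTorus]
    exact h _ (β.smul_mem_handleLattice hL (inv_mem hw) hx)

theorem charValue_smul_sub_eq_one_iff {L : Submodule ℤ X}
    (hL : ∀ (w : P.weylGroup), ∀ y ∈ L, w • y ∈ L) (w : P.weylGroup) (t : Diag X) :
    (∀ x ∈ L, charValue x (weylTorus P w t / t) = 1) ↔
      ∀ x ∈ L, charValue (w • x - x) t = 1 := by
  constructor
  · intro h x hx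
    have := h _ (hL w x hx)
    rw [charValue_div, charValue_weylTorus, inv_smul_smul, div_eq_one] at this
    rw [charValue_sub, this, div_self']
  · intro h x hx
    have := h _ (hL w⁻¹ x hx)
    rw [charValue_sub, smul_inv_smul, div_eq_one] at this
    rw [charValue_div, charValue_weylTorus, this, div_self']

theorem mem_fixedTorus (w : P.weylGroup) (t : Diag X) :
    t ∈ fixedTorus P w ↔ ∀ x ∈ (⊤ : Submodule ℤ X), charValue (w • x - x) t = 1 := by
  rw [← charValue_smul_sub_eq_one_iff (L := ⊤) (fun _ _ _ => trivial)]
  exact ⟨fun h x _ => congrArg (charValue x) (show weylTorus P w t / t = 1 from h),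
    fun h => diag_ext fun x => h x trivial⟩

theorem mem_hatTorus (𝔾 : ReductiveGroup P G) (b : P.Base) (w : P.weylGroup) (t : Diag X) :
    t ∈ hatTorus 𝔾 w ↔ ∀ x ∈ P.rootSpan ℤ, charValue (w • x - x) t = 1 := by
  rw [← charValue_smul_sub_eq_one_iff (fun w _ hy => smul_mem_rootSpan w hy)]
  have : t ∈ hatTorus 𝔾 w ↔ weylTorus P w t / t ∈ torusCenter 𝔾 := Iff.rfl
  rw [this, torusCenter_eq_perp 𝔾 b]
  rfl

theorem HandleWord.mem_perp_handleLattice (β : HandleWord b) (L : Submodule ℤ X) (t : Diag X) :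
    t ∈ perp (β.handleLattice L) ↔ ∀ i, (∀ x ∈ L, charValue (β.fst i • x - x) t = 1) ∧
      ∀ x ∈ L, charValue (β.snd i • x - x) t = 1 := by
  rw [handleLattice, mem_perp_span]
  constructor
  · exact fun h i => ⟨fun x hx => h _ ⟨i, x, hx, Or.inl rfl⟩,
      fun x hx => h _ ⟨i, x, hx, Or.inr rfl⟩⟩
  · rintro h _ ⟨i, x, hx, rfl | rfl⟩
    · exact (h i).1 x hx
    · exact (h i).2 x hx

variable [Finite ι] [P.IsReduced] (𝔾 : ReductiveGroup P G)

/-- An element of T is fixed by π exactly when every character (π - 1)x, x ∈ X, is trivial on it. -/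
theorem HandleWord.stab_eq_perp (β : HandleWord b) (hβ : β.IsCellWord)
    (p : Fin (β.l + 1) → P.weylGroup) (hp : IsWalk b β.letter p) (hp0 : p 0 = 1) :
    β.stab 𝔾 p = perp (walkQ b β.letter p ⊔ β.handleLattice ⊤) := by
  rw [stab, walkStab_eq_perp b β.letter 𝔾 p hp hp0, perp_sup]
  congr 1
  ext t
  rw [← β.weylTorus_mem_perp_iff (L := ⊤) (fun _ _ _ => trivial) (β.total_mem hβ),
    β.mem_perp_handleLattice, Subgroup.mem_iInf]
  refine forall_congr' fun i => ?_
  rw [← mem_fixedTorus, ← mem_fixedTorus]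
  rfl

/-- Now the condition is tested modulo Z(G), hence only by the characters in Q. -/
theorem HandleWord.tildeStab_eq_perp (β : HandleWord b) (hβ : β.IsCellWord)
    (p : Fin (β.l + 1) → P.weylGroup) (hp : IsWalk b β.letter p) (hp0 : p 0 = 1) :
    β.tildeStab 𝔾 p = perp (walkQ b β.letter p ⊔ β.handleLattice (P.rootSpan ℤ)) := by
  rw [tildeStab, walkStab_eq_perp b β.letter 𝔾 p hp hp0, perp_sup]
  congr 1
  ext t
  rw [← β.weylTorus_mem_perp_iff (fun w _ hy => smul_mem_rootSpan w hy) (β.total_mem hβ),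
    β.mem_perp_handleLattice, Subgroup.mem_iInf]
  refine forall_congr' fun i => ?_
  rw [← mem_hatTorus 𝔾 b, ← mem_hatTorus 𝔾 b]
  rfl

end Handles

/-! ### Regular functions on the quotients and products. -/

section RegularFunctions

variable {A B : Type*}

theorem comp_mem_of_mem_adjoin (s : Set (A → ℂ)) (O : Subalgebra ℂ (B → ℂ)) (g : B → A)
    (h : ∀ f ∈ s, (fun x => f (g x)) ∈ O) {f : A → ℂ} (hf : f ∈ Algebra.adjoin ℂ s) :
    (fun x => f (g x)) ∈ O := by
  induction hf using Algebra.adjoin_induction with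
  | mem f hf => exact h f hf
  | algebraMap r => exact O.algebraMap_mem r
  | add f f' _ _ hf hf' => exact add_mem hf hf'
  | mul f f' _ _ hf hf' => exact mul_mem hf hf'

theorem comp_mem_diagRegular {M N : Type*} [AddCommGroup M] [AddCommGroup N]
    (g : Diag N → Diag M) (h : ∀ x : M, ∃ y : N, ∀ t, charValue x (g t) = charValue y t)
    {f : Diag M → ℂ} (hf : f ∈ diagRegular M) : (fun t => f (g t)) ∈ diagRegular N := by
  refine comp_mem_of_mem_adjoin _ _ g ?_ hf
  rintro _ ⟨x, rfl⟩
  obtain ⟨y, hy⟩ := h x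
  simp only [hy]
  exact charValue_mem_diagRegular y

theorem comp_mk_mem_of_mem_quotientRegular {A : Type*} [Group A] (O : Subalgebra ℂ (A → ℂ))
    (N : Subgroup A) {f : A ⧸ N → ℂ} (hf : f ∈ quotientRegular O N) :
    (fun a : A => f (QuotientGroup.mk a)) ∈ O :=
  comp_mem_of_mem_adjoin {f : A ⧸ N → ℂ | (fun a : A => f (QuotientGroup.mk a)) ∈ O} O
    QuotientGroup.mk (fun _ h => h) hf

variable {ι X Y : Type*} [AddCommGroup X] [AddCommGroup Y] {P : RootDatum ι X Y}
  {G : Type*} [Group G] {b : P.Base} (𝔾 : ReductiveGroup P G)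

theorem exists_quotientRegular_eq (b : P.Base) {x : X} (hx : x ∈ P.rootSpan ℤ) :
    ∃ F ∈ quotientRegular (diagRegular X) (torusCenter 𝔾),
      ∀ t : Diag X, F (QuotientGroup.mk t) = charValue x t := by
  let f : Diag X ⧸ torusCenter 𝔾 →* ℂˣ := QuotientGroup.lift _ (evalChar X (Multiplicative.ofAdd x))
    fun t ht => by
      rw [torusCenter_eq_perp 𝔾 b] at ht
      exact ht x hx
  exact ⟨fun a => f a, Algebra.subset_adjoin (charValue_mem_diagRegular x), fun t => rfl⟩

theorem weylTorus_eq_of_mem_perp {t : Diag X} (ht : t ∈ perp (P.rootSpan ℤ)) (w : P.weylGroup) :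
    weylTorus P w t = t :=
  diag_ext fun x => by
    have := ht _ (smul_sub_mem_rootSpan w⁻¹ x)
    rwa [charValue_sub, div_eq_one] at this

/-- The first component already has kernel Z(G). The components of A are quotients of two Weyl
translates, and W fixes Z(G), so A adds no condition. -/
theorem HandleWord.tildeHom_eq_one_iff (β : HandleWord b) (t : Diag X) :
    β.tildeHom 𝔾 t = 1 ↔ t ∈ perp (P.rootSpan ℤ) := by
  rw [← torusCenter_eq_perp 𝔾 b]
  constructor
  · intro h
    exact (QuotientGroup.eq_one_iff t).1 (congrArg Prod.fst h)
  · intro h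
    refine Prod.ext ((QuotientGroup.eq_one_iff t).2 h) ?_
    rw [torusCenter_eq_perp 𝔾 b] at h
    change (β.toriAct t)⁻¹ = 1
    rw [inv_eq_one]
    funext i
    refine Prod.ext ?_ ?_ <;>
    · simp only [toriAct, MonoidHom.pi_apply, MonoidHom.comp_apply, MonoidHom.prod_apply,
        MonoidHom.div_apply, weylTorus_eq_of_mem_perp h, div_self']
      rfl

theorem HandleWord.comp_tildeHom_mem (β : HandleWord b)
    {F : (Diag X ⧸ torusCenter 𝔾) × (Fin β.g → Diag X × Diag X) → ℂ}
    (hF : F ∈ prodRegular (quotientRegular (diagRegular X) (torusCenter 𝔾))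
      (powRegular (Fin β.g) (prodRegular (diagRegular X) (diagRegular X)))) :
    (fun t => F (β.tildeHom 𝔾 t)) ∈ diagRegular X := by
  refine comp_mem_of_mem_adjoin _ _ _ ?_ hF
  rintro _ (⟨f, hf, rfl⟩ | ⟨f, hf, rfl⟩)
  · exact comp_mk_mem_of_mem_quotientRegular _ _ hf
  · refine comp_mem_of_mem_adjoin _ _ (fun t => (β.tildeHom 𝔾 t).2) ?_ hf
    rintro _ ⟨f, hf, k, rfl⟩
    refine comp_mem_of_mem_adjoin _ _ (fun t => (β.tildeHom 𝔾 t).2 k) ?_ hf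
    rintro _ (⟨f, hf, rfl⟩ | ⟨f, hf, rfl⟩)
    · refine comp_mem_diagRegular (fun t => ((β.tildeHom 𝔾 t).2 k).1) (fun x => ?_) hf
      let r := ((β.twist k)⁻¹ * β.rightTwist k)⁻¹
      let u := ((β.fst k)⁻¹ * β.snd k * β.fst k * (β.snd k)⁻¹ * (β.fst k)⁻¹)⁻¹
      let v := (β.snd k * β.fst k * (β.snd k)⁻¹ * (β.fst k)⁻¹)⁻¹
      -- The outer sign comes from the inverse of A(t), the difference from the quotient of Weyl
      -- translates.
      refine ⟨-(r • u • x - r • v • x), fun t => ?_⟩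
      rw [charValue_neg, charValue_sub]
      rfl
    · refine comp_mem_diagRegular (fun t => ((β.tildeHom 𝔾 t).2 k).2) (fun x => ?_) hf
      let r := ((β.twist k)⁻¹ * β.rightTwist k)⁻¹
      let u := (β.fst k * (β.snd k)⁻¹ * (β.fst k)⁻¹)⁻¹
      let v := (β.snd k * β.fst k * (β.snd k)⁻¹ * (β.fst k)⁻¹)⁻¹
      refine ⟨-(r • u • x - r • v • x), fun t => ?_⟩
      rw [charValue_neg, charValue_sub]
      rfl

end RegularFunctions

/-! ### Compatibility of the Weyl group actions with duality. -/

section WeylActions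

variable {ι X Y : Type*} [AddCommGroup X] [AddCommGroup Y] {P : RootDatum ι X Y}

local notation "σ" => RootPairing.weylGroup.ofIdx

theorem weylCochar_mul (v w : P.weylGroup) (y : Y) :
    weylCochar P (v * w) y = weylCochar P v (weylCochar P w y) := by
  rw [weylCochar, mul_inv_rev]
  rfl

@[simp] theorem weylCochar_one (y : Y) : weylCochar P 1 y = y := by
  rw [weylCochar, inv_one]
  rfl

theorem weylCochar_ofIdx (i : ι) (y : Y) : weylCochar P (σ P i) y = P.coreflection i y := by
  rw [weylCochar, ofIdx_inv]
  rfl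

theorem weylGroup_induction {q : P.weylGroup → Prop} (h1 : q 1) (hi : ∀ i, q (σ P i))
    (hmul : ∀ v w, q v → q w → q (v * w)) (w : P.weylGroup) : q w := by
  obtain ⟨w, hw⟩ := w
  induction hw using RootPairing.weylGroup.induction with
  | mem i => exact hi i
  | one => exact h1
  | mul x y hx hy ihx ihy => exact hmul _ _ ihx ihy

theorem toLinearMap_smul_weylCochar (w : P.weylGroup) (x : X) (y : Y) :
    P.toLinearMap (w • x) (weylCochar P w y) = P.toLinearMap x y := by
  induction w using weylGroup_induction generalizing x y with
  | h1 => simp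
  | hi i =>
    rw [weylCochar_ofIdx, ofIdx_smul_weight]
    simp [RootPairing.reflection_apply, RootPairing.coreflection_apply]
    ring
  | hmul v w hv hw => rw [mul_smul, weylCochar_mul, hv, hw]

theorem toLinearMap_weylCochar (w : P.weylGroup) (x : X) (y : Y) :
    P.toLinearMap x (weylCochar P w y) = P.toLinearMap (w⁻¹ • x) y := by
  rw [← toLinearMap_smul_weylCochar w (w⁻¹ • x), smul_inv_smul]

variable {X₂ Y₂ : Type*} [AddCommGroup X₂] [AddCommGroup Y₂] [Finite ι]

theorem weylGroupToPerm_weylEquiv {P₂ : RootDatum ι X₂ Y₂}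
    (h : P.reflectionPerm = P₂.reflectionPerm) (w : P.weylGroup) :
    P₂.weylGroupToPerm (weylEquiv P P₂ h w) = P.weylGroupToPerm w := by
  have := MonoidHom.apply_ofInjective_symm (weylGroupToPerm_injective P₂)
    (MulEquiv.subgroupCongr (by
      rw [RootPairing.range_weylGroupToPerm, RootPairing.range_weylGroupToPerm, h])
      (MonoidHom.ofInjective (weylGroupToPerm_injective P) w))
  exact this

variable [Module.Finite ℤ X] [Module.Free ℤ X]

-- Both sides permute the indices of the roots in the same way, and this action is faithful.
@[simp] theorem dualWeyl_ofIdx (i : ι) : dualWeyl P (σ P i) = σ (dualDatum P) i :=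
  weylGroupToPerm_injective _ (weylGroupToPerm_weylEquiv _ _)

theorem coe_weylCochar_dualWeyl (w : P.weylGroup) (r : P.flip.corootSpan ℤ) :
    (weylCochar (dualDatum P) (dualWeyl P w) r : X) = w • (r : X) := by
  induction w using weylGroup_induction generalizing r with
  | h1 => simp
  | hi i =>
    rw [dualWeyl_ofIdx, weylCochar_ofIdx, ofIdx_smul_weight]
    rfl
  | hmul v w hv hw => rw [map_mul, weylCochar_mul, hv, hw, mul_smul]

theorem dualWeyl_smul_apply (w : P.weylGroup) (f : Module.Dual ℤ (P.flip.corootSpan ℤ))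
    (r r' : P.flip.corootSpan ℤ) (h : w • (r' : X) = r) : (dualWeyl P w • f) r = f r' := by
  have h1 := toLinearMap_smul_weylCochar (P := dualDatum P) (dualWeyl P w) f r'
  have h2 : weylCochar (dualDatum P) (dualWeyl P w) r' = r :=
    Subtype.ext ((coe_weylCochar_dualWeyl w r').trans h)
  rw [h2] at h1
  exact h1

/-- Equivariance of the map from Y to the characters of the dual torus, a consequence of the
invariance of the pairing. -/
theorem restrictChar_weylCochar (w : P.weylGroup) (y : Y) :
    restrictChar P.flip (weylCochar P w y) = dualWeyl P w • restrictChar P.flip y := by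
  ext r
  have hr : w • ((weylCochar (dualDatum P) (dualWeyl P w⁻¹) r : P.flip.corootSpan ℤ) : X) = r := by
    rw [coe_weylCochar_dualWeyl, smul_inv_smul]
  rw [dualWeyl_smul_apply w _ r _ hr, restrictChar_apply, restrictChar_apply]
  change P.toLinearMap (r : X) (weylCochar P w y) = P.toLinearMap _ y
  rw [toLinearMap_weylCochar, coe_weylCochar_dualWeyl]

end WeylActions

/-! ### Duality for words, lengths, walks and cell words. -/

section Combinatorics

variable {ι X Y : Type*} [AddCommGroup X] [AddCommGroup Y] {P : RootDatum ι X Y}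
  [Finite ι] [Module.Finite ℤ X] [Module.Free ℤ X] (b : P.Base)

local notation "σ" => RootPairing.weylGroup.ofIdx

/-- The simple roots of the dual group as simple coroots. -/
def dualLetter : b.support ≃ (dualBase b).support := Equiv.refl _

theorem wordProd_dual (u : List b.support) :
    wordProd (dualBase b) (u.map (dualLetter b)) = dualWeyl P (wordProd b u) := by
  induction u with
  | nil => simp
  | cons i u ih =>
    rw [List.map_cons, wordProd_cons, wordProd_cons, ih, map_mul, dualWeyl_ofIdx]
    rfl

theorem exists_word_map (v : List (dualBase b).support) :
    ∃ u : List b.support, u.map (dualLetter b) = v :=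
  ⟨v.map (dualLetter b).symm, by simp⟩

theorem weylLength_dual (w : P.weylGroup) :
    weylLength (dualBase b) (dualWeyl P w) = weylLength b w := by
  unfold weylLength
  congr 1
  ext n
  constructor
  · rintro ⟨v, hv, hvw⟩
    obtain ⟨u, rfl⟩ := exists_word_map b v
    rw [wordProd_dual] at hvw
    exact ⟨u, by simpa using hv, (dualWeyl P).injective hvw⟩
  · rintro ⟨u, hu, rfl⟩
    exact ⟨u.map (dualLetter b), by simpa using hu, wordProd_dual b u⟩

variable {b}

theorem isWalk_dual_iff {l : ℕ} (α : Fin l → b.support) (p : Fin (l + 1) → P.weylGroup) :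
    IsWalk (dualBase b) (dualLetters α) (dualWalk p) ↔ IsWalk b α p := by
  refine forall_congr' fun k => ?_
  have h1 : σ (dualDatum P) (dualLetters α k).1 * dualWalk p k.castSucc =
      dualWeyl P (σ P (α k).1 * p k.castSucc) := by
    rw [map_mul, dualWeyl_ofIdx]; rfl
  rw [h1]
  simp only [dualWalk, weylLength_dual, EmbeddingLike.apply_eq_iff_eq]

theorem dualWalk_bijective {l : ℕ} :
    Function.Bijective (dualWalk : (Fin (l + 1) → P.weylGroup) → _) :=
  (Equiv.arrowCongr (Equiv.refl (Fin (l + 1))) (dualWeyl P).toEquiv).bijective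

theorem dualWalk_bijOn {l : ℕ} (α : Fin l → b.support) :
    Set.BijOn dualWalk {p : Fin (l + 1) → P.weylGroup | IsWalk b α p}
      {q | IsWalk (dualBase b) (dualLetters α) q} := by
  refine ⟨fun p hp => (isWalk_dual_iff α p).2 hp, dualWalk_bijective.1.injOn, fun q hq => ?_⟩
  obtain ⟨p, rfl⟩ := dualWalk_bijective.2 q
  exact ⟨p, (isWalk_dual_iff α p).1 hq, rfl⟩

theorem stays_dualWalk {l : ℕ} (p : Fin (l + 1) → P.weylGroup) : stays (dualWalk p) = stays p := by
  ext k
  exact (dualWeyl P).injective.eq_iff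

theorem partialProd_dual {l : ℕ} (α : Fin l → b.support) (k : Fin (l + 1)) :
    partialProd (dualBase b) (dualLetters α) k = dualWeyl P (partialProd b α k) := by
  induction k using Fin.induction with
  | zero => simp
  | succ k ih =>
    rw [partialProd_succ, partialProd_succ, ih, map_mul, dualWeyl_ofIdx]
    rfl

theorem isMinimalLift_dual {I : Set b.support} {u : List b.support} (h : IsMinimalLift b I u) :
    IsMinimalLift (dualBase b) (dualLetter b '' I) (u.map (dualLetter b)) := by
  intro v hv
  obtain ⟨v, rfl⟩ := exists_word_map b v
  rw [List.length_map, List.length_map]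
  refine h v ?_
  rw [wordProd_dual, wordProd_dual, ← map_inv, ← map_mul] at hv
  have hset : {w | ∃ i ∈ dualLetter b '' I, w = σ (dualDatum P) i.1} =
      (dualWeyl P).toMonoidHom '' {w | ∃ i ∈ I, w = σ P i.1} := by
    ext w
    constructor
    · rintro ⟨_, ⟨i, hi, rfl⟩, rfl⟩
      exact ⟨_, ⟨i, hi, rfl⟩, dualWeyl_ofIdx _⟩
    · rintro ⟨_, ⟨i, hi, rfl⟩, rfl⟩
      exact ⟨_, ⟨i, hi, rfl⟩, dualWeyl_ofIdx _⟩
  rw [hset, ← MonoidHom.map_closure] at hv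
  obtain ⟨w, hw, hwv⟩ := hv
  rwa [← (dualWeyl P).injective hwv]

theorem HandleWord.isCellWord_dual (β : HandleWord b) (hβ : β.IsCellWord) : β.dual.IsCellWord := by
  obtain ⟨a, c, n, d, hred, hd, hac, htw, hl⟩ := hβ
  refine ⟨fun i => (a i).map (dualLetter b), fun i => (c i).map (dualLetter b), n,
    fun j => (d j).map (dualLetter b), fun i => ?_, fun j => ?_, fun i => ?_, fun i => ?_, ?_⟩
  · have h1 := isMinimalLift_dual (hred i).1
    have h2 := isMinimalLift_dual (hred i).2
    rw [Set.image_empty] at h1 h2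
    exact ⟨h1, h2⟩
  · obtain ⟨I, hI⟩ := hd j
    exact ⟨_, isMinimalLift_dual hI⟩
  · rw [wordProd_dual, wordProd_dual, ← (hac i).1, ← (hac i).2]
    exact ⟨rfl, rfl⟩
  · have h1 := congrArg (dualWeyl P) (htw i)
    rw [map_list_prod, List.map_map] at h1
    refine h1.trans ?_
    congr 1
    refine List.map_congr_left fun j _ => ?_
    simp [dual]
  · have h1 := congrArg (List.map (dualLetter b)) hl
    rw [List.map_reverse, List.map_append, List.map_flatten, List.map_flatten, List.map_ofFn,
      List.map_ofFn, List.map_ofFn] at h1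
    refine Eq.trans ?_ (h1.trans ?_)
    · rfl
    · congr 3
      · funext i
        simp
      · funext j
        simp

end Combinatorics

theorem exists_addEquiv_of_ker_eq {A B C : Type*} [AddCommGroup A] [AddCommGroup B]
    [AddCommGroup C] (f : A →+ B) (g : A →+ C) (hf : Function.Surjective f)
    (hg : Function.Surjective g) (h : ∀ a, f a = 0 ↔ g a = 0) :
    ∃ e : B ≃+ C, ∀ a, e (f a) = g a := by
  obtain ⟨e, he⟩ := exists_mulEquiv_of_ker_eq (AddMonoidHom.toMultiplicative f)
    (AddMonoidHom.toMultiplicative g) hf hg (by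
      ext a
      exact h a.toAdd)
  exact ⟨MulEquiv.toAdditive e, fun a => he (Multiplicative.ofAdd a)⟩

theorem exists_int_hom {A : Type*} [AddCommGroup A] (f : A →+ ℂ) (h : ∀ a, ∃ n : ℤ, f a = n) :
    ∃ g : A →ₗ[ℤ] ℤ, ∀ a, f a = g a := by
  choose g hg using h
  have hadd : ∀ x y, g (x + y) = g x + g y := fun x y => by
    have := hg (x + y)
    rw [map_add, hg, hg] at this
    exact_mod_cast this.symm
  exact ⟨(AddMonoidHom.mk' g hadd).toIntLinearMap, hg⟩

/-- M/N is torsion and ℂ is torsion-free. -/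
theorem eq_zero_of_finrank_eq {M : Type*} [AddCommGroup M] [Module.Finite ℤ M] (N : Submodule ℤ M)
    (hN : Module.finrank ℤ N = Module.finrank ℤ M) (f : M →+ ℂ) (hf : ∀ x ∈ N, f x = 0) :
    f = 0 := by
  have h0 : Module.finrank ℤ (M ⧸ N) = 0 := by
    have := N.finrank_quotient_add_finrank
    omega
  have htors := Module.finrank_eq_zero_iff_isTorsion.1 h0
  ext x
  obtain ⟨a, ha⟩ := htors (x := Submodule.Quotient.mk x)
  have hmem : (a : ℤ) • x ∈ N := by
    rw [← Submodule.Quotient.mk_eq_zero]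
    exact ha
  have h1 := hf _ hmem
  rw [map_zsmul, zsmul_eq_mul, mul_eq_zero] at h1
  exact h1.resolve_left (by exact_mod_cast nonZeroDivisors.ne_zero a.2)

/-- `T_β(p)` for a walk that ends at the identity, by generators. -/
theorem HandleWord.latticeT_eq {ι X Y : Type*} [AddCommGroup X] [AddCommGroup Y]
    {P : RootDatum ι X Y} {b : P.Base} (β : HandleWord b) (p : Fin (β.l + 1) → P.weylGroup)
    (hp : p (Fin.last β.l) = 1) :
    β.latticeT p = walkT b β.letter p ⊔ Submodule.span ℤ {y | ∃ i, ∃ z,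
      y = weylCochar P (β.fst i) z - z ∨ y = weylCochar P (β.snd i) z - z} := by
  have hid : weylCochar P (1 : P.weylGroup)⁻¹ = LinearMap.id :=
    LinearMap.ext fun y => by rw [inv_one]; exact weylCochar_one y
  rw [latticeT, hp, hid, Submodule.map_id]
  congr 1
  apply le_antisymm
  · refine iSup_le fun i => sup_le ?_ ?_
    · rintro _ ⟨z, rfl⟩
      rw [LinearMap.sub_apply, LinearMap.id_apply, ← neg_sub]
      exact neg_mem (Submodule.subset_span ⟨i, z, Or.inl rfl⟩)
    · rintro _ ⟨z, rfl⟩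
      rw [LinearMap.sub_apply, LinearMap.id_apply, ← neg_sub]
      exact neg_mem (Submodule.subset_span ⟨i, z, Or.inr rfl⟩)
  · rw [Submodule.span_le]
    rintro _ ⟨i, z, rfl | rfl⟩
    · refine (le_iSup (fun i => LinearMap.range (LinearMap.id - weylCochar P (β.fst i)) ⊔
        LinearMap.range (LinearMap.id - weylCochar P (β.snd i))) i)
        (Submodule.mem_sup_left ⟨-z, ?_⟩)
      rw [LinearMap.sub_apply, LinearMap.id_apply, map_neg]
      abel
    · refine (le_iSup (fun i => LinearMap.range (LinearMap.id - weylCochar P (β.fst i)) ⊔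
        LinearMap.range (LinearMap.id - weylCochar P (β.snd i))) i)
        (Submodule.mem_sup_right ⟨-z, ?_⟩)
      rw [LinearMap.sub_apply, LinearMap.id_apply, map_neg]
      abel

/-! ### Exchange of root and coroot lattices. -/

section DualLattices

variable {ι X Y : Type*} [AddCommGroup X] [AddCommGroup Y] {P : RootDatum ι X Y}
  [Finite ι]

/-- The coroots span Y, and on their span the pairing with the roots is nondegenerate. -/
theorem restrictChar_flip_injective (hP : IsSimplyConnected P) :
    Function.Injective (restrictChar P.flip) := fun x y h =>
  restrictChar_injOn P.flip (show x ∈ P.corootSpan ℤ by rw [hP]; trivial)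
    (show y ∈ P.corootSpan ℤ by rw [hP]; trivial) h

variable [Module.Finite ℤ X] [Module.Free ℤ X]

theorem rootSpan_dualDatum (hP : IsSimplyConnected P) :
    (dualDatum P).rootSpan ℤ = LinearMap.range (restrictChar P.flip) := by
  have h1 : (dualDatum P).rootSpan ℤ = (P.corootSpan ℤ).map (restrictChar P.flip) := by
    change _ = (Submodule.span ℤ (Set.range P.coroot)).map _
    rw [Submodule.map_span, ← Set.range_comp]
    rfl
  rw [h1, hP, Submodule.map_top]

/-- For simply connected `G`, the root lattice of the dual group is the cocharacter lattice. -/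
def dualRootEquiv (hP : IsSimplyConnected P) : Y ≃ₗ[ℤ] (dualDatum P).rootSpan ℤ :=
  (LinearEquiv.ofInjective _ (restrictChar_flip_injective hP)).trans
    (LinearEquiv.ofEq _ _ (rootSpan_dualDatum hP).symm)

@[simp] theorem coe_dualRootEquiv (hP : IsSimplyConnected P) (y : Y) :
    (dualRootEquiv hP y : Module.Dual ℤ (P.flip.corootSpan ℤ)) = restrictChar P.flip y := rfl

theorem walkQ_dual {b : P.Base} {l : ℕ} (α : Fin l → b.support) (p : Fin (l + 1) → P.weylGroup) :
    walkQ (dualBase b) (dualLetters α) (dualWalk p) = (walkT b α p).map (restrictChar P.flip) := by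
  rw [walkQ, walkT, Submodule.map_span, stays_dualWalk]
  congr 1
  ext x
  constructor
  · rintro ⟨k, hk, rfl⟩
    refine ⟨_, ⟨k, hk, rfl⟩, ?_⟩
    rw [restrictChar_weylCochar, partialProd_dual, map_inv]
    rfl
  · rintro ⟨_, ⟨k, hk, rfl⟩, rfl⟩
    refine ⟨k, hk, ?_⟩
    rw [restrictChar_weylCochar, partialProd_dual, map_inv]
    rfl

theorem map_walkT_dual {b : P.Base} {l : ℕ} (α : Fin l → b.support)
    (p : Fin (l + 1) → P.weylGroup) :
    (walkT (dualBase b) (dualLetters α) (dualWalk p)).map (P.flip.corootSpan ℤ).subtype =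
      walkQ b α p := by
  rw [walkQ, walkT, Submodule.map_span, stays_dualWalk]
  congr 1
  ext x
  constructor
  · rintro ⟨_, ⟨k, hk, rfl⟩, rfl⟩
    refine ⟨k, hk, ?_⟩
    rw [partialProd_dual, ← map_inv]
    exact coe_weylCochar_dualWeyl _ _
  · rintro ⟨k, hk, rfl⟩
    refine ⟨_, ⟨k, hk, rfl⟩, ?_⟩
    rw [partialProd_dual, ← map_inv]
    exact coe_weylCochar_dualWeyl _ _

theorem mem_walkT_dual_iff {b : P.Base} {l : ℕ} (α : Fin l → b.support)
    (p : Fin (l + 1) → P.weylGroup) (r : P.flip.corootSpan ℤ) :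
    r ∈ walkT (dualBase b) (dualLetters α) (dualWalk p) ↔ (r : X) ∈ walkQ b α p := by
  rw [← map_walkT_dual]
  exact ((P.flip.corootSpan ℤ).injective_subtype.mem_set_image
    (s := (walkT (dualBase b) (dualLetters α) (dualWalk p) : Set _))).symm

variable {b : P.Base}

theorem HandleWord.map_latticeT (β : HandleWord b) (hP : IsSimplyConnected P)
    (p : Fin (β.l + 1) → P.weylGroup) (hp : p (Fin.last β.l) = 1) :
    (β.latticeT p).map (restrictChar P.flip) =
      walkQ (dualBase b) β.dual.letter (dualWalk p) ⊔
        β.dual.handleLattice ((dualDatum P).rootSpan ℤ) := by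
  rw [β.latticeT_eq p hp, Submodule.map_sup]
  congr 1
  · exact (walkQ_dual β.letter p).symm
  · rw [Submodule.map_span, handleLattice]
    congr 1
    ext x
    constructor
    · rintro ⟨_, ⟨i, z, h⟩, rfl⟩
      refine ⟨i, _, (dualRootEquiv hP z).2, ?_⟩
      rcases h with rfl | rfl
      · left
        rw [map_sub, restrictChar_weylCochar]
        rfl
      · right
        rw [map_sub, restrictChar_weylCochar]
        rfl
    · rintro ⟨i, y, hy, h⟩
      rw [rootSpan_dualDatum hP] at hy
      obtain ⟨z, rfl⟩ := hy
      rcases h with rfl | rfl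
      · refine ⟨_, ⟨i, z, Or.inl rfl⟩, ?_⟩
        rw [map_sub, restrictChar_weylCochar]
        rfl
      · refine ⟨_, ⟨i, z, Or.inr rfl⟩, ?_⟩
        rw [map_sub, restrictChar_weylCochar]
        rfl

theorem HandleWord.map_latticeT_dual (β : HandleWord b) (p : Fin (β.l + 1) → P.weylGroup)
    (hp : p (Fin.last β.l) = 1) :
    (β.dual.latticeT (dualWalk p)).map (P.flip.corootSpan ℤ).subtype =
      walkQ b β.letter p ⊔ β.handleLattice (P.rootSpan ℤ) := by
  rw [β.dual.latticeT_eq (dualWalk p) (by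
    change dualWeyl P (p (Fin.last β.l)) = 1
    rw [hp, map_one]), Submodule.map_sup]
  congr 1
  · exact map_walkT_dual β.letter p
  · rw [Submodule.map_span, handleLattice]
    congr 1
    ext x
    constructor
    · rintro ⟨_, ⟨i, z, h⟩, rfl⟩
      refine ⟨i, z.1, z.2, h.imp ?_ ?_⟩
      · rintro rfl
        exact congrArg (· - z.1) (coe_weylCochar_dualWeyl (β.fst i) z)
      · rintro rfl
        exact congrArg (· - z.1) (coe_weylCochar_dualWeyl (β.snd i) z)
    · rintro ⟨i, y, hy, rfl | rfl⟩
      · exact ⟨_, ⟨i, ⟨y, hy⟩, Or.inl rfl⟩,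
          congrArg (· - y) (coe_weylCochar_dualWeyl (β.fst i) ⟨y, hy⟩)⟩
      · exact ⟨_, ⟨i, ⟨y, hy⟩, Or.inr rfl⟩,
          congrArg (· - y) (coe_weylCochar_dualWeyl (β.snd i) ⟨y, hy⟩)⟩

end DualLattices

/-! ### The lattice T̃_β(p) inside the Lie algebra. -/

section TildeLattice

variable {ι X Y E : Type*} [AddCommGroup X] [AddCommGroup Y] [AddCommGroup E]
  {P : RootDatum ι X Y} {b : P.Base}

/-- Membership in `T̃_β(p)` can be tested in any model `E` of the coweight lattice `Q^*`, embedded by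
`κ` into the homomorphisms from the root lattice to `ℂ`. -/
theorem HandleWord.cocharToLie_mem_tildeLattice_iff (β : HandleWord b)
    (p : Fin (β.l + 1) → P.weylGroup)
    (hres : ∀ f : X →+ ℂ, (∀ x ∈ P.rootSpan ℤ, f x = 0) → f = 0)
    (κ : E →+ (P.rootSpan ℤ →+ ℂ)) (hκ : Function.Injective κ)
    (hint : ∀ e i, ∃ n : ℤ, κ e (P.rootSpanMem ℤ i) = n)
    (hsurj : ∀ f ∈ coweightLattice P, ∃ e, ∀ r : P.rootSpan ℤ, κ e r = f r)
    (a : P.weylGroup → E →+ E)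
    (ha : ∀ w e (r r' : P.rootSpan ℤ), (r' : X) = w⁻¹ • (r : X) → κ (a w e) r = κ e r')
    (c : Y →ₗ[ℤ] E) (hc : ∀ y (r : P.rootSpan ℤ), κ (c y) r = (P.toLinearMap (r : X) y : ℂ))
    (y : Y) :
    cocharToLie P y ∈ β.tildeLattice p ↔ c y ∈ (walkT b β.letter p).map c ⊔
      Submodule.span ℤ {e | ∃ i e', e = a (β.twist i) (a (β.fst i) e' - e') ∨
        e = a (β.twist i) (a (β.snd i) e' - e')} := by
  set K := (walkT b β.letter p).map c ⊔
      Submodule.span ℤ {e | ∃ i e', e = a (β.twist i) (a (β.fst i) e' - e') ∨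
        e = a (β.twist i) (a (β.snd i) e' - e')} with hK
  -- Restriction to the root lattice loses nothing by `hres`, and it brings 𝔱 and E into the common
  -- target Hom(Q, ℂ).
  let res : (X →+ ℂ) →+ (P.rootSpan ℤ →+ ℂ) :=
    { toFun := fun f => f.comp (P.rootSpan ℤ).subtype.toAddMonoidHom
      map_zero' := rfl
      map_add' := fun _ _ => rfl }
  have hres' : Function.Injective res := by
    rw [injective_iff_map_eq_zero]
    exact fun f hf => hres f fun x hx => DFunLike.congr_fun hf ⟨x, hx⟩
  have hcoch : ∀ y, res (cocharToLie P y) = κ (c y) := fun y =>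
    AddMonoidHom.ext fun r => (hc y r).symm
  have hact : ∀ w f e, res f = κ e → res (weylLie P w f) = κ (a w e) := by
    intro w f e h
    ext r
    have hr : w⁻¹ • (r : X) ∈ P.rootSpan ℤ := smul_mem_rootSpan _ r.2
    rw [ha w e r ⟨_, hr⟩ rfl, ← h]
    rfl
  have hgen : ∀ v w f e, res f = κ e →
      res (((weylLie P v).comp (weylLie P w - AddMonoidHom.id _)) f) = κ (a v (a w e - e)) := by
    intro v w f e h
    refine hact v _ _ ?_
    rw [AddMonoidHom.sub_apply, map_sub, map_sub, hact w f e h, AddMonoidHom.id_apply, h]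
  have hmap : (β.tildeLattice p).map res = K.toAddSubgroup.map κ := by
    apply le_antisymm
    · rw [AddSubgroup.map_le_iff_le_comap, tildeLattice]
      refine sup_le ?_ (iSup_le fun i => sup_le ?_ ?_)
      · rintro _ ⟨y, hy, rfl⟩
        exact ⟨c y, Submodule.mem_sup_left (Submodule.mem_map_of_mem hy), (hcoch y).symm⟩
      · rintro _ ⟨f, hf, rfl⟩
        obtain ⟨e, he⟩ := hsurj f hf
        exact ⟨_, Submodule.mem_sup_right (Submodule.subset_span ⟨i, e, Or.inl rfl⟩),
          (hgen _ _ f e (AddMonoidHom.ext fun r => (he r).symm)).symm⟩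
      · rintro _ ⟨f, hf, rfl⟩
        obtain ⟨e, he⟩ := hsurj f hf
        exact ⟨_, Submodule.mem_sup_right (Submodule.subset_span ⟨i, e, Or.inr rfl⟩),
          (hgen _ _ f e (AddMonoidHom.ext fun r => (he r).symm)).symm⟩
    · rw [AddSubgroup.map_le_iff_le_comap]
      suffices K ≤ AddSubgroup.toIntSubmodule (((β.tildeLattice p).map res).comap κ) from this
      -- Conversely each element of E comes from a coweight in 𝔱, since homomorphisms to the
      -- divisible group ℂ extend from Q to X.
      have hext : ∀ e, ∃ f ∈ coweightLattice P, res f = κ e := by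
        intro e
        obtain ⟨f, hf⟩ := (Module.Baer.of_divisible ℂ).extension_property_addMonoidHom
          (P.rootSpan ℤ).subtype.toAddMonoidHom (P.rootSpan ℤ).injective_subtype (κ e)
        refine ⟨f, fun i => ?_, hf⟩
        obtain ⟨n, hn⟩ := hint e i
        exact ⟨n, (DFunLike.congr_fun hf (P.rootSpanMem ℤ i)).trans hn⟩
      refine sup_le ?_ ?_
      · rintro _ ⟨y, hy, rfl⟩
        exact ⟨cocharToLie P y, AddSubgroup.mem_sup_left ⟨y, hy, rfl⟩, hcoch y⟩
      · rw [Submodule.span_le]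
        rintro _ ⟨i, e, rfl | rfl⟩
        · obtain ⟨f, hf, hfe⟩ := hext e
          refine ⟨_, AddSubgroup.mem_sup_right ?_, hgen (β.twist i) (β.fst i) f e hfe⟩
          exact AddSubgroup.mem_iSup_of_mem i (AddSubgroup.mem_sup_left ⟨f, hf, rfl⟩)
        · obtain ⟨f, hf, hfe⟩ := hext e
          refine ⟨_, AddSubgroup.mem_sup_right ?_, hgen (β.twist i) (β.snd i) f e hfe⟩
          exact AddSubgroup.mem_iSup_of_mem i (AddSubgroup.mem_sup_right ⟨f, hf, rfl⟩)
  have h1 : cocharToLie P y ∈ β.tildeLattice p ↔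
      res (cocharToLie P y) ∈ (β.tildeLattice p).map res :=
    (AddSubgroup.mem_map_iff_mem hres').symm
  rw [h1, hmap, hcoch, AddSubgroup.mem_map_iff_mem hκ]
  rfl

end TildeLattice

/-! ### Coweight lattices of both groups and the quotients of cocharacters. -/

section Duality

variable {ι X Y : Type*} [AddCommGroup X] [AddCommGroup Y] {P : RootDatum ι X Y}
  [Finite ι] [Module.Finite ℤ X] [Module.Free ℤ X]

theorem finrank_rootSpan_eq (hP : IsSimplyConnected P) :
    Module.finrank ℤ (P.rootSpan ℤ) = Module.finrank ℤ X := by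
  have := Fintype.ofFinite ι
  rw [← P.finrank_corootSpan_eq ℤ, show P.corootSpan ℤ = ⊤ from hP, finrank_top,
    Module.finrank_of_isPerfPair P.toLinearMap]

theorem finrank_rootSpan_dualDatum_eq (hP : IsSimplyConnected P) :
    Module.finrank ℤ ((dualDatum P).rootSpan ℤ) =
      Module.finrank ℤ (Module.Dual ℤ (P.flip.corootSpan ℤ)) := by
  rw [← (dualRootEquiv hP).finrank_eq, Module.finrank_linearMap_self,
    show Module.finrank ℤ (P.flip.corootSpan ℤ) = _ from finrank_rootSpan_eq hP,
    Module.finrank_of_isPerfPair P.toLinearMap]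

theorem isReduced_dualDatum [Module.IsTorsionFree ℤ Y] [P.IsReduced] (hP : IsSimplyConnected P) :
    (dualDatum P).IsReduced where
  eq_or_eq_neg i j h := by
    have hflip : ¬ LinearIndependent ℤ ![P.flip.root i, P.flip.root j] := by
      intro hl
      apply h
      have := hl.map_injOn (restrictChar P.flip) (restrictChar_flip_injective hP).injOn
      have e : ![(dualDatum P).root i, (dualDatum P).root j] =
          restrictChar P.flip ∘ ![P.flip.root i, P.flip.root j] := by
        funext k
        fin_cases k <;> rfl
      rw [e]
      exact this
    rcases RootPairing.IsReduced.eq_or_eq_neg (P := P.flip) i j hflip with h | h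
    · exact Or.inl (congrArg (restrictChar P.flip) h)
    · right
      have := congrArg (restrictChar P.flip) h
      rw [map_neg] at this
      exact this

/-- The embedding of `Hom(Q, ℤ)` into `Hom(Q, ℂ)`. -/
def dualToComplex (M : Type*) [AddCommGroup M] : Module.Dual ℤ M →+ (M →+ ℂ) where
  toFun f := (Int.castAddHom ℂ).comp f.toAddMonoidHom
  map_zero' := AddMonoidHom.ext fun _ => Int.cast_zero
  map_add' f g := AddMonoidHom.ext fun r => Int.cast_add (f r) (g r)

theorem dualToComplex_injective (M : Type*) [AddCommGroup M] :
    Function.Injective (dualToComplex M) := fun _ _ h =>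
  LinearMap.ext fun r => Int.cast_injective (α := ℂ) (DFunLike.congr_fun h r)

/-- The pairing of the character lattice with the root lattice of the dual group. -/
def dualPairing (hP : IsSimplyConnected P) : X →+ ((dualDatum P).rootSpan ℤ →+ ℂ) :=
  (dualToComplex _).comp
    ((LinearMap.lcomp ℤ ℤ (dualRootEquiv hP).symm.toLinearMap) ∘ₗ P.toLinearMap).toAddMonoidHom

@[simp] theorem dualPairing_dualRootEquiv (hP : IsSimplyConnected P) (x : X) (y : Y) :
    dualPairing hP x (dualRootEquiv hP y) = (P.toLinearMap x y : ℂ) := by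
  change ((P.toLinearMap x ((dualRootEquiv hP).symm (dualRootEquiv hP y)) : ℤ) : ℂ) = _
  rw [LinearEquiv.symm_apply_apply]

theorem dualPairing_injective (hP : IsSimplyConnected P) : Function.Injective (dualPairing hP) :=
  fun x y h => (LinearMap.IsPerfPair.bijective_left P.toLinearMap).1 <| LinearMap.ext fun z => by
    have := DFunLike.congr_fun h (dualRootEquiv hP z)
    rw [dualPairing_dualRootEquiv, dualPairing_dualRootEquiv] at this
    exact_mod_cast this

theorem dualPairing_weyl (hP : IsSimplyConnected P) (w : P.weylGroup) (x : X)
    (r r' : (dualDatum P).rootSpan ℤ) (h : (r' : Module.Dual ℤ (P.flip.corootSpan ℤ)) =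
      (dualWeyl P w)⁻¹ • (r : Module.Dual ℤ (P.flip.corootSpan ℤ))) :
    dualPairing hP (w • x) r = dualPairing hP x r' := by
  obtain ⟨y, rfl⟩ := (dualRootEquiv hP).surjective r
  have h1 : r' = dualRootEquiv hP (weylCochar P w⁻¹ y) := by
    apply Subtype.ext
    rw [h, coe_dualRootEquiv, coe_dualRootEquiv, restrictChar_weylCochar, map_inv]
  rw [h1, dualPairing_dualRootEquiv, dualPairing_dualRootEquiv, toLinearMap_weylCochar, inv_inv]

theorem exists_dual_of_mem_coweightLattice {ι X Y : Type*} [AddCommGroup X] [AddCommGroup Y]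
    {P : RootDatum ι X Y} {f : X →+ ℂ} (hf : f ∈ coweightLattice P) :
    ∃ g : Module.Dual ℤ (P.rootSpan ℤ), ∀ r : P.rootSpan ℤ, f r = g r := by
  refine exists_int_hom (f.comp (P.rootSpan ℤ).subtype.toAddMonoidHom) ?_
  rintro ⟨x, hx⟩
  change ∃ n : ℤ, f x = n
  induction hx using Submodule.span_induction with
  | mem x hx => obtain ⟨i, rfl⟩ := hx; exact hf i
  | zero => exact ⟨0, by simp⟩
  | add x y _ _ hx hy =>
    obtain ⟨m, hm⟩ := hx
    obtain ⟨n, hn⟩ := hy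
    exact ⟨m + n, by simp [hm, hn]⟩
  | smul k x _ hx =>
    obtain ⟨m, hm⟩ := hx
    exact ⟨k * m, by simp [hm]⟩

/-- The roots of the dual group span Y, so its coweights are Hom(Y, ℤ), which is X because the
pairing is perfect. -/
theorem exists_dualPairing_eq (hP : IsSimplyConnected P)
    {f : Module.Dual ℤ (P.flip.corootSpan ℤ) →+ ℂ} (hf : f ∈ coweightLattice (dualDatum P)) :
    ∃ x, ∀ r : (dualDatum P).rootSpan ℤ, dualPairing hP x r = f r := by
  obtain ⟨g, hg⟩ := exists_dual_of_mem_coweightLattice hf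
  obtain ⟨x, hx⟩ := (LinearMap.IsPerfPair.bijective_left P.toLinearMap).2
    (g ∘ₗ (dualRootEquiv hP).toLinearMap)
  refine ⟨x, fun r => ?_⟩
  obtain ⟨y, rfl⟩ := (dualRootEquiv hP).surjective r
  rw [hg, dualPairing_dualRootEquiv, hx]
  rfl

variable {b : P.Base}

/-- The coweights of G are Hom(Q, ℤ), the full character lattice of the dual torus. This is the
model E, and the twists drop out. -/
theorem HandleWord.mem_comap_tildeLattice_iff (β : HandleWord b)
    (hP : IsSimplyConnected P) (hβ : β.IsCellWord) (p : Fin (β.l + 1) → P.weylGroup) (y : Y) :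
    cocharToLie P y ∈ β.tildeLattice p ↔ restrictChar P.flip y ∈
      walkQ (dualBase b) β.dual.letter (dualWalk p) ⊔ β.dual.handleLattice ⊤ := by
  have hQ : walkQ (dualBase b) β.dual.letter (dualWalk p) =
    (walkT b β.letter p).map (restrictChar P.flip) := walkQ_dual β.letter p
  rw [← β.dual.twistedLattice_eq (β.isCellWord_dual hβ) (L := ⊤) (fun _ _ _ => trivial), hQ,
    β.cocharToLie_mem_tildeLattice_iff (E := Module.Dual ℤ (P.flip.corootSpan ℤ)) p
      (fun f hf => eq_zero_of_finrank_eq _ (finrank_rootSpan_eq hP) f hf)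
      (dualToComplex _) (dualToComplex_injective _)
      (fun f i => ⟨f (P.rootSpanMem ℤ i), rfl⟩)
      (fun f hf => (exists_dual_of_mem_coweightLattice hf).imp fun g hg r => (hg r).symm)
      (fun w => DistribSMul.toAddMonoidHom _ (dualWeyl P w))
      (fun w f r r' h => congrArg (Int.cast : ℤ → ℂ)
        (dualWeyl_smul_apply w f r r' (by rw [h, smul_inv_smul])))
      (restrictChar P.flip) (fun y r => rfl) y]
  have hset : Submodule.span ℤ {e | ∃ i e', e = dualWeyl P (β.twist i) •
        (dualWeyl P (β.fst i) • e' - e') ∨ e = dualWeyl P (β.twist i) •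
        (dualWeyl P (β.snd i) • e' - e')} = β.dual.twistedLattice ⊤ := by
    rw [twistedLattice]
    congr 1
    ext e
    exact ⟨fun ⟨i, e', h⟩ => ⟨i, e', trivial, h⟩, fun ⟨i, e', _, h⟩ => ⟨i, e', h⟩⟩
  rw [← hset]
  rfl

/-- The same with the roles exchanged: the model of the coweights of the dual group is E = X. -/
theorem HandleWord.mem_comap_tildeLattice_dual_iff (β : HandleWord b)
    (hP : IsSimplyConnected P) (hβ : β.IsCellWord) (p : Fin (β.l + 1) → P.weylGroup)
    (r : P.flip.corootSpan ℤ) :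
    cocharToLie (dualDatum P) r ∈ β.dual.tildeLattice (dualWalk p) ↔
      (r : X) ∈ walkQ b β.letter p ⊔ β.handleLattice ⊤ := by
  have hT : walkQ b β.letter p = (walkT (dualBase b) β.dual.letter (dualWalk p)).map
    (P.flip.corootSpan ℤ).subtype := (map_walkT_dual β.letter p).symm
  have key := β.dual.cocharToLie_mem_tildeLattice_iff (E := X) (dualWalk p)
    (fun f hf => eq_zero_of_finrank_eq _ (finrank_rootSpan_dualDatum_eq hP) f hf)
    (dualPairing hP) (dualPairing_injective hP) (fun x i => ⟨_, rfl⟩)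
    (fun f hf => exists_dualPairing_eq hP hf)
    (fun w => DistribSMul.toAddMonoidHom _ ((dualWeyl P).symm w))
    (fun w x r r' h => dualPairing_weyl hP ((dualWeyl P).symm w) x r r' (by
      rw [MulEquiv.apply_symm_apply]
      exact h))
    (P.flip.corootSpan ℤ).subtype (fun r r' => by
      obtain ⟨y, rfl⟩ := (dualRootEquiv hP).surjective r'
      rw [dualPairing_dualRootEquiv]
      rfl) r
  rw [key, ← β.twistedLattice_eq hβ (L := ⊤) (fun _ _ _ => trivial), hT]
  have hset : Submodule.span ℤ {e : X | ∃ i e', e = (dualWeyl P).symm (β.dual.twist i) •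
        ((dualWeyl P).symm (β.dual.fst i) • e' - e') ∨ e = (dualWeyl P).symm (β.dual.twist i) •
        ((dualWeyl P).symm (β.dual.snd i) • e' - e')} = β.twistedLattice ⊤ := by
    rw [twistedLattice]
    congr 1
    ext e
    simp only [dual, MulEquiv.symm_apply_apply]
    exact ⟨fun ⟨i, e', h⟩ => ⟨i, e', trivial, h⟩, fun ⟨i, e', _, h⟩ => ⟨i, e', h⟩⟩
  rw [← hset]
  rfl

/-- A quotient of the cocharacter lattice as a quotient of the root lattice of the dual group. -/
theorem exists_quotient_equiv {B : Type*} [AddCommGroup B] (hP : IsSimplyConnected P)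
    (f : Y →+ B) (hf : Function.Surjective f)
    (K : Submodule ℤ (Module.Dual ℤ (P.flip.corootSpan ℤ)))
    (h : ∀ y, f y = 0 ↔ restrictChar P.flip y ∈ K) :
    ∃ e : B ≃+ ((dualDatum P).rootSpan ℤ ⧸ K.submoduleOf ((dualDatum P).rootSpan ℤ)),
      ∀ y, e (f y) = Submodule.Quotient.mk (dualRootEquiv hP y) := by
  refine exists_addEquiv_of_ker_eq f
    ((K.submoduleOf ((dualDatum P).rootSpan ℤ)).mkQ.toAddMonoidHom.comp
      (dualRootEquiv hP).toLinearMap.toAddMonoidHom) hf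
    ((K.submoduleOf _).mkQ_surjective.comp (dualRootEquiv hP).surjective) fun y => ?_
  rw [h]
  exact (Submodule.Quotient.mk_eq_zero (K.submoduleOf ((dualDatum P).rootSpan ℤ))
    (x := dualRootEquiv hP y)).symm

end Duality

/-! ### The canonical isomorphisms. -/

section Duality

theorem mk'_torusCenter_eq_one_iff {ι X Y G : Type*} [AddCommGroup X] [AddCommGroup Y]
    [Group G] {P : RootDatum ι X Y} (𝔾 : ReductiveGroup P G) (b : P.Base) (t : Diag X) :
    QuotientGroup.mk' (torusCenter 𝔾) t = 1 ↔ t ∈ perp (P.rootSpan ℤ) := by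
  rw [← torusCenter_eq_perp 𝔾 b]
  exact QuotientGroup.eq_one_iff t

variable {ι X Y : Type*} [AddCommGroup X] [AddCommGroup Y] {P : RootDatum ι X Y}
  [Finite ι] [Module.Finite ℤ X] [Module.Free ℤ X] {b : P.Base}

/-- A quotient of the cocharacter lattice of the dual group as a quotient of the root lattice. -/
theorem exists_rootSpan_quotient_equiv {ι X Y B : Type*} [AddCommGroup X] [AddCommGroup Y]
    {P : RootDatum ι X Y} [AddCommGroup B] (f : P.flip.corootSpan ℤ →+ B)
    (hf : Function.Surjective f) (L : Submodule ℤ X)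
    (h : ∀ r : P.flip.corootSpan ℤ, f r = 0 ↔ (r : X) ∈ L) :
    ∃ e : B ≃+ (P.rootSpan ℤ ⧸ L.submoduleOf (P.rootSpan ℤ)),
      ∀ i, e (f (P.flip.corootSpanMem ℤ i)) = Submodule.Quotient.mk (P.rootSpanMem ℤ i) := by
  obtain ⟨e, he⟩ := exists_addEquiv_of_ker_eq (A := P.rootSpan ℤ) (f : P.rootSpan ℤ →+ B)
    (L.submoduleOf (P.rootSpan ℤ)).mkQ.toAddMonoidHom hf
    (L.submoduleOf (P.rootSpan ℤ)).mkQ_surjective fun r => (h r).trans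
      (Submodule.Quotient.mk_eq_zero (L.submoduleOf (P.rootSpan ℤ)) (x := r)).symm
  exact ⟨e, fun i => he (P.rootSpanMem ℤ i)⟩

/-- `Z(p^*) = π₁(p)^*`. -/
theorem exists_walkCenter_dual_equiv (hP : IsSimplyConnected P) {l : ℕ} (α : Fin l → b.support)
    (p : Fin (l + 1) → P.weylGroup) :
    ∃ e : walkCenter (dualBase b) (dualLetters α) (dualWalk p) ≃* Diag (walkPi b α p),
      ∀ (f : walkCenter (dualBase b) (dualLetters α) (dualWalk p)) (i : ι),
        charValue (Submodule.Quotient.mk (P.coroot i)) (e f) =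
          charValue (Submodule.Quotient.mk ((dualDatum P).rootSpanMem ℤ i)) f := by
  obtain ⟨e, he⟩ := exists_quotient_equiv hP (walkT b α p).mkQ.toAddMonoidHom
    (walkT b α p).mkQ_surjective (walkQ (dualBase b) (dualLetters α) (dualWalk p)) (fun y => by
      rw [walkQ_dual]
      exact (Submodule.Quotient.mk_eq_zero _).trans
        ((restrictChar_flip_injective hP).mem_set_image (s := (walkT b α p : Set Y))).symm)
  refine ⟨diagCongr e, fun f i => ?_⟩
  rw [charValue_diagCongr]
  exact congrArg (charValue · f) (he (P.coroot i))

/-- `π₁(p^*) = Z(p)^*`. -/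
theorem exists_walkPi_dual_equiv {l : ℕ} (α : Fin l → b.support)
    (p : Fin (l + 1) → P.weylGroup) :
    ∃ e : Multiplicative (walkPi (dualBase b) (dualLetters α) (dualWalk p)) ≃*
        walkCenterDual b α p,
      ∀ (i : ι) (f : walkCenter b α p),
        (e (Multiplicative.ofAdd (Submodule.Quotient.mk ((dualDatum P).coroot i)))).1 f =
          charValue (Submodule.Quotient.mk (P.rootSpanMem ℤ i)) f := by
  obtain ⟨e₁, he₁⟩ := exists_rootSpan_quotient_equiv
    (walkT (dualBase b) (dualLetters α) (dualWalk p)).mkQ.toAddMonoidHom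
    (Submodule.mkQ_surjective _) (walkQ b α p) (fun r =>
      (Submodule.Quotient.mk_eq_zero _).trans (mem_walkT_dual_iff α p r))
  obtain ⟨e₂, he₂⟩ := exists_equiv_charGroup_diagRegular (rootQuotient b α p)
  refine ⟨(AddEquiv.toMultiplicative e₁).trans e₂, fun i f => ?_⟩
  rw [← he₂]
  exact congrArg (fun m => (e₂ (Multiplicative.ofAdd m)).1 f) (he₁ i)

variable [P.IsReduced] {G : Type*} [Group G]

/-- `π_{1,β^*}(p^*) = Z̃_β(p)^*`. -/
theorem HandleWord.exists_pi_dual_equiv (𝔾 : ReductiveGroup P G) (β : HandleWord b)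
    (hβ : β.IsCellWord) (p : Fin (β.l + 1) → P.weylGroup) (hp : IsWalk b β.letter p)
    (hp0 : p 0 = 1) (hpl : p (Fin.last β.l) = 1) :
    ∃ e : Multiplicative (β.dual.pi (dualWalk p)) ≃* β.tildeCenterDual 𝔾 p,
      ∀ (i : ι) (t : Diag X) (ht : t ∈ β.tildeStab 𝔾 p),
        (e (Multiplicative.ofAdd (Submodule.Quotient.mk ((dualDatum P).coroot i)))).1
          ⟨β.tildeHom 𝔾 t, Subgroup.mem_map_of_mem _ ht⟩ = charValue (P.root i) t := by
  set L := walkQ b β.letter p ⊔ β.handleLattice (P.rootSpan ℤ) with hL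
  obtain ⟨e₁, he₁⟩ := exists_rootSpan_quotient_equiv
    (β.dual.latticeT (dualWalk p)).mkQ.toAddMonoidHom (Submodule.mkQ_surjective _) L (fun r => by
      refine (Submodule.Quotient.mk_eq_zero _).trans ?_
      rw [hL, ← β.map_latticeT_dual p hpl]
      exact ((P.flip.corootSpan ℤ).injective_subtype.mem_set_image
        (s := (β.dual.latticeT (dualWalk p) : Set _))).symm)
  obtain ⟨e₂, he₂⟩ := exists_equiv_charGroup (β.tildeHom 𝔾) (P.rootSpan ℤ) L (β.tildeStab 𝔾 p)
    (sup_le (walkQ_le_rootSpan _ _) β.handleLattice_le)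
    (HandleWord.tildeStab_eq_perp 𝔾 β hβ p hp hp0)
    (fun t _ => HandleWord.tildeHom_eq_one_iff 𝔾 β t) _
    (fun F hF => HandleWord.comp_tildeHom_mem 𝔾 β hF)
    (fun x hx => by
      obtain ⟨F, hF, h⟩ := exists_quotientRegular_eq 𝔾 b hx
      exact ⟨fun q => F q.1, Algebra.subset_adjoin (Or.inl ⟨F, hF, rfl⟩), h⟩)
  refine ⟨(AddEquiv.toMultiplicative e₁).trans e₂, fun i t ht => ?_⟩
  refine Eq.trans ?_ (he₂ (P.rootSpanMem ℤ i) t ht)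
  exact congrArg (fun m => (e₂ (Multiplicative.ofAdd m)).1
    ⟨β.tildeHom 𝔾 t, Subgroup.mem_map_of_mem _ ht⟩) (he₁ i)

/-- `π̃_{1,β^*}(p^*) = Z_β(p)^*`. -/
theorem HandleWord.exists_tildePi_dual_equiv (hP : IsSimplyConnected P) (𝔾 : ReductiveGroup P G)
    (β : HandleWord b) (hβ : β.IsCellWord) (p : Fin (β.l + 1) → P.weylGroup)
    (hp : IsWalk b β.letter p) (hp0 : p 0 = 1) :
    ∃ e : Multiplicative (β.dual.tildePi (dualWalk p)) ≃* β.centerDual 𝔾 p,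
      ∀ (i : ι) (t : Diag X) (ht : t ∈ β.stab 𝔾 p),
        (e (Multiplicative.ofAdd (QuotientAddGroup.mk ((dualDatum P).coroot i)))).1
          ⟨QuotientGroup.mk' _ t, Subgroup.mem_map_of_mem _ ht⟩ = charValue (P.root i) t := by
  set L := walkQ b β.letter p ⊔ β.handleLattice ⊤ with hL
  obtain ⟨e₁, he₁⟩ := exists_rootSpan_quotient_equiv
    (QuotientAddGroup.mk' ((β.dual.tildeLattice (dualWalk p)).comap (cocharToLie (dualDatum P))))
    (QuotientAddGroup.mk'_surjective _) L (fun r =>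
      (QuotientAddGroup.eq_zero_iff r).trans (β.mem_comap_tildeLattice_dual_iff hP hβ p r))
  obtain ⟨e₂, he₂⟩ := exists_equiv_charGroup (QuotientGroup.mk' (torusCenter 𝔾)) (P.rootSpan ℤ) L
    (β.stab 𝔾 p) (sup_le (walkQ_le_rootSpan _ _) β.handleLattice_le)
    (HandleWord.stab_eq_perp 𝔾 β hβ p hp hp0)
    (fun t _ => mk'_torusCenter_eq_one_iff 𝔾 b t) _
    (fun F hF => comp_mk_mem_of_mem_quotientRegular (diagRegular X) (torusCenter 𝔾) hF)
    (fun x hx => exists_quotientRegular_eq 𝔾 b hx)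
  refine ⟨(AddEquiv.toMultiplicative e₁).trans e₂, fun i t ht => ?_⟩
  refine Eq.trans ?_ (he₂ (P.rootSpanMem ℤ i) t ht)
  exact congrArg (fun m => (e₂ (Multiplicative.ofAdd m)).1
    ⟨QuotientGroup.mk' _ t, Subgroup.mem_map_of_mem _ ht⟩) (he₁ i)

variable [Module.IsTorsionFree ℤ Y] {H : Type*} [Group H]

/-- `Z̃_{β^*}(p^*) = π_{1,β}(p)^*`. -/
theorem HandleWord.exists_tildeCenter_dual_equiv (hP : IsSimplyConnected P)
    (ℍ : ReductiveGroup (dualDatum P) H) (β : HandleWord b) (hβ : β.IsCellWord)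
    (p : Fin (β.l + 1) → P.weylGroup) (hp : IsWalk b β.letter p) (hp0 : p 0 = 1)
    (hpl : p (Fin.last β.l) = 1) :
    ∃ e : β.dual.tildeCenter ℍ (dualWalk p) ≃* Diag (β.pi p),
      ∀ (i : ι) (t : Diag (Module.Dual ℤ (P.flip.corootSpan ℤ)))
        (ht : t ∈ β.dual.tildeStab ℍ (dualWalk p)),
        charValue (Submodule.Quotient.mk (P.coroot i))
            (e ⟨β.dual.tildeHom ℍ t, Subgroup.mem_map_of_mem _ ht⟩) =
          charValue ((dualDatum P).root i) t := by
  have := isReduced_dualDatum hP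
  obtain ⟨e₁, he₁⟩ := exists_quotient_equiv hP (β.latticeT p).mkQ.toAddMonoidHom
    (Submodule.mkQ_surjective _) (walkQ (dualBase b) β.dual.letter (dualWalk p) ⊔
      β.dual.handleLattice ((dualDatum P).rootSpan ℤ)) (fun y => by
      rw [← β.map_latticeT hP p hpl]
      exact (Submodule.Quotient.mk_eq_zero _).trans
        ((restrictChar_flip_injective hP).mem_set_image (s := (β.latticeT p : Set Y))).symm)
  obtain ⟨e₂, he₂⟩ := exists_equiv_diag (β.dual.tildeHom ℍ) ((dualDatum P).rootSpan ℤ) _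
    (β.dual.tildeStab ℍ (dualWalk p))
    (sup_le (walkQ_le_rootSpan _ _) β.dual.handleLattice_le)
    (HandleWord.tildeStab_eq_perp ℍ β.dual (β.isCellWord_dual hβ) (dualWalk p)
      ((isWalk_dual_iff β.letter p).2 hp) ((congrArg _ hp0).trans (map_one (dualWeyl P))))
    (fun t _ => HandleWord.tildeHom_eq_one_iff ℍ β.dual t)
  refine ⟨e₂.trans (diagCongr e₁), fun i t ht => ?_⟩
  refine Eq.trans ?_ (he₂ ((dualDatum P).rootSpanMem ℤ i) t ht)
  exact (charValue_diagCongr _ _ _).trans (congrArg (charValue · _) (he₁ (P.coroot i)))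

/-- `Z_{β^*}(p^*) = π̃_{1,β}(p)^*`. -/
theorem HandleWord.exists_center_dual_equiv (hP : IsSimplyConnected P)
    (ℍ : ReductiveGroup (dualDatum P) H) (β : HandleWord b) (hβ : β.IsCellWord)
    (p : Fin (β.l + 1) → P.weylGroup) (hp : IsWalk b β.letter p) (hp0 : p 0 = 1) :
    ∃ e : β.dual.center ℍ (dualWalk p) ≃* Diag (β.tildePi p),
      ∀ (i : ι) (t : Diag (Module.Dual ℤ (P.flip.corootSpan ℤ)))
        (ht : t ∈ β.dual.stab ℍ (dualWalk p)),
        charValue (QuotientAddGroup.mk (P.coroot i))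
            (e ⟨QuotientGroup.mk' _ t, Subgroup.mem_map_of_mem _ ht⟩) =
          charValue ((dualDatum P).root i) t := by
  have := isReduced_dualDatum hP
  obtain ⟨e₁, he₁⟩ := exists_quotient_equiv hP
    (QuotientAddGroup.mk' ((β.tildeLattice p).comap (cocharToLie P)))
    (QuotientAddGroup.mk'_surjective _) _ (fun y =>
      (QuotientAddGroup.eq_zero_iff y).trans (β.mem_comap_tildeLattice_iff hP hβ p y))
  obtain ⟨e₂, he₂⟩ := exists_equiv_diag (QuotientGroup.mk' (torusCenter ℍ))
    ((dualDatum P).rootSpan ℤ) _ (β.dual.stab ℍ (dualWalk p))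
    (sup_le (walkQ_le_rootSpan _ _) β.dual.handleLattice_le)
    (HandleWord.stab_eq_perp ℍ β.dual (β.isCellWord_dual hβ) (dualWalk p)
      ((isWalk_dual_iff β.letter p).2 hp) ((congrArg _ hp0).trans (map_one (dualWeyl P))))
    (fun t _ => mk'_torusCenter_eq_one_iff ℍ (dualBase b) t)
  refine ⟨e₂.trans (diagCongr e₁), fun i t ht => ?_⟩
  refine Eq.trans ?_ (he₂ ((dualDatum P).rootSpanMem ℤ i) t ht)
  exact (charValue_diagCongr _ _ _).trans (congrArg (charValue · _) (he₁ (P.coroot i)))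

end Duality

end WalkDuality

end

open WalkDuality in
theorem mainTheorem6 {ι X Y : Type*} [Finite ι] [AddCommGroup X] [AddCommGroup Y]
    [Module.Finite ℤ X] [Module.Free ℤ X] [Module.Finite ℤ Y] [Module.Free ℤ Y]
    (P : RootDatum ι X Y) [P.IsReduced] (b : P.Base) (hP : IsSimplyConnected P)
    {G H : Type*} [Group G] [Group H]
    (𝔾 : ReductiveGroup P G) (ℍ : ReductiveGroup (dualDatum P) H) :
    (∀ (l : ℕ) (α : Fin l → b.support),
      Set.BijOn dualWalk {p : Fin (l + 1) → P.weylGroup | IsWalk b α p}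
        {q | IsWalk (dualBase b) (dualLetters α) q}) ∧
    (∀ (l : ℕ) (α : Fin l → b.support) (p : Fin (l + 1) → P.weylGroup), IsWalk b α p →
      stays (dualWalk p) = stays p ∧
      (∃ e : walkCenter (dualBase b) (dualLetters α) (dualWalk p) ≃* Diag (walkPi b α p),
        ∀ (f : walkCenter (dualBase b) (dualLetters α) (dualWalk p)) (i : ι),
          charValue (Submodule.Quotient.mk (P.coroot i)) (e f) =
            charValue (Submodule.Quotient.mk ((dualDatum P).rootSpanMem ℤ i)) f) ∧
      (∃ e : Multiplicative (walkPi (dualBase b) (dualLetters α) (dualWalk p)) ≃*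
          walkCenterDual b α p,
        ∀ (i : ι) (f : walkCenter b α p),
          (e (Multiplicative.ofAdd (Submodule.Quotient.mk ((dualDatum P).coroot i)))).1 f =
            charValue (Submodule.Quotient.mk (P.rootSpanMem ℤ i)) f)) ∧
    (∀ (β : HandleWord b) (p : Fin (β.l + 1) → P.weylGroup), β.IsCellWord →
      IsWalk b β.letter p → p 0 = 1 → p (Fin.last β.l) = 1 →
      (β.dual.IsCellWord ∧ IsWalk (dualBase b) β.dual.letter (dualWalk p) ∧
        dualWalk p 0 = 1 ∧ dualWalk p (Fin.last β.l) = 1) ∧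
      (∃ e : Multiplicative (β.dual.pi (dualWalk p)) ≃* β.tildeCenterDual 𝔾 p,
        ∀ (i : ι) (t : Diag X) (ht : t ∈ β.tildeStab 𝔾 p),
          (e (Multiplicative.ofAdd (Submodule.Quotient.mk ((dualDatum P).coroot i)))).1
              ⟨β.tildeHom 𝔾 t, Subgroup.mem_map_of_mem _ ht⟩ = charValue (P.root i) t) ∧
      (∃ e : β.dual.tildeCenter ℍ (dualWalk p) ≃* Diag (β.pi p),
        ∀ (i : ι) (t : Diag (Module.Dual ℤ (P.flip.corootSpan ℤ)))
          (ht : t ∈ β.dual.tildeStab ℍ (dualWalk p)),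
          charValue (Submodule.Quotient.mk (P.coroot i))
              (e ⟨β.dual.tildeHom ℍ t, Subgroup.mem_map_of_mem _ ht⟩) =
            charValue ((dualDatum P).root i) t) ∧
      (∃ e : Multiplicative (β.dual.tildePi (dualWalk p)) ≃* β.centerDual 𝔾 p,
        ∀ (i : ι) (t : Diag X) (ht : t ∈ β.stab 𝔾 p),
          (e (Multiplicative.ofAdd (QuotientAddGroup.mk ((dualDatum P).coroot i)))).1
              ⟨QuotientGroup.mk' _ t, Subgroup.mem_map_of_mem _ ht⟩ = charValue (P.root i) t) ∧
      (∃ e : β.dual.center ℍ (dualWalk p) ≃* Diag (β.tildePi p),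
        ∀ (i : ι) (t : Diag (Module.Dual ℤ (P.flip.corootSpan ℤ)))
          (ht : t ∈ β.dual.stab ℍ (dualWalk p)),
          charValue (QuotientAddGroup.mk (P.coroot i))
              (e ⟨QuotientGroup.mk' _ t, Subgroup.mem_map_of_mem _ ht⟩) =
            charValue ((dualDatum P).root i) t)) := by
  refine ⟨fun l α => dualWalk_bijOn α, fun l α p _ => ⟨stays_dualWalk p,
    exists_walkCenter_dual_equiv hP α p, exists_walkPi_dual_equiv α p⟩,
    fun β p hβ hp hp0 hpl => ⟨⟨β.isCellWord_dual hβ, (isWalk_dual_iff β.letter p).2 hp,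
      (congrArg (dualWeyl P) hp0).trans (map_one _), (congrArg (dualWeyl P) hpl).trans (map_one _)⟩,
    β.exists_pi_dual_equiv 𝔾 hβ p hp hp0 hpl, β.exists_tildeCenter_dual_equiv hP ℍ hβ p hp hp0 hpl,
    β.exists_tildePi_dual_equiv hP 𝔾 hβ p hp hp0, β.exists_center_dual_equiv hP ℍ hβ p hp hp0⟩⟩
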